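/- **Conventions.** A code with finite alphabet $K$ and finite set of positions $I\neq\emptyset$ is a nonempty set $C\subseteq K^I$. Its normalized Hamming distance is $\mathrm{dist}(f,g)=\frac{1}{|I|}\#\{i: f_i\neq g_i\}$, with $\mathrm{dist}(f,C)=\min_{g\in C}\mathrm{dist}(f,g)$. Its relative distance is $\delta(C)=\min\{\mathrm{dist}(f,g): f,g\in C,\ f\neq g\}$ ($=\infty$ if $|C|=1$), and its rate is $r(C)=\log_{|K^I|}|C|$. **Setting.** Let $G$ be a finite group and let $A,B\subseteq G\setminus\{1\}$ be nonempty generating sets of $G$ with $A=A^{-1}$, $B=B^{-1}$ and $gag^{-1}\neq b$ for all $a\in A$, $b\in B$, $g\in G$. Let $X=\mathrm{Cay}(A,G,B)$ be the double Cayley complex: its vertices are the elements of $G$, its edges are $\{g,ag\}$ and $\{g,gb\}$, and for $g\in G$, $a\in A$, $b\in B$ it has a square $\varphi_g(a,b)$ with the corners $g,ag,gb,agb$ and the sides $\{g,ag\},\{g,gb\},\{ag,agb\},\{gb,agb\}$; two squares are equal iff they have the same four sides. $X(2)$ is the set of squares and $X(2)_g$ is the set of squares having the corner $g$; then $\varphi_g:A\times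 B\to X(2)_g$ is a bijection. Let $\mathbb F$ be a finite field, and let $C_A\subseteq\mathbb F^A$, $C_B\subseteq\mathbb F^B$ be linear codes. Let $C_A\otimes C_B$ be the set of matrices in $\mathbb F^{A\times B}$ all of whose rows are in $C_B$ and all of whose columns are in $C_A$. Put $$C=C(A,G,B)=\{f:X(2)\to\mathbb F \;:\; f\circ\varphi_g\in C_A\otimes C_B\ \text{ for all } g\in G\}.$$ The *natural tester* of $C$ picks $g\in G$ uniformly at random, reads $f|_{X(2)_g}$, and accepts $f$ iff $f\circ\varphi_g\in C_A\otimes C_B$. It has *soundness* $\mu$ if it rejects every $f\in\mathbb F^{X(2)}$ with probability at least $\mu\,\mathrm{dist}(f,C)$. **Hypotheses.** Let $\varepsilon\in(0,1]$ and suppose that * (1a) $\delta(C_A)\ge\varepsilon$ and (1b) $\delta(C_B)\ge\varepsilon$; * (1c) $C_A\otimes C_B$ is $\varepsilon$-agreement testable: for all $(f_b\in C_A)_{b\in B}$ and $(f'_a\in C_B)_{a\in A}$ there is $m\in C_A\otimes C_B$, with rows $r_a(m)$ and columns $c_b(m)$, such that $$\varepsilon\Big(\tfrac{\#\{a\in A:\,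 f'_a\ne r_a(m)\}}{2|A|}+\tfrac{\#\{b\in B:\, f_b\neq c_b(m)\}}{2|B|}\Big)\le\tfrac{\#\{(a,b)\in A\times B:\,(f_b)_a\ne (f'_a)_b\}}{|A||B|};$$ * (2) the Cayley graphs $\mathrm{Cay}(A,G)$ (edges $\{g,ag\}$) and $\mathrm{Cay}(G,B)$ (edges $\{g,gb\}$) are $\frac{\varepsilon^2}{2500}$-expanders: all eigenvalues of the normalized adjacency operator on the functions of sum zero lie in $[-1,\frac{\varepsilon^2}{2500}]$. **Conclusion.** Then $$\delta(C)\ge 0.9996\,\varepsilon^3,\qquad r(C)\ge 4r(C_A)r(C_B)-3,$$ and the natural tester of $C$ has soundness $$\frac{1}{2\max\{\frac{|A|}{|B|},\frac{|B|}{|A|}\}\,[250000\varepsilon^{-3}+4800\max\{|A|,|B|\}\varepsilon^{-1}]+1}.$$ Moreover, provided that $|A|,|B|,|\mathbb F|$ are $O(1)$, $C$ has a linear-time decoding algorithm for the words that are $\eta$-close to $C$, where $$\eta=\frac1{|A||B|}\cdot\frac{1}{250000\varepsilon^{-5}+4800\max\{|A|,|B|\}\varepsilon^{-3}}.$$ That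 is, for every $m$ there are a program $P$ for a random access machine (unit-cost arithmetic operations on words of $\log_2 |X(2)|+O(1)$ bits) and a constant $c$, both depending only on $m$, such that whenever the above holds with $|A|,|B|,|\mathbb F|\le m$, the program $P$, given a received word $f\in\mathbb F^{X(2)}$, tables of the maps $(g,a)\mapsto ag$, $(g,b)\mapsto gb$, $(g,a,b)\mapsto\varphi_g(a,b)$ and tables of $C_A$ and $C_B$, outputs after at most $c\,|X(2)|$ steps the codeword $f'\in C$ with $\mathrm{dist}(f,f')<\eta$, if there is one. -/

import Mathlib

noncomputable section

namespace SquareLTC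

/-! ### Error correcting codes

A word over the alphabet `K` with positions `ι` is a function `ι → K`, and a code is a set of
words. -/

section Codes

variable {ι K : Type*} [Fintype ι]

open Classical in
/-- The normalized Hamming distance of two words. -/
def relHamming (f g : ι → K) : ℝ :=
  (hammingDist f g : ℝ) / (Fintype.card ι : ℝ)

/-- The distance `dist(f, C)` of a word from a (nonempty) code. -/
def distToCode (f : ι → K) (C : Set (ι → K)) : ℝ :=
  ⨅ g : C, relHamming f g

/-- The relative distance of a code: the least distance of two distinct codewords, so `⊤` if the
code has a single element. -/
def relDist (C : Set (ι → K)) : EReal :=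
  ⨅ f ∈ C, ⨅ g ∈ C, ⨅ _ : f ≠ g, ((relHamming f g : ℝ) : EReal)

/-- The rate `log_{|K ^ ι|} |C|` of a code. -/
def rate (C : Set (ι → K)) : ℝ :=
  Real.logb (Nat.card (ι → K)) (Nat.card C)

end Codes

/-! ### Lifted codes and their natural testers -/

/-- Small codes `code s ⊆ K ^ (view s)` on a family of subsets `view s` covering the set `M`. -/
structure SmallCodes (S M K : Type*) where
  view : S → Set M
  code : (s : S) → Set (view s → K)
  cover : ∀ i, ∃ s, i ∈ view s

namespace SmallCodes

variable {S M K : Type*} (D : SmallCodes S M K)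

/-- The local view of the word `f` at `s` is in the small code at `s`. -/
def LocallyOk (f : M → K) (s : S) : Prop :=
  (fun i : D.view s => f i) ∈ D.code s

/-- The lifted code determined by small codes. -/
def liftedCode : Set (M → K) :=
  {f | ∀ s, D.LocallyOk f s}

open Classical in
/-- The natural tester picks `s : S` uniformly at random, reads `f` on `view s` and accepts iff
what it read is in the small code at `s`. This is the probability that it rejects `f`. -/
def rejectProb [Fintype S] (f : M → K) : ℝ :=
  ((Finset.univ.filter fun s => ¬ D.LocallyOk f s).card : ℝ) / (Fintype.card S : ℝ)

/-- The natural tester of the lifted code has soundness `μ`. -/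
def TesterHasSoundness [Fintype S] [Fintype M] (μ : ℝ) : Prop :=
  ∀ f : M → K, μ * distToCode f D.liftedCode ≤ D.rejectProb f

end SmallCodes

/-! ### Tensor codes and agreement testability -/

section Tensor

variable {R S F : Type*} [Field F]

/-- The tensor code `C₁ ⊗ C₂`: the `R × S` matrices all of whose columns are in `C₁` and all of
whose rows are in `C₂`. -/
def tensorCode (C₁ : Submodule F (R → F)) (C₂ : Submodule F (S → F)) : Set (R → S → F) :=
  {m | (∀ i, m i ∈ C₂) ∧ ∀ j, (fun i => m i j) ∈ C₁}

open Classical in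
/-- `C₁ ⊗ C₂` is `κ`-agreement testable: given prospective columns `c j ∈ C₁` and rows
`r i ∈ C₂` there is `m ∈ C₁ ⊗ C₂` whose average disagreement with the rows and the columns, times
`κ`, is at most the fraction of entries in which the given rows and columns disagree. -/
def AgreementTestable [Fintype R] [Fintype S]
    (C₁ : Submodule F (R → F)) (C₂ : Submodule F (S → F)) (κ : ℝ) : Prop :=
  ∀ (c : S → R → F) (r : R → S → F), (∀ j, c j ∈ C₁) → (∀ i, r i ∈ C₂) →
    ∃ m ∈ tensorCode C₁ C₂,
      κ * (((Finset.univ.filter fun i => r i ≠ m i).card : ℝ) / (2 * Fintype.card R)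
        + ((Finset.univ.filter fun j => c j ≠ fun i => m i j).card : ℝ) / (2 * Fintype.card S))
      ≤ ((Finset.univ.filter fun p : R × S => c p.2 p.1 ≠ r p.1 p.2).card : ℝ)
          / (Fintype.card R * Fintype.card S)

end Tensor

/-! ### Expander graphs -/

section Expanders

variable {V : Type*} [Fintype V] (Γ : SimpleGraph V)

/-- The natural weight of an edge. -/
def natEdgeWeight : ℝ := 1 / (Nat.card Γ.edgeSet : ℝ)

/-- The natural weight of a vertex. -/
def natVertexWeight (v : V) : ℝ :=
  (Nat.card (Γ.neighborSet v) : ℝ) / (2 * (Nat.card Γ.edgeSet : ℝ))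

open Classical in
/-- The weighted adjacency operator for the natural weights. -/
def adjOp (f : V → ℝ) (v : V) : ℝ :=
  ∑ u ∈ Finset.univ.filter (fun u => Γ.Adj v u),
    natEdgeWeight Γ / (2 * natVertexWeight Γ v) * f u

/-- `Γ` with its natural weights is an `l`-expander: all eigenvalues of the weighted adjacency
operator on the functions of weighted sum zero are in `[-1, l]`. -/
def IsExpander (l : ℝ) : Prop :=
  ∀ (μ : ℝ) (f : V → ℝ), f ≠ 0 → ∑ v, natVertexWeight Γ v * f v = 0 →
    adjOp Γ f = μ • f → μ ∈ Set.Icc (-1) l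

end Expanders

/-- The left Cayley graph `Cay(A, G)`, with the edges `{g, a g}`. The right Cayley graph
`Cay(G, B)` is `SimpleGraph.mulCayley B`. -/
def leftCayley {G : Type*} [Group G] (A : Set G) : SimpleGraph G :=
  SimpleGraph.fromRel fun g h => ∃ a ∈ A, h = a * g

/-! ### The double Cayley complex and the code `C(A, G, B)` -/

section DoubleCayley

variable {G : Type*} [Group G]

/-- The square with the corners `g`, `a g`, `g b`, `a g b`, recorded by its four sides. -/
def square (a g b : G) : Set (Sym2 G) :=
  {s(g, a * g), s(g, g * b), s(a * g, a * g * b), s(g * b, a * g * b)}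

/-- The set `X(2)` of squares of the double Cayley complex `X = Cay(A, G, B)`. -/
abbrev Squares (A B : Finset G) : Type _ :=
  {s : Set (Sym2 G) // ∃ a ∈ A, ∃ g : G, ∃ b ∈ B, s = square a g b}

/-- `φ_g(a, b)`, the square `{g, a g, g b, a g b}`. -/
def phi (A B : Finset G) (g : G) (a : A) (b : B) : Squares A B :=
  ⟨square a g b, a, a.2, g, b, b.2, rfl⟩

/-- The set `X(2)_{g}` of the squares of which `g` is a corner. -/
def squaresAt (A B : Finset G) (g : G) : Set (Squares A B) :=
  {s | ∃ e ∈ s.1, g ∈ e}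

theorem phi_mem (A B : Finset G) (g : G) (a : A) (b : B) : phi A B g a b ∈ squaresAt A B g :=
  ⟨s(g, a * g), Or.inl rfl, Sym2.mem_mk_left _ _⟩

instance [Finite G] (A B : Finset G) : Fintype (Squares A B) := Fintype.ofFinite _

/-- The small codes `C_g ⊆ F ^ X(2)_{g}`, `g ∈ G`, where `C_g` corresponds to `C_A ⊗ C_B` under
the bijection `φ_g : A × B → X(2)_{g}`. -/
def smallCodes {F : Type*} [Field F] (A B : Finset G)
    (CA : Submodule F (A → F)) (CB : Submodule F (B → F)) : SmallCodes G (Squares A B) F where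
  view g := squaresAt A B g
  code g := {u | (fun (a : A) (b : B) => u ⟨phi A B g a b, phi_mem A B g a b⟩) ∈ tensorCode CA CB}
  cover := by
    rintro ⟨s, a, ha, g, b, hb, rfl⟩
    exact ⟨g, phi_mem A B g ⟨a, ha⟩ ⟨b, hb⟩⟩

/-- The code `C(A, G, B) ⊆ F ^ X(2)`. -/
def codeCAGB {F : Type*} [Field F] (A B : Finset G)
    (CA : Submodule F (A → F)) (CB : Submodule F (B → F)) : Set (Squares A B → F) :=
  (smallCodes A B CA CB).liftedCode

/-- For symmetric `A`, `B` that contain no two conjugate elements and not `1`, the map `φ_g` is a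
bijection from `A × B` onto the set of squares at `g`. -/
theorem phi_bijOn (A B : Finset G) (hA : ∀ a ∈ A, a⁻¹ ∈ A) (hB : ∀ b ∈ B, b⁻¹ ∈ B)
    (hA1 : (1 : G) ∉ A) (hB1 : (1 : G) ∉ B)
    (hconj : ∀ a ∈ A, ∀ b ∈ B, ∀ g : G, g * a * g⁻¹ ≠ b) (g : G) :
    Set.BijOn (fun p : A × B => phi A B g p.1 p.2) Set.univ (squaresAt A B g) := by
  have hA' : ∀ a ∈ A, ∀ x : G, x ≠ a * x := fun a ha x h => hA1 (by
    have : a = 1 := by simpa using h.symm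
    exact this ▸ ha)
  have hB' : ∀ b ∈ B, ∀ x : G, x ≠ x * b := fun b hb x h => hB1 (by
    have : b = 1 := by simpa using h.symm
    exact this ▸ hb)
  have hAB : ∀ a ∈ A, ∀ b ∈ B, ∀ x : G, a * x ≠ x * b := fun a ha b hb x h =>
    hconj a ha b hb x⁻¹ (by rw [inv_inv, mul_assoc, h, inv_mul_cancel_left])
  have hABx : ∀ a ∈ A, ∀ b ∈ B, ∀ x : G, x ≠ a * x * b := fun a ha b hb x h =>
    hAB a ha b⁻¹ (hB b hb) x (by rw [eq_mul_inv_iff_mul_eq]; exact h.symm)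
  have key : ∀ a ∈ A, ∀ b ∈ B, ∀ y : G,
      s(g, y) ∈ square a g b ↔ y = a * g ∨ y = g * b := by
    intro a ha b hb y
    simp [square, hA' a ha g, hB' b hb g, hABx a ha b hb g]
  refine ⟨?_, ?_, ?_⟩
  · rintro p -
    exact phi_mem A B g p.1 p.2
  · rintro ⟨⟨a, ha⟩, ⟨b, hb⟩⟩ - ⟨⟨a', ha'⟩, ⟨b', hb'⟩⟩ - h
    have hs : square a g b = square a' g b' := congrArg Subtype.val h
    have h1 := (key a' ha' b' hb' (a * g)).1 (hs ▸ (key a ha b hb _).2 (Or.inl rfl))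
    have h2 := (key a' ha' b' hb' (g * b)).1 (hs ▸ (key a ha b hb _).2 (Or.inr rfl))
    have e1 : a = a' := by
      rcases h1 with h1 | h1
      · exact mul_right_cancel h1
      · exact absurd h1 (hAB a ha b' hb' g)
    have e2 : b = b' := by
      rcases h2 with h2 | h2
      · exact absurd h2.symm (hAB a' ha' b hb g)
      · exact mul_left_cancel h2
    subst e1 e2
    rfl
  · rintro ⟨s, a, ha, x, b, hb, rfl⟩ ⟨e, he, hg⟩
    have hx : g = x ∨ g = a * x ∨ g = x * b ∨ g = a * x * b := by
      rcases he with rfl | rfl | rfl | rfl <;> rcases Sym2.mem_iff.1 hg with h | h <;> simp [h]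
    rcases hx with rfl | rfl | rfl | rfl
    · exact ⟨(⟨a, ha⟩, ⟨b, hb⟩), trivial, rfl⟩
    · refine ⟨(⟨a⁻¹, hA a ha⟩, ⟨b, hb⟩), trivial, Subtype.ext ?_⟩
      ext e
      simp only [phi, square, Set.mem_insert_iff, Set.mem_singleton_iff, mul_assoc,
        inv_mul_cancel_left, Sym2.eq_swap (a := a * x) (b := x),
        Sym2.eq_swap (a := a * (x * b)) (b := x * b)]
      tauto
    · refine ⟨(⟨a, ha⟩, ⟨b⁻¹, hB b hb⟩), trivial, Subtype.ext ?_⟩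
      ext e
      simp only [phi, square, Set.mem_insert_iff, Set.mem_singleton_iff, mul_assoc,
        mul_inv_cancel, mul_one, Sym2.eq_swap (a := x * b) (b := x),
        Sym2.eq_swap (a := a * (x * b)) (b := a * x)]
      tauto
    · refine ⟨(⟨a⁻¹, hA a ha⟩, ⟨b⁻¹, hB b hb⟩), trivial, Subtype.ext ?_⟩
      ext e
      simp only [phi, square, Set.mem_insert_iff, Set.mem_singleton_iff, mul_assoc,
        inv_mul_cancel_left, mul_inv_cancel, mul_one, Sym2.eq_swap (a := x * b) (b := x),
        Sym2.eq_swap (a := a * (x * b)) (b := a * x),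
        Sym2.eq_swap (a := a * x) (b := x),
        Sym2.eq_swap (a := a * (x * b)) (b := x * b)]
      tauto

end DoubleCayley

/-! ### Random access machines

Programs for a random access machine whose memory consists of finitely many arrays of natural
numbers. Every operation takes one unit of time and the numbers that are written to the memory,
as well as the addresses they are written to, are at most `W` (that is, they have about `log₂ W`
bits). -/

/-- Contents of the memory: `σ x i` is the cell `i` of the array `x`. -/
abbrev Store : Type := ℕ → ℕ → ℕ

/-- Arithmetic expressions; `read x i` is the value of the cell `i` of the array `x`, and `sub` is
truncated subtraction. -/
inductive Expr : Type
  | lit (n : ℕ) : Expr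
  | read (x : ℕ) (i : Expr) : Expr
  | add (e e' : Expr) : Expr
  | sub (e e' : Expr) : Expr
  | mul (e e' : Expr) : Expr

namespace Expr

def eval (σ : Store) : Expr → ℕ
  | lit n => n
  | read x i => σ x (i.eval σ)
  | add e e' => e.eval σ + e'.eval σ
  | sub e e' => e.eval σ - e'.eval σ
  | mul e e' => e.eval σ * e'.eval σ

/-- The number of elementary operations in the evaluation of an expression. -/
def cost : Expr → ℕ
  | lit _ => 1
  | read _ i => i.cost + 1
  | add e e' => e.cost + e'.cost + 1
  | sub e e' => e.cost + e'.cost + 1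
  | mul e e' => e.cost + e'.cost + 1

end Expr

/-- Programs. -/
inductive Prog : Type
  | skip : Prog
  /-- write the value of `e` to the cell `i` of the array `x` -/
  | write (x : ℕ) (i e : Expr) : Prog
  | seq (p q : Prog) : Prog
  /-- if `e ≠ 0` then `p` else `q` -/
  | ite (e : Expr) (p q : Prog) : Prog
  /-- while `e ≠ 0` do `p` -/
  | loop (e : Expr) (p : Prog) : Prog

/-- `Runs W p σ τ t`: started on the memory `σ`, the program `p` halts with the memory `τ` after
`t` steps, and all writes respect the bound `W`. -/
inductive Runs (W : ℕ) : Prog → Store → Store → ℕ → Prop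
  | skip (σ : Store) : Runs W .skip σ σ 1
  | write (σ : Store) (x : ℕ) (i e : Expr) (hi : i.eval σ ≤ W) (he : e.eval σ ≤ W) :
      Runs W (.write x i e) σ
        (Function.update σ x (Function.update (σ x) (i.eval σ) (e.eval σ)))
        (i.cost + e.cost + 1)
  | seq {p q : Prog} {σ σ' σ'' : Store} {t t' : ℕ} (hp : Runs W p σ σ' t)
      (hq : Runs W q σ' σ'' t') : Runs W (.seq p q) σ σ'' (t + t')
  | ite_true {e : Expr} {p q : Prog} {σ σ' : Store} {t : ℕ} (he : e.eval σ ≠ 0)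
      (hp : Runs W p σ σ' t) : Runs W (.ite e p q) σ σ' (e.cost + t + 1)
  | ite_false {e : Expr} {p q : Prog} {σ σ' : Store} {t : ℕ} (he : e.eval σ = 0)
      (hq : Runs W q σ σ' t) : Runs W (.ite e p q) σ σ' (e.cost + t + 1)
  | loop_stop {e : Expr} {p : Prog} {σ : Store} (he : e.eval σ = 0) :
      Runs W (.loop e p) σ σ (e.cost + 1)
  | loop_step {e : Expr} {p : Prog} {σ σ' σ'' : Store} {t t' : ℕ} (he : e.eval σ ≠ 0)
      (hp : Runs W p σ σ' t) (hl : Runs W (.loop e p) σ' σ'' t') :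
      Runs W (.loop e p) σ σ'' (e.cost + t + t' + 1)

/-- The result of a run and its number of steps are determined by the program and its input. -/
theorem Runs.deterministic {W : ℕ} {p : Prog} {σ τ τ' : Store} {t t' : ℕ}
    (h : Runs W p σ τ t) (h' : Runs W p σ τ' t') : τ = τ' ∧ t = t' := by
  induction h generalizing τ' t' with
  | skip => cases h'; exact ⟨rfl, rfl⟩
  | write => cases h'; exact ⟨rfl, rfl⟩
  | seq _ _ ihp ihq =>
    cases h' with
    | seq hp hq =>
      obtain ⟨rfl, rfl⟩ := ihp hp
      obtain ⟨rfl, rfl⟩ := ihq hq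
      exact ⟨rfl, rfl⟩
  | ite_true he _ ih =>
    cases h' with
    | ite_true _ hp => obtain ⟨rfl, rfl⟩ := ih hp; exact ⟨rfl, rfl⟩
    | ite_false he' _ => exact absurd he' he
  | ite_false he _ ih =>
    cases h' with
    | ite_true he' _ => exact absurd he he'
    | ite_false _ hq => obtain ⟨rfl, rfl⟩ := ih hq; exact ⟨rfl, rfl⟩
  | loop_stop he =>
    cases h' with
    | loop_stop _ => exact ⟨rfl, rfl⟩
    | loop_step he' _ _ => exact absurd he he'
  | loop_step he _ _ ihp ihl =>
    cases h' with
    | loop_stop he' => exact absurd he' he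
    | loop_step _ hp hl =>
      obtain ⟨rfl, rfl⟩ := ihp hp
      obtain ⟨rfl, rfl⟩ := ihl hl
      exact ⟨rfl, rfl⟩

/-! ### Decoding in linear time -/

/-- Numberings of the group, of the two generating sets, of the field and of the squares. -/
structure Numbering {G : Type*} [Group G] (F : Type*) (A B : Finset G) where
  group : G ≃ Fin (Nat.card G)
  left : A ≃ Fin A.card
  right : B ≃ Fin B.card
  field : F ≃ Fin (Nat.card F)
  squares : Squares A B ≃ Fin (Nat.card (Squares A B))

section Decoding

variable {G : Type*} [Group G] {F : Type*} [Field F] {A B : Finset G}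

/-- The number whose digits in base `|F|` are the letters of the word `u`. -/
def wordIndex {ι : Type*} {k q : ℕ} (pos : ι ≃ Fin k) (letter : F ≃ Fin q) (u : ι → F) : ℕ :=
  ∑ j : Fin k, (letter (u (pos.symm j)) : ℕ) * q ^ (j : ℕ)

/-- The memory `σ` holds the input of a decoder of `C(A, G, B)`: array 0 has the cardinalities of
`G`, `A`, `B`, `F` and `X(2)`; the arrays 1, 2, 3 are the tables of `(g, a) ↦ a g`,
`(g, b) ↦ g b` and `(g, a, b) ↦ {g, a g, g b, a g b}`; array 4 is the received word; the arrays 5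
and 6 are the tables of the membership in `C_A` and `C_B`; all other arrays are zero. -/
structure IsInput (N : Numbering F A B) (CA : Submodule F (A → F)) (CB : Submodule F (B → F))
    (f : Squares A B → F) (σ : Store) : Prop where
  card_group : σ 0 0 = Nat.card G
  card_left : σ 0 1 = A.card
  card_right : σ 0 2 = B.card
  card_field : σ 0 3 = Nat.card F
  card_squares : σ 0 4 = Nat.card (Squares A B)
  left_mul : ∀ (g : G) (a : A), σ 1 (N.group g * A.card + N.left a) = N.group (a * g)
  right_mul : ∀ (g : G) (b : B), σ 2 (N.group g * B.card + N.right b) = N.group (g * b)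
  square : ∀ (g : G) (a : A) (b : B),
    σ 3 ((N.group g * A.card + N.left a) * B.card + N.right b) = N.squares (phi A B g a b)
  word : ∀ s : Squares A B, σ 4 (N.squares s) = N.field (f s)
  mem_left : ∀ u ∈ CA, σ 5 (wordIndex N.left N.field u) = 1
  notMem_left : ∀ u ∉ CA, σ 5 (wordIndex N.left N.field u) = 0
  mem_right : ∀ u ∈ CB, σ 6 (wordIndex N.right N.field u) = 1
  notMem_right : ∀ u ∉ CB, σ 6 (wordIndex N.right N.field u) = 0
  work : ∀ x, 7 ≤ x → ∀ i, σ x i = 0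

/-- With time and word bound `T`, the program `P` decodes the words that are `η`-close to the code
`C(A, G, B)`: whatever the numberings are, on a word `f` at distance less than `η` from a codeword
`f'` it halts after at most `T` steps with `f'` in array 7. -/
def Decodes [Finite G] (P : Prog) (T : ℕ) (A B : Finset G)
    (CA : Submodule F (A → F)) (CB : Submodule F (B → F)) (η : ℝ) : Prop :=
  ∀ (N : Numbering F A B) (f : Squares A B → F), ∀ f' ∈ codeCAGB A B CA CB,
    relHamming f f' < η → ∀ σ : Store, IsInput N CA CB f σ →
      ∃ (τ : Store) (t : ℕ), Runs T P σ τ t ∧ t ≤ T ∧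
        ∀ s : Squares A B, τ 7 (N.squares s) = N.field (f' s)

end Decoding

end SquareLTC

end

noncomputable section

set_option linter.unusedSectionVars false

namespace SquareLTC

/-! ### Square complexes -/

/-! Give every vertex `v` a local view `z v` in `C_A ⊗ C_B`. Call an edge in disagreement if the
views at its two ends differ on the squares that contain it. Let the cost of a vertex be the
weighted number of its edges in disagreement, and let the potential be the sum of all costs. Views
without any disagreement glue to a codeword (`exists_word`). A correction step replaces one view by
an element of `C_A ⊗ C_B` whose cost is less than half as large. This lowers the potential by at
least `min |A| |B|`, so few vertices are changed before the process stops.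

The main point is `potential_of_stable`: if no correction is possible, the potential is zero or
linear in `|G|`. At a vertex `v` the neighbours propose rows and columns. By agreement testability
some `m ∈ C_A ⊗ C_B` has small cost against these proposals unless they often conflict, and a
conflict at an entry is caused by a disagreement on one of the two edges at the corner opposite to
`v` (`disagreements_le`). Stability therefore bounds the cost at `v` by the costs of its neighbours.
Multiplying by the cost at `v` and summing gives the adjacency forms of the two Cayley graphs, and
expansion yields `ε n Q ≤ 9 P²` for `P = ∑ cost`, `Q = ∑ cost²`. A nonzero cost is at least `min |A|
|B|`, so `Q ≥ min |A| |B| * P`, and `P` is large unless it vanishes.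

If a word has few bad views, the views obtained by replacing the bad ones have a small potential, so
correction ends in a codeword near the word; this gives the soundness of the tester. If the word is
close to a codeword, this end point is closer to that codeword than the minimum distance and so
equals it; this gives the decoder. Both constants come out better than stated: the terms with 250000
are not needed.

The distance follows from expansion of the set of vertices at which two codewords have different
views, and the rate from counting linear constraints, as every square has four corners.

For linear time, a stack holds all vertices at which correction may be possible. A correction pushes
the neighbours of the corrected vertex, and `(|A| + |B| + 1) * potential + stack size` decreases in
every round. One program serves all parameters up to `m`: only finitely many sizes, codes and
inversion tables occur, and the program branches to a decoder in which they are hard-coded. -/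

/-- A complex of squares on the vertex set `V`, in which the edges at a vertex are labelled by
`I` (left edges) and `J` (right edges) and the squares at a vertex by `I × J`. -/
structure SquareComplex (V I J X : Type*) where
  left : I → V → V
  right : J → V → V
  invL : I → I
  invR : J → J
  sq : V → I → J → X
  left_left : ∀ i v, left (invL i) (left i v) = v
  right_right : ∀ j v, right (invR j) (right j v) = v
  invL_invL : ∀ i, invL (invL i) = i
  invR_invR : ∀ j, invR (invR j) = j
  left_ne : ∀ i v, left i v ≠ v
  right_ne : ∀ j v, right j v ≠ v
  left_ne_right : ∀ i j v, left i v ≠ right j v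
  comm : ∀ i j v, left i (right j v) = right j (left i v)
  sq_left : ∀ v i j, sq (left i v) (invL i) j = sq v i j
  sq_right : ∀ v i j, sq (right j v) i (invR j) = sq v i j
  exists_sq : ∀ s, ∃ v i j, sq v i j = s
  eq_of_sq_eq : ∀ v i j v' i' j', sq v' i' j' = sq v i j →
    (v', i', j') = (v, i, j) ∨ (v', i', j') = (left i v, invL i, j) ∨
      (v', i', j') = (right j v, i, invR j) ∨
      (v', i', j') = (left i (right j v), invL i, invR j)

/-- The matrices with columns in `CA` and rows in `CB`. -/
def productCode {I J K : Type*} (CA : Set (I → K)) (CB : Set (J → K)) : Set (I → J → K) :=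
  {m | (∀ i, m i ∈ CB) ∧ ∀ j, (fun i => m i j) ∈ CA}

open Classical in
/-- The weighted number of rows and columns of `t` that differ from the prescribed rows `r` and
columns `c`. -/
def localCost {I J K : Type*} [Fintype I] [Fintype J] (t : I → J → K) (r : I → J → K)
    (c : J → I → K) : ℕ :=
  Fintype.card J * (∑ i, if t i = r i then 0 else 1) +
    Fintype.card I * ∑ j, if (fun i => t i j) = c j then 0 else 1

/-- A sum over the oriented edges of a graph splits into the edges at `v₀` and the others. -/
theorem sum_darts {V I : Type*} [Fintype V] [Fintype I] [DecidableEq V] (l : I → V → V)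
    (inv : I → I) (hl : ∀ i v, l (inv i) (l i v) = v) (hinv : ∀ i, inv (inv i) = i)
    (hne : ∀ i v, l i v ≠ v) (g : V → I → ℕ) (hg : ∀ v i, g (l i v) (inv i) = g v i) (v₀ : V) :
    ∑ v, ∑ i, g v i = 2 * ∑ i, g v₀ i +
      ∑ v, ∑ i, if v = v₀ ∨ l i v = v₀ then 0 else g v i := by
  have hl' : ∀ i v, l i (l (inv i) v) = v := fun i v => by
    have := hl (inv i) v
    rwa [hinv] at this
  have h1 : ∑ v, ∑ i, (if v = v₀ then g v i else 0) = ∑ i, g v₀ i := by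
    rw [Finset.sum_comm]
    simp
  have h2 : ∑ v, ∑ i, (if l i v = v₀ then g v i else 0) = ∑ i, g v₀ i := by
    rw [Finset.sum_comm]
    -- For each label exactly one dart ends at `v₀`; reversing it gives a dart that starts there.
    have : ∀ i, ∑ v, (if l i v = v₀ then g v i else 0) = g v₀ (inv i) := by
      intro i
      rw [Finset.sum_eq_single (l (inv i) v₀)]
      · rw [if_pos (hl' i v₀), ← hg, hl']
      · intro v _ hv
        rw [if_neg]
        rintro rfl
        exact hv (hl i v).symm
      · simp
    rw [Finset.sum_congr rfl fun i _ => this i]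
    exact Fintype.sum_bijective inv (Function.Involutive.bijective hinv) _ _ fun _ => rfl
  rw [two_mul]
  nth_rewrite 1 [← h1]
  rw [← h2, ← Finset.sum_add_distrib, ← Finset.sum_add_distrib]
  refine Finset.sum_congr rfl fun v _ => ?_
  rw [← Finset.sum_add_distrib, ← Finset.sum_add_distrib]
  refine Finset.sum_congr rfl fun i _ => ?_
  have := hne i v
  by_cases hv : v = v₀
  · subst hv
    simp [this]
  · simp [hv]
    split_ifs <;> simp

/-! ### Local views, their potential, and correction steps -/

namespace SquareComplex

variable {V I J X K : Type*} (S : SquareComplex V I J X)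

theorem left_left' (i : I) (v : V) : S.left i (S.left (S.invL i) v) = v := by
  have := S.left_left (S.invL i) v
  rwa [S.invL_invL] at this

theorem right_right' (j : J) (v : V) : S.right j (S.right (S.invR j) v) = v := by
  have := S.right_right (S.invR j) v
  rwa [S.invR_invR] at this

/-- Exchanging the left and the right edges. -/
def swap : SquareComplex V J I X where
  left := S.right
  right := S.left
  invL := S.invR
  invR := S.invL
  sq v j i := S.sq v i j
  left_left := S.right_right
  right_right := S.left_left
  invL_invL := S.invR_invR
  invR_invR := S.invL_invL
  left_ne := S.right_ne
  right_ne := S.left_ne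
  left_ne_right i j v := (S.left_ne_right j i v).symm
  comm i j v := (S.comm j i v).symm
  sq_left v i j := S.sq_right v j i
  sq_right v i j := S.sq_left v j i
  exists_sq s := by
    obtain ⟨v, i, j, h⟩ := S.exists_sq s
    exact ⟨v, j, i, h⟩
  eq_of_sq_eq v i j v' i' j' h := by
    have := S.eq_of_sq_eq v j i v' j' i' h
    simp only [Prod.mk.injEq, S.comm] at this ⊢
    tauto

/-- The view of a word at a vertex. -/
def viewAt (f : X → K) (v : V) : I → J → K := fun i j => f (S.sq v i j)

/-- The words all of whose views are in the product code. -/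
def code (CA : Set (I → K)) (CB : Set (J → K)) : Set (X → K) :=
  {f | ∀ v, S.viewAt f v ∈ productCode CA CB}

/-- The rows that the left neighbours of `v` propose. -/
def rowsAt (z : V → I → J → K) (v : V) : I → J → K := fun i j => z (S.left i v) (S.invL i) j

/-- The columns that the right neighbours of `v` propose. -/
def colsAt (z : V → I → J → K) (v : V) : J → I → K := fun j i => z (S.right j v) i (S.invR j)

variable [Fintype V] [Fintype I] [Fintype J]

/-- The weighted number of neighbours of `v` that disagree with `v`. -/
def costAt (z : V → I → J → K) (v : V) : ℕ := localCost (z v) (S.rowsAt z v) (S.colsAt z v)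

/-- The weighted number of disagreements. -/
def potential (z : V → I → J → K) : ℕ := ∑ v, S.costAt z v

open Classical in
-- Darts that avoid `v₀` do not see the change, and the edges at `v₀` are counted once from either
-- end, which gives the factor 2. The old and new terms at `v₀` are on opposite sides to avoid
-- subtraction in `ℕ`.
theorem sum_update (z : V → I → J → K) (v₀ : V) (t : I → J → K) :
    (∑ v, ∑ i, if Function.update z v₀ t v i = S.rowsAt (Function.update z v₀ t) v i then 0 else 1)
      + 2 * ∑ i, (if z v₀ i = S.rowsAt z v₀ i then 0 else 1)
    = (∑ v, ∑ i, if z v i = S.rowsAt z v i then 0 else 1)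
      + 2 * ∑ i, (if t i = S.rowsAt z v₀ i then 0 else 1) := by
  have key : ∀ w : V → I → J → K, ∀ v i,
      (if w (S.left i v) (S.invL i) = S.rowsAt w (S.left i v) (S.invL i) then 0 else 1)
        = if w v i = S.rowsAt w v i then 0 else 1 := by
    intro w v i
    have h1 : S.rowsAt w (S.left i v) (S.invL i) = w v i := by
      funext j
      simp [rowsAt, S.left_left, S.invL_invL]
    have h2 : S.rowsAt w v i = w (S.left i v) (S.invL i) := rfl
    rw [h1, h2]
    simp only [eq_comm]
  have e1 := sum_darts S.left S.invL S.left_left S.invL_invL S.left_ne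
    (fun v i => if Function.update z v₀ t v i = S.rowsAt (Function.update z v₀ t) v i
      then 0 else 1) (key (Function.update z v₀ t)) v₀
  have e2 := sum_darts S.left S.invL S.left_left S.invL_invL S.left_ne
    (fun v i => if z v i = S.rowsAt z v i then 0 else 1) (key z) v₀
  rw [e1, e2]
  have h1 : ∀ i, S.rowsAt (Function.update z v₀ t) v₀ i = S.rowsAt z v₀ i := by
    intro i
    funext j
    simp [rowsAt, Function.update_of_ne (S.left_ne i v₀)]
  have h2 : ∀ v i, (if v = v₀ ∨ S.left i v = v₀ then 0 else
      if Function.update z v₀ t v i = S.rowsAt (Function.update z v₀ t) v i then 0 else 1)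
      = if v = v₀ ∨ S.left i v = v₀ then 0 else if z v i = S.rowsAt z v i then 0 else 1 := by
    intro v i
    by_cases h : v = v₀ ∨ S.left i v = v₀
    · simp [h]
    · rw [if_neg h, if_neg h]
      push Not at h
      have hr : S.rowsAt (Function.update z v₀ t) v i = S.rowsAt z v i := by
        funext j
        simp only [rowsAt, Function.update_of_ne h.2]
      rw [hr, Function.update_of_ne h.1]
  simp only [h1, h2, Function.update_self]
  ring

open Classical in
-- The row part is `sum_update` and the column part is `sum_update` for the complex with left and
-- right exchanged; they are added with the weights of `localCost`.
theorem potential_update (z : V → I → J → K) (v₀ : V) (t : I → J → K) :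
    S.potential (Function.update z v₀ t) + 2 * S.costAt z v₀ =
      S.potential z + 2 * localCost t (S.rowsAt z v₀) (S.colsAt z v₀) := by
  have h1 := S.sum_update z v₀ t
  have h2 := S.swap.sum_update (fun v j i => z v i j) v₀ (fun j i => t i j)
  have h3 : Function.update (fun v j i => z v i j) v₀ (fun j i => t i j) =
      fun v j i => Function.update z v₀ t v i j := by
    funext v j i
    by_cases h : v = v₀
    · subst h; simp
    · simp [h]
  rw [h3] at h2
  change (∑ v, ∑ j, if (fun i => Function.update z v₀ t v i j)
      = S.colsAt (Function.update z v₀ t) v j then 0 else 1)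
      + 2 * ∑ j, (if (fun i => z v₀ i j) = S.colsAt z v₀ j then 0 else 1)
    = (∑ v, ∑ j, if (fun i => z v i j) = S.colsAt z v j then 0 else 1)
      + 2 * ∑ j, (if (fun i => t i j) = S.colsAt z v₀ j then 0 else 1) at h2
  simp only [potential, costAt, localCost, Finset.sum_add_distrib, ← Finset.mul_sum]
  linear_combination (Fintype.card J) * h1 + (Fintype.card I) * h2

/-- A correction step: a local view is replaced by one whose cost is less than half as large. -/
def Step (L : Set (I → J → K)) (z z' : V → I → J → K) : Prop :=
  ∃ v, z' v ∈ L ∧ 2 * localCost (z' v) (S.rowsAt z v) (S.colsAt z v) < S.costAt z v ∧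
    ∀ u ≠ v, z' u = z u

/-- No correction step is possible at `v`. -/
def Stable (L : Set (I → J → K)) (z : V → I → J → K) (v : V) : Prop :=
  ∀ t ∈ L, S.costAt z v ≤ 2 * localCost t (S.rowsAt z v) (S.colsAt z v)

/-- A cost is a sum of multiples of `|I|` and `|J|`. This gap above zero bounds the gain of a
correction step from below, and it bounds the sum of squared costs by the sum of costs in
`potential_of_stable`. -/
theorem min_le_localCost (t r : I → J → K) (c : J → I → K) (h : localCost t r c ≠ 0) :
    min (Fintype.card I) (Fintype.card J) ≤ localCost t r c := by
  classical
  unfold localCost at *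
  rcases Nat.eq_zero_or_pos (∑ i, if t i = r i then 0 else 1) with h1 | h1
  · rcases Nat.eq_zero_or_pos (∑ j, if (fun i => t i j) = c j then 0 else 1) with h2 | h2
    · simp [h1, h2] at h
    · exact (min_le_left _ _).trans ((Nat.le_mul_of_pos_right _ h2).trans (Nat.le_add_left _ _))
  · exact (min_le_right _ _).trans ((Nat.le_mul_of_pos_right _ h1).trans (Nat.le_add_right _ _))

/-- The potential drops by twice the drop of the cost at the corrected vertex. As the cost is more
than halved, this exceeds the old cost, which is nonzero. -/
theorem Step.potential_le {L : Set (I → J → K)} {z z' : V → I → J → K} (h : S.Step L z z') :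
    S.potential z' + min (Fintype.card I) (Fintype.card J) ≤ S.potential z ∧
      S.potential z' < S.potential z := by
  classical
  obtain ⟨v, -, h, hz⟩ := h
  have h1 := S.potential_update z v (z' v)
  rw [← Function.eq_update_iff.2 ⟨rfl, hz⟩] at h1
  have h2 := min_le_localCost (z v) (S.rowsAt z v) (S.colsAt z v)
    (by unfold costAt at h; omega)
  change _ ≤ S.costAt z v at h2
  omega

open Classical in
-- Every step changes one vertex and pays for it with `min |I| |J|` of potential.
theorem steps_changed {L : Set (I → J → K)} {z₀ z : V → I → J → K}
    (h : Relation.ReflTransGen (S.Step L) z₀ z) :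
    (Finset.univ.filter fun v => z v ≠ z₀ v).card * min (Fintype.card I) (Fintype.card J)
      + S.potential z ≤ S.potential z₀ := by
  induction h with
  | refl => simp
  | tail h1 h2 ih =>
    rename_i y y'
    have h3 := (Step.potential_le S h2).1
    obtain ⟨v, -, -, hv⟩ := h2
    have h4 : (Finset.univ.filter fun u => y' u ≠ z₀ u) ⊆
        insert v (Finset.univ.filter fun u => y u ≠ z₀ u) := by
      intro u hu
      by_cases huv : u = v
      · simp [huv]
      · simpa [huv, hv u huv] using hu
    have h5 := (Finset.card_le_card h4).trans (Finset.card_insert_le _ _)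
    have h6 := Nat.mul_le_mul_right (min (Fintype.card I) (Fintype.card J)) h5
    rw [Nat.add_mul] at h6
    omega

theorem steps_mem {L : Set (I → J → K)} {z₀ z : V → I → J → K} (h₀ : ∀ v, z₀ v ∈ L)
    (h : Relation.ReflTransGen (S.Step L) z₀ z) (v : V) : z v ∈ L := by
  induction h with
  | refl => exact h₀ v
  | tail h1 h2 ih =>
    obtain ⟨u, hu, -, hz⟩ := h2
    by_cases hv : v = u
    · exact hv ▸ hu
    · exact hz v hv ▸ ih

/-- The potential strictly decreases in every step, so greedy correction terminates. -/
theorem exists_stable (L : Set (I → J → K)) (z₀ : V → I → J → K) :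
    ∃ z, Relation.ReflTransGen (S.Step L) z₀ z ∧ ∀ v, S.Stable L z v := by
  induction h : S.potential z₀ using Nat.strong_induction_on generalizing z₀ with
  | _ k ih =>
    by_cases hs : ∀ v, S.Stable L z₀ v
    · exact ⟨z₀, .refl, hs⟩
    · unfold Stable at hs
      push Not at hs
      obtain ⟨v, t, ht, hlt⟩ := hs
      classical
      have hstep : S.Step L z₀ (Function.update z₀ v t) :=
        ⟨v, by simpa, by simpa, fun u hu => Function.update_of_ne hu _ _⟩
      obtain ⟨z, hz, hz'⟩ := ih _ (h ▸ (Step.potential_le S hstep).2) _ rfl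
      exact ⟨z, .head hstep hz, hz'⟩

end SquareComplex

/-! ### Corners of squares, gluing of views, and the potential of stable views -/

namespace SquareComplex

variable {V I J X K : Type*} (S : SquareComplex V I J X)

open Classical in
/-- Every square has four corners. -/
theorem sum_corners [Fintype V] [Fintype I] [Fintype J] [Fintype X] (p : X → ℕ) :
    ∑ v, ∑ i, ∑ j, p (S.sq v i j) = 4 * ∑ s, p s := by
  have h1 : ∑ v, ∑ i, ∑ j, p (S.sq v i j) = ∑ x : V × I × J, p (S.sq x.1 x.2.1 x.2.2) := by
    simp [Fintype.sum_prod_type]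
  rw [h1, ← Finset.sum_fiberwise Finset.univ (fun x : V × I × J => S.sq x.1 x.2.1 x.2.2),
    Finset.mul_sum]
  refine Finset.sum_congr rfl fun s _ => ?_
  obtain ⟨v, i, j, rfl⟩ := S.exists_sq s
  rw [Finset.sum_congr rfl (g := fun _ => p (S.sq v i j))
    (fun x hx => by rw [(Finset.mem_filter.1 hx).2]), Finset.sum_const, smul_eq_mul]
  congr 1
  -- The fibre over a square consists of its descriptions from its four corners; the inequalities
  -- below show that these corners are distinct.
  have h2 : (Finset.univ.filter fun x : V × I × J => S.sq x.1 x.2.1 x.2.2 = S.sq v i j) =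
      {(v, i, j), (S.left i v, S.invL i, j), (S.right j v, i, S.invR j),
        (S.left i (S.right j v), S.invL i, S.invR j)} := by
    ext ⟨v', i', j'⟩
    simp only [Finset.mem_filter, Finset.mem_univ, true_and, Finset.mem_insert,
      Finset.mem_singleton]
    constructor
    · exact S.eq_of_sq_eq v i j v' i' j'
    · simp only [Prod.mk.injEq]
      rintro (⟨rfl, rfl, rfl⟩ | ⟨rfl, rfl, rfl⟩ | ⟨rfl, rfl, rfl⟩ | ⟨rfl, rfl, rfl⟩)
      · rfl
      · exact S.sq_left _ _ _
      · exact S.sq_right _ _ _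
      · rw [S.sq_left, S.sq_right]
  rw [h2]
  have n1 := S.left_ne i v
  have n2 := S.right_ne j v
  have n3 := S.left_ne_right i j v
  have n4 := S.left_ne i (S.right j v)
  have n5 : S.left i (S.right j v) ≠ S.left i v := fun h => by
    have := congrArg (S.left (S.invL i)) h
    rw [S.left_left, S.left_left] at this
    exact n2 this
  have n6 : S.left i (S.right j v) ≠ v := fun h => by
    have := congrArg (S.left (S.invL i)) h
    rw [S.left_left] at this
    exact S.left_ne_right _ _ _ this.symm
  rw [Finset.card_insert_of_notMem, Finset.card_insert_of_notMem, Finset.card_insert_of_notMem,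
    Finset.card_singleton]
  all_goals simp [n1.symm, n2.symm, n3, n4.symm, n5.symm, n6.symm]

theorem card_squares (S : SquareComplex V I J X) [Fintype V] [Fintype I] [Fintype J] [Fintype X] :
    4 * Fintype.card X = Fintype.card V * Fintype.card I * Fintype.card J := by
  have := S.sum_corners (fun _ => 1)
  simp at this
  rw [← this, mul_assoc]

/-- Local views without disagreement come from a word. -/
theorem exists_word (z : V → I → J → K) (hA : ∀ v, S.rowsAt z v = z v)
    (hB : ∀ v j i, S.colsAt z v j i = z v i j) : ∃ f : X → K, ∀ v, S.viewAt f v = z v := by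
  have key : ∀ v i j v' i' j', S.sq v' i' j' = S.sq v i j → z v' i' j' = z v i j := by
    intro v i j v' i' j' h
    have hA' : ∀ v i j, z (S.left i v) (S.invL i) j = z v i j := fun v i j =>
      congrFun (congrFun (hA v) i) j
    have := S.eq_of_sq_eq _ _ _ _ _ _ h
    simp only [Prod.mk.injEq] at this
    rcases this with ⟨rfl, rfl, rfl⟩ | ⟨rfl, rfl, rfl⟩ | ⟨rfl, rfl, rfl⟩ | ⟨rfl, rfl, rfl⟩
    · rfl
    · exact hA' _ _ _
    · exact hB _ _ _
    · rw [hA']; exact hB _ _ _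
  choose a b c h using S.exists_sq
  refine ⟨fun s => z (a s) (b s) (c s), fun v => ?_⟩
  funext i j
  exact key _ _ _ _ _ _ (h _)

variable [Fintype V] [Fintype I] [Fintype J]

/-- The adjacency form of the graph with the edges `{v, m i v}` is bounded as in an `l`-expander. -/
def ExpanderForm {V I : Type*} [Fintype V] [Fintype I] (m : I → V → V) (l : ℝ) : Prop :=
  ∀ h : V → ℝ, Fintype.card V * ∑ v, h v * ∑ i, h (m i v) ≤
    Fintype.card I * ((∑ v, h v) ^ 2 + l * Fintype.card V * ∑ v, h v ^ 2)

open Classical in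
/-- `κ`-agreement testability of the product code in terms of local costs. -/
def CostTestable (CA : Set (I → K)) (CB : Set (J → K)) (κ : ℝ) : Prop :=
  ∀ (r : I → J → K) (c : J → I → K), (∀ i, r i ∈ CB) → (∀ j, c j ∈ CA) →
    ∃ m ∈ productCode CA CB, κ * localCost m r c ≤
      2 * ∑ i, ∑ j, if c j i = r i j then (0 : ℝ) else 1

variable {S}

open Classical in
/-- The number of left neighbours that disagree with `v`. -/
def leftDis (S : SquareComplex V I J X) (z : V → I → J → K) (v : V) : ℝ :=
  ∑ i, if z v i = S.rowsAt z v i then 0 else 1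

open Classical in
/-- The number of right neighbours that disagree with `v`. -/
def rightDis (S : SquareComplex V I J X) (z : V → I → J → K) (v : V) : ℝ :=
  ∑ j, if (fun i => z v i j) = S.colsAt z v j then 0 else 1

theorem leftDis_nonneg (z : V → I → J → K) (v : V) : 0 ≤ S.leftDis z v :=
  Finset.sum_nonneg fun i _ => by split_ifs <;> norm_num

theorem rightDis_nonneg (z : V → I → J → K) (v : V) : 0 ≤ S.rightDis z v :=
  Finset.sum_nonneg fun i _ => by split_ifs <;> norm_num

theorem costAt_eq (z : V → I → J → K) (v : V) :
    (S.costAt z v : ℝ) = Fintype.card J * S.leftDis z v + Fintype.card I * S.rightDis z v := by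
  simp [costAt, localCost, leftDis, rightDis]

open Classical in
-- Let `w` be the corner opposite to `v` in the square with the labels `i`, `j`. If the right
-- neighbour of `v` agrees with `w` along their left edge and the left neighbour agrees with `w`
-- along their right edge, then both proposals for the entry `(i, j)` equal the entry of `z w` at
-- this square. Hence every conflict is charged to a disagreement on an edge at `w`, one step away
-- from `v`.
theorem disagreements_le (z : V → I → J → K) (v : V) :
    (∑ i, ∑ j, if S.colsAt z v j i = S.rowsAt z v i j then (0 : ℝ) else 1) ≤
      ∑ j, S.leftDis z (S.right j v) + ∑ i, S.rightDis z (S.left i v) := by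
  unfold leftDis rightDis
  rw [Finset.sum_comm (s := (Finset.univ : Finset J)), ← Finset.sum_add_distrib]
  refine Finset.sum_le_sum fun i _ => ?_
  rw [← Finset.sum_add_distrib]
  refine Finset.sum_le_sum fun j _ => ?_
  by_cases h1 : z (S.right j v) i = S.rowsAt z (S.right j v) i
  · by_cases h2 : (fun i' => z (S.left i v) i' j) = S.colsAt z (S.left i v) j
    · have e1 := congrFun h1 (S.invR j)
      have e2 := congrFun h2 (S.invL i)
      have : S.colsAt z v j i = S.rowsAt z v i j := by
        unfold colsAt rowsAt at *
        rw [e1, e2, S.comm]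
      simp [this, h1, h2]
    · simp only [h2, if_false]
      split_ifs <;> norm_num
  · simp only [h1, if_false]
    split_ifs <;> norm_num

/-- If no correction step is possible, there are no disagreements or there are many. -/
theorem potential_of_stable {CA : Set (I → K)} {CB : Set (J → K)} {ε : ℝ} (hε : 0 < ε)
    (hε1 : ε ≤ 1) [Nonempty I] [Nonempty J]
    (hagr : CostTestable CA CB ε) (hL : ExpanderForm S.left (ε ^ 2 / 2500))
    (hR : ExpanderForm S.right (ε ^ 2 / 2500)) {z : V → I → J → K}
    (hz : ∀ v, z v ∈ productCode CA CB) (hs : ∀ v, S.Stable (productCode CA CB) z v)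
    (hpos : S.potential z ≠ 0) :
    (Fintype.card I * Fintype.card J * (ε * Fintype.card V) : ℝ) ≤
      9 * max (Fintype.card I : ℝ) (Fintype.card J) * S.potential z := by
  have ha : (0 : ℝ) < Fintype.card I := by exact_mod_cast Fintype.card_pos
  have hb : (0 : ℝ) < Fintype.card J := by exact_mod_cast Fintype.card_pos
  set a : ℝ := (Fintype.card I : ℝ) with ha_def
  set b : ℝ := (Fintype.card J : ℝ) with hb_def
  set n : ℝ := (Fintype.card V : ℝ) with hn_def
  set C : V → ℝ := fun v => S.costAt z v with hC
  have hC0 : ∀ v, 0 ≤ C v := fun v => Nat.cast_nonneg _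
  set P : ℝ := ∑ v, C v with hP
  set Q : ℝ := ∑ v, C v ^ 2 with hQ
  have hPpot : (S.potential z : ℝ) = P := by simp [potential, hP, hC]
  have hP0 : 0 < P := by
    rw [← hPpot]
    exact_mod_cast Nat.pos_of_ne_zero hpos
  -- Compare with the codeword `m` that agreement testability supplies: stability loses a factor 2,
  -- `CostTestable` another 2. Each one-sided disagreement count is then bounded by a full cost,
  -- divided by `b` or `a`.
  have h1 : ∀ v, ε * a * b * C v ≤
      4 * (a * ∑ j, C (S.right j v) + b * ∑ i, C (S.left i v)) := by
    intro v
    obtain ⟨m, hm, hmc⟩ := hagr (S.rowsAt z v) (S.colsAt z v)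
      (fun i => (hz _).1 _) (fun j => (hz _).2 _)
    have h2 : C v ≤ 2 * localCost m (S.rowsAt z v) (S.colsAt z v) := by
      simp only [hC]
      exact_mod_cast hs v m hm
    have h3 := hmc.trans (mul_le_mul_of_nonneg_left (disagreements_le z v) (by norm_num))
    have h4 : b * ∑ j, S.leftDis z (S.right j v) ≤ ∑ j, C (S.right j v) := by
      rw [Finset.mul_sum]
      refine Finset.sum_le_sum fun j _ => ?_
      simp only [hC, costAt_eq]
      have := mul_nonneg ha.le (S.rightDis_nonneg z (S.right j v))
      linarith
    have h5 : a * ∑ i, S.rightDis z (S.left i v) ≤ ∑ i, C (S.left i v) := by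
      rw [Finset.mul_sum]
      refine Finset.sum_le_sum fun i _ => ?_
      simp only [hC, costAt_eq]
      have := mul_nonneg hb.le (S.leftDis_nonneg z (S.left i v))
      linarith
    have h6 := mul_le_mul_of_nonneg_left h4 ha.le
    have h7 := mul_le_mul_of_nonneg_left h5 hb.le
    have h8 : ε * C v ≤ 4 * (∑ j, S.leftDis z (S.right j v) + ∑ i, S.rightDis z (S.left i v)) := by
      have := mul_le_mul_of_nonneg_left h2 hε.le
      linarith
    have h9 := mul_le_mul_of_nonneg_left h8 (mul_pos ha hb).le
    linarith
  -- Multiplying by `C v` and summing turns the neighbour sums into the adjacency forms of the two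
  -- graphs.
  have h2 : ε * a * b * Q ≤ 4 * (a * ∑ v, C v * ∑ j, C (S.right j v) +
      b * ∑ v, C v * ∑ i, C (S.left i v)) := by
    rw [hQ, Finset.mul_sum, Finset.mul_sum, Finset.mul_sum, ← Finset.sum_add_distrib,
      Finset.mul_sum]
    refine Finset.sum_le_sum fun v _ => ?_
    have := mul_le_mul_of_nonneg_left (h1 v) (hC0 v)
    linarith
  have h3 := hL C
  have h4 := hR C
  have hn0 : 0 ≤ n := Nat.cast_nonneg _
  have h5 : (a * b) * (ε * n * Q) ≤ (a * b) * (8 * (P ^ 2 + ε ^ 2 / 2500 * n * Q)) := by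
    have e2 := mul_le_mul_of_nonneg_left h2 hn0
    have e3 := mul_le_mul_of_nonneg_left h3 hb.le
    have e4 := mul_le_mul_of_nonneg_left h4 ha.le
    linarith
  have h6 := le_of_mul_le_mul_left h5 (mul_pos ha hb)
  -- Every cost is either zero or at least `min a b`.
  have h7 : min a b * P ≤ Q := by
    rw [hP, hQ, Finset.mul_sum]
    refine Finset.sum_le_sum fun v _ => ?_
    by_cases hv : S.costAt z v = 0
    · simp [hC, hv]
    · have : min a b ≤ C v := by
        have := min_le_localCost _ _ _ hv
        simp only [hC, ha_def, hb_def]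
        exact_mod_cast this
      nlinarith [hC0 v]
  -- Expansion absorbs the diagonal term: `8 * ε ^ 2 / 2500 ≤ ε / 9` because `ε ≤ 1`.
  have h8 : (8 / 9 * ε) * (n * Q) ≤ 8 * P ^ 2 := by
    have : 0 ≤ n * Q := mul_nonneg hn0 (Finset.sum_nonneg fun _ _ => sq_nonneg _)
    nlinarith [mul_nonneg (mul_nonneg hε.le (sub_nonneg.2 hε1)) this, mul_nonneg hε.le this]
  have h9 : P * (ε * n * min a b) ≤ P * (9 * P) := by
    have := mul_le_mul_of_nonneg_left h7 (mul_nonneg hε.le hn0)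
    linarith
  have h10 := le_of_mul_le_mul_left h9 hP0
  rw [hPpot, ← min_mul_max a b]
  have := mul_le_mul_of_nonneg_left h10 (le_max_of_le_left ha.le : 0 ≤ max a b)
  linarith

open Classical in
-- Two vertices that both carry the views of `y` agree along their edge, so an edge in disagreement
-- has a bad end. Counting darts by their two ends gives at most `2 |I| * bad` row disagreements and
-- `2 |J| * bad` column disagreements; with the weights, each kind contributes `2 |I| |J| * bad`.
theorem potential_le_bad (z : V → I → J → K) (y : X → K) :
    S.potential z ≤ 4 * (Fintype.card I * Fintype.card J) *
      (Finset.univ.filter fun v => z v ≠ S.viewAt y v).card := by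
  set bad : V → ℕ := fun v => if z v = S.viewAt y v then 0 else 1 with hbad
  have hcard : (Finset.univ.filter fun v => z v ≠ S.viewAt y v).card = ∑ v, bad v := by
    simp [hbad, Finset.card_filter]
  have h1 : ∀ v i, (if z v i = S.rowsAt z v i then 0 else 1) ≤ bad v + bad (S.left i v) := by
    intro v i
    by_cases e1 : z v = S.viewAt y v
    · by_cases e2 : z (S.left i v) = S.viewAt y (S.left i v)
      · have : z v i = S.rowsAt z v i := by
          funext j
          simp only [rowsAt, e1, e2, viewAt, S.sq_left]
        simp [this]
      · simp only [hbad, e2, if_false]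
        split_ifs <;> omega
    · simp only [hbad, e1, if_false]
      split_ifs <;> omega
  have h2 : ∀ v j, (if (fun i => z v i j) = S.colsAt z v j then 0 else 1) ≤
      bad v + bad (S.right j v) := by
    intro v j
    by_cases e1 : z v = S.viewAt y v
    · by_cases e2 : z (S.right j v) = S.viewAt y (S.right j v)
      · have : (fun i => z v i j) = S.colsAt z v j := by
          funext i
          simp only [colsAt, e1, e2, viewAt, S.sq_right]
        simp [this]
      · simp only [hbad, e2, if_false]
        split_ifs <;> omega
    · simp only [hbad, e1, if_false]
      split_ifs <;> omega
  have h3 : ∀ i, ∑ v, bad (S.left i v) = ∑ v, bad v := fun i =>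
    Fintype.sum_bijective (S.left i) ⟨Function.LeftInverse.injective (S.left_left i),
      Function.RightInverse.surjective (S.left_left' i)⟩ _ _ fun _ => rfl
  have h4 : ∀ j, ∑ v, bad (S.right j v) = ∑ v, bad v := fun j =>
    Fintype.sum_bijective (S.right j) ⟨Function.LeftInverse.injective (S.right_right j),
      Function.RightInverse.surjective (S.right_right' j)⟩ _ _ fun _ => rfl
  have h5 : ∑ v, ∑ i, (if z v i = S.rowsAt z v i then 0 else 1) ≤
      Fintype.card I * (2 * ∑ v, bad v) := by
    rw [Finset.sum_comm]
    refine (Finset.sum_le_sum fun i _ => Finset.sum_le_sum fun v _ => h1 v i).trans ?_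
    simp only [Finset.sum_add_distrib, h3]
    simp [two_mul, mul_add]
  have h6 : ∑ v, ∑ j, (if (fun i => z v i j) = S.colsAt z v j then 0 else 1) ≤
      Fintype.card J * (2 * ∑ v, bad v) := by
    rw [Finset.sum_comm]
    refine (Finset.sum_le_sum fun j _ => Finset.sum_le_sum fun v _ => h2 v j).trans ?_
    simp only [Finset.sum_add_distrib, h4]
    simp [two_mul, mul_add]
  have h7 : S.potential z = Fintype.card J * (∑ v, ∑ i, if z v i = S.rowsAt z v i then 0 else 1)
      + Fintype.card I *
        ∑ v, ∑ j, if (fun i => z v i j) = S.colsAt z v j then 0 else 1 := by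
    simp only [potential, costAt, localCost, Finset.sum_add_distrib, ← Finset.mul_sum]
  rw [h7, hcard]
  have := Nat.mul_le_mul_left (Fintype.card J) h5
  have := Nat.mul_le_mul_left (Fintype.card I) h6
  linarith

open Classical in
theorem exists_word_of_potential_eq_zero [Nonempty I] [Nonempty J] {z : V → I → J → K}
    (h : S.potential z = 0) : ∃ f : X → K, ∀ v, S.viewAt f v = z v := by
  have h1 : ∀ v, S.costAt z v = 0 := by simpa [potential] using h
  simp only [costAt, localCost, Nat.add_eq_zero_iff, mul_eq_zero, Fintype.card_ne_zero, false_or,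
    Finset.sum_eq_zero_iff, Finset.mem_univ, true_imp_iff, ite_eq_left_iff, one_ne_zero,
    imp_false, not_not] at h1
  exact S.exists_word z (fun v => (funext (h1 v).1).symm) fun v j i =>
    (congrFun ((h1 v).2 j) i).symm

end SquareComplex

/-! ### Hamming distance and separation of codes -/

open Classical in
theorem relHamming_eq_sum {ι K : Type*} [Fintype ι] (f g : ι → K) :
    relHamming f g = (∑ i, if f i = g i then (0 : ℝ) else 1) / Fintype.card ι := by
  simp [relHamming, hammingDist, Finset.card_filter]

/-- Distinct words of `C` have relative distance at least `δ`. -/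
def SeparatedBy {ι K : Type*} [Fintype ι] (C : Set (ι → K)) (δ : ℝ) : Prop :=
  ∀ f ∈ C, ∀ g ∈ C, f ≠ g → δ ≤ relHamming f g

theorem le_relDist_iff {ι K : Type*} [Fintype ι] (C : Set (ι → K)) (δ : ℝ) :
    (δ : EReal) ≤ relDist C ↔ SeparatedBy C δ := by
  simp [relDist, SeparatedBy]

/-! ### Distance, testing and unique correction on expanding square complexes -/

namespace SquareComplex

variable {V I J X K : Type*} {S : SquareComplex V I J X}
variable [Fintype V] [Fintype I] [Fintype J] [Fintype X]

open Classical in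
theorem sum_view_ne (f g : X → K) :
    ∑ v, ∑ i, ∑ j, (if S.viewAt f v i j = S.viewAt g v i j then (0 : ℝ) else 1) =
      4 * ∑ s, if f s = g s then (0 : ℝ) else 1 := by
  have := S.sum_corners (fun s => if f s = g s then 0 else 1)
  simp only [viewAt]
  exact_mod_cast this

open Classical in
theorem relHamming_eq_view [Nonempty V] [Nonempty I] [Nonempty J] (f g : X → K) :
    relHamming f g = (∑ v, ∑ i, ∑ j, (if S.viewAt f v i j = S.viewAt g v i j then (0 : ℝ) else 1))
      / (Fintype.card V * Fintype.card I * Fintype.card J) := by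
  have h1 : (4 * Fintype.card X : ℝ) = Fintype.card V * Fintype.card I * Fintype.card J := by
    exact_mod_cast S.card_squares
  rw [relHamming_eq_sum, sum_view_ne, ← h1, mul_div_mul_left _ _ (by norm_num)]

open Classical in
/-- Words are close if most of their views agree. -/
theorem relHamming_le_views [Nonempty V] [Nonempty I] [Nonempty J] (f g : X → K) :
    relHamming f g ≤
      ((Finset.univ.filter fun v => S.viewAt f v ≠ S.viewAt g v).card : ℝ) / Fintype.card V := by
  have hn : (0 : ℝ) < Fintype.card V := by exact_mod_cast Fintype.card_pos
  have ha : (0 : ℝ) < Fintype.card I := by exact_mod_cast Fintype.card_pos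
  have hb : (0 : ℝ) < Fintype.card J := by exact_mod_cast Fintype.card_pos
  rw [relHamming_eq_view (S := S), div_le_div_iff₀ (by positivity) hn, Finset.card_filter]
  push_cast
  have : ∀ v, ∑ i, ∑ j, (if S.viewAt f v i j = S.viewAt g v i j then (0 : ℝ) else 1) ≤
      (if S.viewAt f v ≠ S.viewAt g v then 1 else 0) * (Fintype.card I * Fintype.card J) := by
    intro v
    by_cases h : S.viewAt f v = S.viewAt g v
    · simp [h]
    · calc _ ≤ ∑ i : I, ∑ j : J, (1 : ℝ) := by
            refine Finset.sum_le_sum fun i _ => Finset.sum_le_sum fun j _ => ?_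
            split_ifs <;> norm_num
        _ = _ := by simp [h]
  have h2 := Finset.sum_le_sum fun v (_ : v ∈ Finset.univ) => this v
  rw [← Finset.sum_mul] at h2
  have := mul_le_mul_of_nonneg_right h2 hn.le
  linarith

open Classical in
/-- Close words have few different views. -/
theorem card_views_le [Nonempty V] [Nonempty I] [Nonempty J] (f g : X → K) :
    ((Finset.univ.filter fun v => S.viewAt f v ≠ S.viewAt g v).card : ℝ) ≤
      Fintype.card V * Fintype.card I * Fintype.card J * relHamming f g := by
  have hn : (0 : ℝ) < Fintype.card V := by exact_mod_cast Fintype.card_pos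
  have ha : (0 : ℝ) < Fintype.card I := by exact_mod_cast Fintype.card_pos
  have hb : (0 : ℝ) < Fintype.card J := by exact_mod_cast Fintype.card_pos
  rw [relHamming_eq_view (S := S), mul_div_cancel₀ _ (by positivity), Finset.card_filter]
  push_cast
  refine Finset.sum_le_sum fun v _ => ?_
  by_cases h : S.viewAt f v = S.viewAt g v
  · simp [h]
  · obtain ⟨i, hi⟩ := Function.ne_iff.1 h
    obtain ⟨j, hj⟩ := Function.ne_iff.1 hi
    rw [if_pos h]
    have h0 : ∀ i j, (0 : ℝ) ≤ if S.viewAt f v i j = S.viewAt g v i j then (0 : ℝ) else 1 :=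
      fun i j => by split_ifs <;> norm_num
    calc (1 : ℝ) = if S.viewAt f v i j = S.viewAt g v i j then (0 : ℝ) else 1 := by simp [hj]
      _ ≤ ∑ j, if S.viewAt f v i j = S.viewAt g v i j then (0 : ℝ) else 1 :=
        Finset.single_le_sum (f := fun j => if S.viewAt f v i j = S.viewAt g v i j then (0 : ℝ)
          else 1) (fun j _ => h0 i j) (Finset.mem_univ j)
      _ ≤ _ := Finset.single_le_sum (f := fun i => ∑ j, if S.viewAt f v i j = S.viewAt g v i j
          then (0 : ℝ) else 1) (fun i _ => Finset.sum_nonneg fun j _ => h0 i j) (Finset.mem_univ i)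

/-- The distance of the code of an expanding square complex. -/
theorem code_separated {CA : Set (I → K)} {CB : Set (J → K)} {ε : ℝ} (hε : 0 < ε)
    (hε1 : ε ≤ 1) [Nonempty V] [Nonempty I] [Nonempty J]
    (hA : SeparatedBy CA ε) (hB : SeparatedBy CB ε)
    (hL : ExpanderForm S.left (ε ^ 2 / 2500)) :
    SeparatedBy (S.code CA CB) (0.9996 * ε ^ 3) := by
  classical
  intro f hf g hg hfg
  have hn : (0 : ℝ) < Fintype.card V := by exact_mod_cast Fintype.card_pos
  have ha : (0 : ℝ) < Fintype.card I := by exact_mod_cast Fintype.card_pos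
  have hb : (0 : ℝ) < Fintype.card J := by exact_mod_cast Fintype.card_pos
  set h : V → ℝ := fun v => if S.viewAt f v = S.viewAt g v then 0 else 1 with h_def
  have hne : ∀ v i j, S.viewAt f v i j ≠ S.viewAt g v i j → h v = 1 := fun v i j hv => by
    simp only [h_def]
    rw [if_neg fun e => hv (by rw [e])]
  have hcol : ∀ v i j, S.viewAt f v i j ≠ S.viewAt g v i j →
      ε * Fintype.card I ≤ ∑ i, if S.viewAt f v i j = S.viewAt g v i j then (0 : ℝ) else 1 := by
    intro v i j hv
    have := hA _ ((hf v).2 j) _ ((hg v).2 j) fun e => hv (congrFun e i)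
    rwa [relHamming_eq_sum, le_div_iff₀ ha] at this
  have hrow : ∀ v i j, S.viewAt f v i j ≠ S.viewAt g v i j →
      ε * Fintype.card J ≤ ∑ j, if S.viewAt f v i j = S.viewAt g v i j then (0 : ℝ) else 1 := by
    intro v i j hv
    have := hB _ ((hf v).1 i) _ ((hg v).1 i) fun e => hv (congrFun e j)
    rwa [relHamming_eq_sum, le_div_iff₀ hb] at this
  -- A nonzero difference of views has a nonzero column, which has at least `ε |I|` nonzero entries.
  -- Each lies on a square shared with a different left neighbour, where the views differ as well.
  have h1 : ∀ v, h v * (ε * Fintype.card I) ≤ h v * ∑ i, h (S.left i v) := by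
    intro v
    by_cases hv : S.viewAt f v = S.viewAt g v
    · simp [h_def, hv]
    · obtain ⟨i, hi⟩ := Function.ne_iff.1 hv
      obtain ⟨j, hj⟩ := Function.ne_iff.1 hi
      rw [hne v i j hj, one_mul, one_mul]
      refine (hcol v i j hj).trans (Finset.sum_le_sum fun i' _ => ?_)
      by_cases hv' : S.viewAt f v i' j = S.viewAt g v i' j
      · rw [if_pos hv']
        simp only [h_def]
        split_ifs <;> norm_num
      · rw [if_neg hv', hne (S.left i' v) (S.invL i') j]
        simpa only [viewAt, S.sq_left] using hv'
  -- The usual product bound: a nonzero row meets at least `ε |J|` columns, each of which has at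
  -- least `ε |I|` nonzero entries.
  have h2 : ∀ v, h v * (ε ^ 2 * (Fintype.card I * Fintype.card J)) ≤
      ∑ i, ∑ j, (if S.viewAt f v i j = S.viewAt g v i j then (0 : ℝ) else 1) := by
    intro v
    by_cases hv : S.viewAt f v = S.viewAt g v
    · simp [h_def, hv]
    · obtain ⟨i, hi⟩ := Function.ne_iff.1 hv
      obtain ⟨j, hj⟩ := Function.ne_iff.1 hi
      rw [hne v i j hj, one_mul, Finset.sum_comm]
      have : ∀ j, (ε * Fintype.card I) *
          (if S.viewAt f v i j = S.viewAt g v i j then (0 : ℝ) else 1) ≤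
          ∑ i, if S.viewAt f v i j = S.viewAt g v i j then (0 : ℝ) else 1 := by
        intro j'
        by_cases hj' : S.viewAt f v i j' = S.viewAt g v i j'
        · rw [if_pos hj', mul_zero]
          exact Finset.sum_nonneg fun i _ => by split_ifs <;> norm_num
        · rw [if_neg hj', mul_one]
          exact hcol v i j' hj'
      refine le_trans ?_ (Finset.sum_le_sum fun j _ => this j)
      rw [← Finset.mul_sum]
      have := mul_le_mul_of_nonneg_left (hrow v i j hj) (mul_pos hε ha).le
      linarith
  have hsq : ∀ v, h v ^ 2 = h v := fun v => by
    simp only [h_def]; split_ifs <;> norm_num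
  have h3 := hL h
  simp only [hsq] at h3
  have h4 := Finset.sum_le_sum fun v (_ : v ∈ Finset.univ) => h1 v
  have h5 := Finset.sum_le_sum fun v (_ : v ∈ Finset.univ) => h2 v
  rw [← Finset.sum_mul] at h4 h5
  set P := ∑ v, h v with hP
  have hP0 : 0 < P := by
    obtain ⟨s, hs⟩ := Function.ne_iff.1 hfg
    obtain ⟨v, i, j, rfl⟩ := S.exists_sq s
    have := Finset.single_le_sum (f := h) (fun v _ => by
      simp only [h_def]; split_ifs <;> norm_num) (Finset.mem_univ v)
    rw [hne v i j hs] at this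
    linarith
  have h6 : (Fintype.card I * P) * (ε * Fintype.card V) ≤
      (Fintype.card I * P) * (P + ε ^ 2 / 2500 * Fintype.card V) := by
    have := mul_le_mul_of_nonneg_left h4 hn.le
    linarith
  have h7 := le_of_mul_le_mul_left h6 (mul_pos ha hP0)
  rw [relHamming_eq_view (S := S), le_div_iff₀ (by positivity)]
  refine le_trans ?_ h5
  -- Here `0.9996 = 1 - 1 / 2500`, and `ε ^ 2 ≤ ε`.
  have h8 : 0.9996 * ε * Fintype.card V ≤ P := by
    nlinarith [mul_nonneg (mul_nonneg hε.le (sub_nonneg.2 hε1)) hn.le]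
  have := mul_le_mul_of_nonneg_right h8
    (by positivity : 0 ≤ ε ^ 2 * ((Fintype.card I : ℝ) * Fintype.card J))
  linarith

open Classical in
/-- If most of the initial local views are those of the word `y`, every maximal sequence of
correction steps ends with the views of a codeword close to `y`. -/
theorem exists_codeword_of_steps {CA : Set (I → K)} {CB : Set (J → K)} {ε : ℝ} (hε : 0 < ε)
    (hε1 : ε ≤ 1) [Nonempty V] [Nonempty I] [Nonempty J]
    (hagr : CostTestable CA CB ε) (hL : ExpanderForm S.left (ε ^ 2 / 2500))
    (hR : ExpanderForm S.right (ε ^ 2 / 2500)) {z₀ z : V → I → J → K}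
    (hz₀ : ∀ v, z₀ v ∈ productCode CA CB)
    (hz : Relation.ReflTransGen (S.Step (productCode CA CB)) z₀ z)
    (hs : ∀ v, S.Stable (productCode CA CB) z v) (y : X → K)
    (hbad : 36 * max (Fintype.card I : ℝ) (Fintype.card J) *
      (Finset.univ.filter fun v => z₀ v ≠ S.viewAt y v).card < ε * Fintype.card V) :
    ∃ f ∈ S.code CA CB, (∀ v, S.viewAt f v = z v) ∧
      relHamming f y ≤ (1 + 4 * max (Fintype.card I : ℝ) (Fintype.card J)) *
        ((Finset.univ.filter fun v => z₀ v ≠ S.viewAt y v).card / Fintype.card V) := by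
  have hn : (0 : ℝ) < Fintype.card V := by exact_mod_cast Fintype.card_pos
  have ha : (0 : ℝ) < Fintype.card I := by exact_mod_cast Fintype.card_pos
  have hb : (0 : ℝ) < Fintype.card J := by exact_mod_cast Fintype.card_pos
  set bad := (Finset.univ.filter fun v => z₀ v ≠ S.viewAt y v).card with hbad_def
  have hmem := S.steps_mem hz₀ hz
  have hch := S.steps_changed hz
  have h0 := potential_le_bad (S := S) z₀ y
  rw [← hbad_def] at h0
  -- The constant 36 is the 9 of `potential_of_stable` times the 4 of `potential_le_bad`: the
  -- initial potential is below the threshold for nonzero stable potentials.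
  have hpot : S.potential z = 0 := by
    by_contra hpos
    have h1 := potential_of_stable hε hε1 hagr hL hR hmem hs hpos
    have h2 : (S.potential z : ℝ) ≤ 4 * (Fintype.card I * Fintype.card J) * bad := by
      exact_mod_cast (Nat.le_add_left _ _).trans (hch.trans h0)
    have h3 := mul_le_mul_of_nonneg_left h2
      (by positivity : 0 ≤ 9 * max (Fintype.card I : ℝ) (Fintype.card J))
    have h4 := mul_lt_mul_of_pos_left hbad (mul_pos ha hb)
    linarith
  obtain ⟨f, hf⟩ := exists_word_of_potential_eq_zero hpot
  refine ⟨f, fun v => (hf v).symm ▸ hmem v, hf, ?_⟩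
  refine (relHamming_le_views (S := S) f y).trans ?_
  rw [← mul_div_assoc]
  refine div_le_div_of_nonneg_right ?_ hn.le
  have hsub : (Finset.univ.filter fun v => S.viewAt f v ≠ S.viewAt y v) ⊆
      (Finset.univ.filter fun v => z₀ v ≠ S.viewAt y v) ∪
        Finset.univ.filter fun v => z v ≠ z₀ v := by
    intro v hv
    simp only [Finset.mem_filter, Finset.mem_univ, true_and, Finset.mem_union, hf] at hv ⊢
    by_contra hcon
    push Not at hcon
    exact hv (hcon.2.trans hcon.1)
  have h5 := (Finset.card_le_card hsub).trans (Finset.card_union_le _ _)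
  rw [← hbad_def] at h5
  set ch := (Finset.univ.filter fun v => z v ≠ z₀ v).card
  have h6 : (ch : ℝ) * min (Fintype.card I : ℝ) (Fintype.card J) ≤
      4 * (Fintype.card I * Fintype.card J) * bad := by
    exact_mod_cast (Nat.le_add_right _ _).trans (hch.trans h0)
  have hmin : 0 < min (Fintype.card I : ℝ) (Fintype.card J) := lt_min ha hb
  -- Cancel the minimum from `|I| |J| = min * max`.
  have h7 : (ch : ℝ) ≤ 4 * max (Fintype.card I : ℝ) (Fintype.card J) * bad := by
    refine le_of_mul_le_mul_right (h6.trans_eq ?_) hmin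
    rw [← min_mul_max (Fintype.card I : ℝ)]
    ring
  have h8 : ((Finset.univ.filter fun v => S.viewAt f v ≠ S.viewAt y v).card : ℝ) ≤ bad + ch := by
    exact_mod_cast h5
  linarith

open Classical in
/-- Testing: if few views are not in the product code, the word is close to the code. -/
theorem exists_codeword_near {CA : Set (I → K)} {CB : Set (J → K)} {ε : ℝ} (hε : 0 < ε)
    (hε1 : ε ≤ 1) [Nonempty V] [Nonempty I] [Nonempty J]
    (hagr : CostTestable CA CB ε) (hL : ExpanderForm S.left (ε ^ 2 / 2500))
    (hR : ExpanderForm S.right (ε ^ 2 / 2500)) (hne : (productCode CA CB).Nonempty) (y : X → K)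
    (hbad : 36 * max (Fintype.card I : ℝ) (Fintype.card J) *
      (Finset.univ.filter fun v => S.viewAt y v ∉ productCode CA CB).card
        < ε * Fintype.card V) :
    ∃ f ∈ S.code CA CB,
      relHamming f y ≤ (1 + 4 * max (Fintype.card I : ℝ) (Fintype.card J)) *
        ((Finset.univ.filter fun v => S.viewAt y v ∉ productCode CA CB).card
          / Fintype.card V) := by
  obtain ⟨m, hm⟩ := hne
  -- Views outside the product code are replaced by an arbitrary element `m` of it; they count as
  -- bad anyway.
  set z₀ : V → I → J → K := fun v => if S.viewAt y v ∈ productCode CA CB then S.viewAt y v else m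
    with hz₀
  have hz₀m : ∀ v, z₀ v ∈ productCode CA CB := fun v => by
    simp only [hz₀]; split_ifs with h <;> assumption
  have hle : ((Finset.univ.filter fun v => z₀ v ≠ S.viewAt y v).card : ℝ) ≤
      (Finset.univ.filter fun v => S.viewAt y v ∉ productCode CA CB).card := by
    norm_cast
    refine Finset.card_le_card fun v hv => ?_
    simp only [Finset.mem_filter, Finset.mem_univ, true_and, hz₀] at hv ⊢
    intro h
    exact hv (if_pos h)
  obtain ⟨z, hz, hs⟩ := S.exists_stable (productCode CA CB) z₀
  obtain ⟨f, hf, -, hd⟩ := exists_codeword_of_steps hε hε1 hagr hL hR hz₀m hz hs y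
    (lt_of_le_of_lt (mul_le_mul_of_nonneg_left hle (by positivity)) hbad)
  exact ⟨f, hf, hd.trans (mul_le_mul_of_nonneg_left
    (div_le_div_of_nonneg_right hle (Nat.cast_nonneg _)) (by positivity))⟩

open Classical in
/-- Decoding: if the word `y` is close to the codeword `f`, every maximal sequence of correction
steps starting with the local views of `y`, where they are in the product code, ends with the
views of `f`. -/
theorem eq_view_of_steps {CA : Set (I → K)} {CB : Set (J → K)} {ε : ℝ} (hε : 0 < ε)
    (hε1 : ε ≤ 1) [Nonempty V] [Nonempty I] [Nonempty J]
    (hA : SeparatedBy CA ε) (hB : SeparatedBy CB ε)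
    (hagr : CostTestable CA CB ε) (hL : ExpanderForm S.left (ε ^ 2 / 2500))
    (hR : ExpanderForm S.right (ε ^ 2 / 2500)) {z₀ z : V → I → J → K} {y f : X → K}
    (hz₀ : ∀ v, z₀ v ∈ productCode CA CB)
    (hzy : ∀ v, S.viewAt y v ∈ productCode CA CB → z₀ v = S.viewAt y v)
    (hz : Relation.ReflTransGen (S.Step (productCode CA CB)) z₀ z)
    (hs : ∀ v, S.Stable (productCode CA CB) z v)
    (hf : f ∈ S.code CA CB)
    (hd : Fintype.card I * Fintype.card J * relHamming y f *
      (4800 * max (Fintype.card I : ℝ) (Fintype.card J)) < ε ^ 3) :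
    ∀ v, z v = S.viewAt f v := by
  have hn : (0 : ℝ) < Fintype.card V := by exact_mod_cast Fintype.card_pos
  have ha1 : (1 : ℝ) ≤ Fintype.card I := by exact_mod_cast Fintype.card_pos
  set D := max (Fintype.card I : ℝ) (Fintype.card J) with hD
  have hD1 : 1 ≤ D := ha1.trans (le_max_left _ _)
  have hle : ((Finset.univ.filter fun v => z₀ v ≠ S.viewAt f v).card : ℝ) ≤
      (Finset.univ.filter fun v => S.viewAt y v ≠ S.viewAt f v).card := by
    norm_cast
    refine Finset.card_le_card fun v hv => ?_
    simp only [Finset.mem_filter, Finset.mem_univ, true_and] at hv ⊢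
    intro h
    exact hv ((hzy v (h ▸ hf v)).trans h)
  have hle2 := hle.trans (card_views_le (S := S) y f)
  set bad : ℝ := ((Finset.univ.filter fun v => z₀ v ≠ S.viewAt f v).card : ℝ) with hbad
  have hbad0 : 0 ≤ bad := Nat.cast_nonneg _
  -- One wrong letter spoils at most four views, so the number of bad views is bounded by the
  -- distance.
  have h1 : 4800 * D * bad < ε ^ 3 * Fintype.card V := by
    have e1 := mul_le_mul_of_nonneg_left hle2 (by positivity : 0 ≤ 4800 * D)
    have e2 := mul_lt_mul_of_pos_right hd hn
    linarith
  have hε3 : ε ^ 3 ≤ ε := by nlinarith [mul_nonneg hε.le (sub_nonneg.2 hε1), sq_nonneg ε]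
  have h2 : 36 * D * bad < ε * Fintype.card V := by
    have := mul_le_mul_of_nonneg_right hε3 hn.le
    have := mul_nonneg (by linarith : 0 ≤ D) hbad0
    linarith
  obtain ⟨f', hf', hv, hd'⟩ := exists_codeword_of_steps hε hε1 hagr hL hR hz₀ hz hs f h2
  -- Both are codewords, and their distance is at most `(1 + 4 * D) * bad / |V| ≤ 5 * D * bad /
  -- |V|`. This is less than `5 * ε ^ 3 / 4800`, far below the minimum distance.
  have h3 : f' = f := by
    by_contra hne
    have h4 := (code_separated hε hε1 hA hB hL f' hf' f hf hne).trans hd'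
    rw [← mul_div_assoc, le_div_iff₀ hn] at h4
    have : bad ≤ D * bad := le_mul_of_one_le_left hbad0 hD1
    have := mul_pos (pow_pos hε 3) hn
    linarith
  exact fun v => h3 ▸ (hv v).symm

end SquareComplex

/-! ### From eigenvalues to the adjacency form -/

open Matrix in
/-- The quadratic form of a symmetric matrix that fixes the constants is bounded by its
eigenvalues on the vectors of sum zero. -/
theorem quadratic_form_le {V : Type*} [Fintype V] [DecidableEq V] (M : Matrix V V ℝ)
    (hM : M.IsHermitian) (h1 : ∀ v, ∑ u, M v u = 1) {l : ℝ}
    (hl : ∀ (μ : ℝ) (f : V → ℝ), f ≠ 0 → ∑ v, f v = 0 → M *ᵥ f = μ • f → μ ≤ l) (h : V → ℝ) :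
    Fintype.card V * (h ⬝ᵥ (M *ᵥ h)) ≤
      (1 - l) * (∑ v, h v) ^ 2 + l * Fintype.card V * ∑ v, h v ^ 2 := by
  rcases isEmpty_or_nonempty V with hV | hV
  · simp
  have hn : (0 : ℝ) < Fintype.card V := by exact_mod_cast Fintype.card_pos
  set n : ℝ := (Fintype.card V : ℝ) with hn_def
  -- The claim is positivity of `l • 1 - M + J`. The constant matrix `J` is scaled so that constants
  -- are in the kernel, which leaves only the vectors of sum zero to be checked.
  set J : Matrix V V ℝ := Matrix.of fun _ _ => (1 - l) / n with hJ
  set N : Matrix V V ℝ := l • 1 - M + J with hN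
  have hNv : ∀ f : V → ℝ, N *ᵥ f = l • f - M *ᵥ f + fun _ => (1 - l) / n * ∑ u, f u := by
    intro f
    rw [hN, Matrix.add_mulVec, Matrix.sub_mulVec, Matrix.smul_mulVec, Matrix.one_mulVec]
    congr 1
    funext v
    simp [hJ, Matrix.mulVec, dotProduct, Finset.mul_sum]
  have hsum : ∀ f : V → ℝ, ∑ v, (M *ᵥ f) v = ∑ v, f v := by
    intro f
    simp only [Matrix.mulVec, dotProduct]
    rw [Finset.sum_comm]
    refine Finset.sum_congr rfl fun u _ => ?_
    rw [← Finset.sum_mul]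
    have : ∑ v, M v u = 1 := by
      rw [← h1 u]
      exact Finset.sum_congr rfl fun v _ => by simpa using (hM.apply v u).symm
    rw [this, one_mul]
  have hNH : N.IsHermitian := by
    refine ((Matrix.isHermitian_one.smul (k := l) (by simp [IsSelfAdjoint])).sub hM).add ?_
    ext v u
    simp [hJ]
  have hpos : N.PosSemidef := by
    rw [hNH.posSemidef_iff_eigenvalues_nonneg]
    intro i
    by_contra hneg
    replace hneg := not_le.1 hneg
    change hNH.eigenvalues i < 0 at hneg
    set ν := hNH.eigenvalues i with hν
    have he := hNH.mulVec_eigenvectorBasis i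
    set f : V → ℝ := (hNH.eigenvectorBasis i).ofLp with hf
    have hf0 : f ≠ 0 := by
      intro h0
      have := hNH.eigenvectorBasis.orthonormal.ne_zero i
      exact this (by ext v; exact congrFun h0 v)
    rw [hNv] at he
    change _ = ν • f at he
    have hs := congrArg (fun g : V → ℝ => ∑ v, g v) he
    simp only [Pi.add_apply, Pi.sub_apply, Pi.smul_apply, smul_eq_mul, Finset.sum_add_distrib,
      Finset.sum_sub_distrib, ← Finset.mul_sum, hsum, Finset.sum_const, Finset.card_univ,
      nsmul_eq_mul] at hs
    rw [← hn_def] at hs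
    -- The column sums of `N` vanish, so an eigenvector with a negative eigenvalue `ν` has sum zero.
    -- It is then an eigenvector of `M` with the eigenvalue `l - ν > l`, a contradiction.
    have hs' : ν * ∑ v, f v = 0 := by
      rw [← hs]
      field_simp
      ring
    have hs0 : ∑ v, f v = 0 := by
      rcases mul_eq_zero.1 hs' with h | h
      · exact absurd h hneg.ne
      · exact h
    have := hl (l - ν) f hf0 hs0 (by
      funext v
      have := congrFun he v
      simp [hs0] at this ⊢
      linarith)
    linarith
  have hq := hpos.dotProduct_mulVec_nonneg h
  rw [hNv] at hq
  simp only [star_trivial, dotProduct_add, dotProduct_sub, dotProduct_smul, smul_eq_mul] at hq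
  have e1 : h ⬝ᵥ h = ∑ v, h v ^ 2 := by simp [dotProduct, sq]
  have e2 : (h ⬝ᵥ fun _ => (1 - l) / n * ∑ u, h u) = (1 - l) / n * (∑ u, h u) ^ 2 := by
    simp only [dotProduct]
    rw [← Finset.sum_mul]
    ring
  rw [e1, e2] at hq
  have := mul_le_mul_of_nonneg_left hq hn.le
  rw [mul_zero] at this
  have e3 : n * ((1 - l) / n * (∑ u, h u) ^ 2) = (1 - l) * (∑ u, h u) ^ 2 := by
    field_simp
  linarith

/-- A regular expander graph with labelled edges has a bounded adjacency form. -/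
theorem IsExpander.expanderForm {V I : Type*} [Fintype V] [Fintype I] [Nonempty V] [Nonempty I]
    {Γ : SimpleGraph V} {m : I → V → V} (hadj : ∀ v u, Γ.Adj v u ↔ ∃ i, m i v = u)
    (hinj : ∀ i j v, m i v = m j v → i = j) {l : ℝ} (hl : 0 ≤ l) (h : IsExpander Γ l) :
    SquareComplex.ExpanderForm m l := by
  classical
  have ha : (0 : ℝ) < Fintype.card I := by exact_mod_cast Fintype.card_pos
  have hsum : ∀ (v : V) (f : V → ℝ), ∑ u, (if Γ.Adj v u then f u else 0) = ∑ i, f (m i v) := by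
    intro v f
    rw [← Finset.sum_filter]
    have : (Finset.univ.filter fun u => Γ.Adj v u) = Finset.univ.image fun i => m i v := by
      ext u
      simp [hadj]
    rw [this, Finset.sum_image fun i _ j _ hij => hinj i j v hij]
  have hdeg : ∀ v, Nat.card (Γ.neighborSet v) = Fintype.card I := by
    intro v
    have : Γ.neighborSet v = Set.range fun i => m i v := by
      ext u
      simp [hadj]
    rw [this, Nat.card_range_of_injective fun i j hij => hinj i j v hij, Nat.card_eq_fintype_card]
  have hE : (0 : ℝ) < Nat.card Γ.edgeSet := by
    obtain ⟨v⟩ := ‹Nonempty V›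
    obtain ⟨i⟩ := ‹Nonempty I›
    have hv : Γ.Adj v (m i v) := (hadj _ _).2 ⟨i, rfl⟩
    have : Nonempty Γ.edgeSet := ⟨⟨s(v, m i v), hv⟩⟩
    exact_mod_cast Nat.card_pos
  have hw : ∀ v, natEdgeWeight Γ / (2 * natVertexWeight Γ v) = 1 / Fintype.card I := by
    intro v
    rw [natEdgeWeight, natVertexWeight, hdeg]
    field_simp
  set M : Matrix V V ℝ := Matrix.of fun v u => if Γ.Adj v u then 1 / (Fintype.card I : ℝ) else 0
    with hM_def
  have hMv : ∀ f v, (M.mulVec f) v = 1 / (Fintype.card I : ℝ) * ∑ i, f (m i v) := by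
    intro f v
    rw [← hsum v f, Finset.mul_sum]
    simp only [Matrix.mulVec, dotProduct, hM_def, Matrix.of_apply]
    refine Finset.sum_congr rfl fun u _ => ?_
    split_ifs <;> simp
  have hM : M.IsHermitian := by
    ext v u
    simp [hM_def, Γ.adj_comm]
  have hM1 : ∀ v, ∑ u, M v u = 1 := by
    intro v
    simp only [hM_def, Matrix.of_apply]
    rw [hsum v]
    simp
  intro g
  have := quadratic_form_le M hM hM1 (l := l) (fun μ f hf hf0 hMf => (h μ f hf (by
    simp only [natVertexWeight, hdeg]
    rw [← Finset.mul_sum, hf0, mul_zero]) (by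
    rw [← hMf]
    funext v
    rw [hMv, adjOp, ← hsum v, Finset.mul_sum, Finset.sum_filter]
    refine Finset.sum_congr rfl fun u _ => ?_
    rw [hw]
    split_ifs <;> simp)).2) g
  have h2 : g ⬝ᵥ (M.mulVec g) = 1 / (Fintype.card I : ℝ) * ∑ v, g v * ∑ i, g (m i v) := by
    simp only [dotProduct, hMv]
    rw [Finset.mul_sum]
    exact Finset.sum_congr rfl fun v _ => by ring
  rw [h2] at this
  -- `ExpanderForm` has the coefficient 1 instead of `1 - l` at the square of the sum; `0 ≤ l`
  -- allows this.
  have h3 : 0 ≤ l * (∑ v, g v) ^ 2 := mul_nonneg hl (sq_nonneg _)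
  have h4 := mul_le_mul_of_nonneg_left this ha.le
  have h5 : (Fintype.card I : ℝ) * (Fintype.card V * (1 / (Fintype.card I : ℝ) *
      ∑ v, g v * ∑ i, g (m i v))) = Fintype.card V * ∑ v, g v * ∑ i, g (m i v) := by
    field_simp
  rw [h5] at h4
  have := mul_nonneg ha.le h3
  linarith

/-! ### The double Cayley complex as a square complex -/

/-! ### Renaming positions and letters -/

section Relabel

variable {ι κ K F : Type*} [Fintype ι] [Fintype κ]

/-- A code with renamed positions and letters. -/
def relabel (e : ι ≃ κ) (eF : K ≃ F) (C : Set (κ → F)) : Set (ι → K) :=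
  {w | (fun k => eF (w (e.symm k))) ∈ C}

theorem relHamming_relabel (e : ι ≃ κ) (eF : K ≃ F) (f g : ι → K) :
    relHamming (fun k => eF (f (e.symm k))) (fun k => eF (g (e.symm k))) = relHamming f g := by
  classical
  rw [relHamming_eq_sum, relHamming_eq_sum, Fintype.card_congr e]
  congr 1
  rw [← Equiv.sum_comp e.symm]
  simp

theorem SeparatedBy.relabel {C : Set (κ → F)} {δ : ℝ} (h : SeparatedBy C δ) (e : ι ≃ κ)
    (eF : K ≃ F) : SeparatedBy (relabel e eF C) δ := by
  intro f hf g hg hfg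
  rw [← relHamming_relabel e eF]
  refine h _ hf _ hg fun heq => hfg (funext fun i => ?_)
  simpa using congrFun heq (e i)

end Relabel

/-- Multiplying by `2 |R| |S|` turns the average disagreement into `localCost`; its weights clear
the denominators `2 |R|` and `2 |S|`. -/
theorem AgreementTestable.costTestable {R S I J K F : Type*} [Field F] [Fintype R] [Fintype S]
    [Fintype I] [Fintype J] [Nonempty R] [Nonempty S] {CA : Submodule F (R → F)}
    {CB : Submodule F (S → F)} {κ : ℝ} (h : AgreementTestable CA CB κ) (eA : I ≃ R) (eB : J ≃ S)
    (eF : K ≃ F) :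
    SquareComplex.CostTestable (relabel eA eF (CA : Set (R → F)))
      (relabel eB eF (CB : Set (S → F))) κ := by
  classical
  intro r c hr hc
  obtain ⟨m, ⟨hm1, hm2⟩, hle⟩ := h (fun b a => eF (c (eB.symm b) (eA.symm a)))
    (fun a b => eF (r (eA.symm a) (eB.symm b))) (fun b => hc _) (fun a => hr _)
  have ha : (0 : ℝ) < Fintype.card R := by exact_mod_cast Fintype.card_pos
  have hb : (0 : ℝ) < Fintype.card S := by exact_mod_cast Fintype.card_pos
  refine ⟨fun i j => eF.symm (m (eA i) (eB j)),
    ⟨fun i => by simpa [relabel] using hm1 (eA i), fun j => by simpa [relabel] using hm2 (eB j)⟩,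
    ?_⟩
  have e1 : ((Finset.univ.filter fun i => (fun b => eF (r (eA.symm i) (eB.symm b))) ≠ m i).card : ℝ)
      = ∑ i, if (fun j => eF.symm (m (eA i) (eB j))) = r i then (0 : ℝ) else 1 := by
    rw [Finset.card_filter, ← Equiv.sum_comp eA]
    push_cast
    refine Finset.sum_congr rfl fun i _ => ?_
    have : (fun b => eF (r (eA.symm (eA i)) (eB.symm b))) = m (eA i) ↔
        (fun j => eF.symm (m (eA i) (eB j))) = r i := by
      simp only [funext_iff, Equiv.symm_apply_apply]
      rw [← eB.forall_congr_right]
      simp only [Equiv.symm_apply_apply, Equiv.symm_apply_eq]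
      exact forall_congr' fun _ => eq_comm
    simp only [ne_eq, this, ite_not]
  have e2 : ((Finset.univ.filter fun j => (fun a => eF (c (eB.symm j) (eA.symm a))) ≠
      fun i => m i j).card : ℝ)
      = ∑ j, if (fun i => eF.symm (m (eA i) (eB j))) = c j then (0 : ℝ) else 1 := by
    rw [Finset.card_filter, ← Equiv.sum_comp eB]
    push_cast
    refine Finset.sum_congr rfl fun j _ => ?_
    have : (fun a => eF (c (eB.symm (eB j)) (eA.symm a))) = (fun i => m i (eB j)) ↔
        (fun i => eF.symm (m (eA i) (eB j))) = c j := by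
      simp only [funext_iff, Equiv.symm_apply_apply]
      rw [← eA.forall_congr_right]
      simp only [Equiv.symm_apply_apply, Equiv.symm_apply_eq]
      exact forall_congr' fun _ => eq_comm
    simp only [ne_eq, this, ite_not]
  have e3 : ((Finset.univ.filter fun p : R × S => eF (c (eB.symm p.2) (eA.symm p.1)) ≠
      eF (r (eA.symm p.1) (eB.symm p.2))).card : ℝ)
      = ∑ i, ∑ j, if c j i = r i j then (0 : ℝ) else 1 := by
    rw [Finset.card_filter]
    push_cast
    rw [Fintype.sum_prod_type, ← Equiv.sum_comp eA]
    refine Finset.sum_congr rfl fun i _ => ?_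
    rw [← Equiv.sum_comp eB]
    refine Finset.sum_congr rfl fun j _ => ?_
    simp
  rw [e1, e2, e3] at hle
  rw [localCost, Fintype.card_congr eA, Fintype.card_congr eB]
  push_cast
  rw [le_div_iff₀ (by positivity)] at hle
  refine le_trans (le_of_eq ?_) (mul_le_mul_of_nonneg_left hle (by norm_num : (0 : ℝ) ≤ 2))
  field_simp

/-! ### Transfer to the double Cayley complex -/

section DoubleCayley

variable {G : Type*} [Group G]

/-- The standing assumptions on the two sets of a double Cayley complex. -/
structure IsDoubleCayley (A B : Finset G) : Prop where
  one_left : (1 : G) ∉ A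
  one_right : (1 : G) ∉ B
  inv_left : ∀ a ∈ A, a⁻¹ ∈ A
  inv_right : ∀ b ∈ B, b⁻¹ ∈ B
  conj : ∀ a ∈ A, ∀ b ∈ B, ∀ g : G, g * a * g⁻¹ ≠ b

theorem square_left (a g b : G) : square a⁻¹ (a * g) b = square a g b := by
  ext e
  simp only [square, Set.mem_insert_iff, Set.mem_singleton_iff, mul_assoc,
    inv_mul_cancel_left, Sym2.eq_swap (a := a * g) (b := g),
    Sym2.eq_swap (a := a * (g * b)) (b := g * b)]
  tauto

theorem square_right (a g b : G) : square a (g * b) b⁻¹ = square a g b := by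
  ext e
  simp only [square, Set.mem_insert_iff, Set.mem_singleton_iff, mul_assoc,
    mul_inv_cancel, mul_one, Sym2.eq_swap (a := g * b) (b := g),
    Sym2.eq_swap (a := a * (g * b)) (b := a * g)]
  tauto

variable {A B : Finset G}

theorem corner_of_phi_eq {g g' : G} {a a' : A} {b b' : B}
    (h : phi A B g' a' b' = phi A B g a b) :
    g' = g ∨ g' = a * g ∨ g' = g * b ∨ g' = a * (g * b) := by
  obtain ⟨e, he, hg⟩ : phi A B g a b ∈ squaresAt A B g' := h ▸ phi_mem A B g' a' b'
  rcases he with rfl | rfl | rfl | rfl <;> rcases Sym2.mem_iff.1 hg with h | h <;>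
    simp [h, mul_assoc]

/-- The double Cayley complex, with labels instead of elements of `A` and `B`. -/
def cayleyComplex (h : IsDoubleCayley A B) {I J : Type*} (eA : I ≃ A) (eB : J ≃ B) :
    SquareComplex G I J (Squares A B) where
  left i v := eA i * v
  right j v := v * eB j
  invL i := eA.symm ⟨(eA i : G)⁻¹, h.inv_left _ (eA i).2⟩
  invR j := eB.symm ⟨(eB j : G)⁻¹, h.inv_right _ (eB j).2⟩
  sq v i j := phi A B v (eA i) (eB j)
  left_left i v := by simp
  right_right j v := by simp
  invL_invL i := by simp
  invR_invR j := by simp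
  left_ne i v hv := h.one_left (by
    have : (eA i : G) = 1 := by simpa using hv
    exact this ▸ (eA i).2)
  right_ne j v hv := h.one_right (by
    have : (eB j : G) = 1 := by simpa using hv
    exact this ▸ (eB j).2)
  left_ne_right i j v hv := h.conj _ (eA i).2 _ (eB j).2 v⁻¹ (by
    rw [inv_inv, mul_assoc, hv, inv_mul_cancel_left])
  comm i j v := (mul_assoc _ _ _).symm
  sq_left v i j := Subtype.ext (by simpa [phi] using square_left _ _ _)
  sq_right v i j := Subtype.ext (by simpa [phi] using square_right _ _ _)
  exists_sq := by
    rintro ⟨s, a, ha, g, b, hb, rfl⟩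
    exact ⟨g, eA.symm ⟨a, ha⟩, eB.symm ⟨b, hb⟩, Subtype.ext (by simp [phi])⟩
  eq_of_sq_eq v i j v' i' j' hs := by
    have inj : ∀ g (a a' : A) (b b' : B), phi A B g a b = phi A B g a' b' → a = a' ∧ b = b' := by
      intro g a a' b b' hphi
      have := (phi_bijOn A B h.inv_left h.inv_right h.one_left h.one_right h.conj g).injOn
        (Set.mem_univ (a, b)) (Set.mem_univ (a', b')) hphi
      exact Prod.mk.inj this
    have hl : ∀ g (a : A) (b : B), phi A B g a b =
        phi A B (a * g) ⟨(a : G)⁻¹, h.inv_left _ a.2⟩ b := fun g a b =>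
      Subtype.ext (square_left _ _ _).symm
    have hr : ∀ g (a : A) (b : B), phi A B g a b =
        phi A B (g * b) a ⟨(b : G)⁻¹, h.inv_right _ b.2⟩ := fun g a b =>
      Subtype.ext (square_right _ _ _).symm
    simp only [Prod.mk.injEq, Equiv.eq_symm_apply]
    -- The new base vertex is one of the four corners. Rewriting the square from that corner reduces
    -- the claim to the injectivity of `φ` at a fixed vertex.
    rcases corner_of_phi_eq hs with rfl | rfl | rfl | rfl
    · left
      have := inj _ _ _ _ _ hs
      simpa using this
    · right; left
      rw [hl v] at hs
      have := inj _ _ _ _ _ hs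
      exact ⟨rfl, this.1, eB.injective this.2⟩
    · right; right; left
      rw [hr v] at hs
      have := inj _ _ _ _ _ hs
      exact ⟨rfl, eA.injective this.1, this.2⟩
    · right; right; right
      rw [hr v, hl (v * _)] at hs
      exact ⟨rfl, inj _ _ _ _ _ hs⟩

variable {F : Type*} [Field F] {CA : Submodule F (A → F)} {CB : Submodule F (B → F)}

/-- Arbitrary labels and letters are allowed since distance and testing use the elements of `A`,
`B`, `F` themselves, while the decoder works with their numbers. -/
theorem mem_codeCAGB_iff (h : IsDoubleCayley A B) {I J K : Type*} (eA : I ≃ A) (eB : J ≃ B)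
    (eF : K ≃ F) (f : Squares A B → K) :
    f ∈ (cayleyComplex h eA eB).code (relabel eA eF (CA : Set (A → F)))
      (relabel eB eF (CB : Set (B → F))) ↔ (fun s => eF (f s)) ∈ codeCAGB A B CA CB := by
  simp only [SquareComplex.code, codeCAGB, SmallCodes.liftedCode, SmallCodes.LocallyOk, smallCodes,
    productCode, tensorCode, relabel, SquareComplex.viewAt, cayleyComplex, Set.mem_ofPred_eq]
  refine forall_congr' fun v => and_congr ?_ ?_
  · rw [← eA.forall_congr_right]
    simp
  · rw [← eB.forall_congr_right]
    simp

variable [Fintype G]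

theorem expanderForm_left (h : IsDoubleCayley A B) [Nonempty A] {I J : Type*} [Fintype I]
    (eA : I ≃ A) (eB : J ≃ B) {l : ℝ} (hl : 0 ≤ l)
    (hx : IsExpander (leftCayley (A : Set G)) l) :
    SquareComplex.ExpanderForm (cayleyComplex h eA eB).left l := by
  have : Nonempty I := eA.nonempty
  refine hx.expanderForm (fun v u => ?_) (fun i j v hij => ?_) hl
  · simp only [leftCayley, SimpleGraph.fromRel_adj, cayleyComplex]
    constructor
    · rintro ⟨-, ⟨a, ha, rfl⟩ | ⟨a, ha, rfl⟩⟩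
      · exact ⟨eA.symm ⟨a, ha⟩, by simp⟩
      · exact ⟨eA.symm ⟨a⁻¹, h.inv_left a ha⟩, by simp⟩
    · rintro ⟨i, rfl⟩
      exact ⟨((cayleyComplex h eA eB).left_ne i v).symm, Or.inl ⟨_, (eA i).2, rfl⟩⟩
  · exact eA.injective (Subtype.ext (mul_right_cancel hij))

theorem expanderForm_right (h : IsDoubleCayley A B) [Nonempty B] {I J : Type*} [Fintype J]
    (eA : I ≃ A) (eB : J ≃ B) {l : ℝ} (hl : 0 ≤ l)
    (hx : IsExpander (SimpleGraph.mulCayley (B : Set G)) l) :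
    SquareComplex.ExpanderForm (cayleyComplex h eA eB).right l := by
  have : Nonempty J := eB.nonempty
  refine hx.expanderForm (fun v u => ?_) (fun i j v hij => ?_) hl
  · simp only [SimpleGraph.mulCayley_adj', cayleyComplex]
    constructor
    · rintro ⟨-, b, hb, rfl | rfl⟩
      · exact ⟨eB.symm ⟨b, hb⟩, by simp⟩
      · exact ⟨eB.symm ⟨b⁻¹, h.inv_right b hb⟩, by simp⟩
    · rintro ⟨j, rfl⟩
      exact ⟨((cayleyComplex h eA eB).right_ne j v).symm, _, (eB j).2, Or.inl rfl⟩
  · exact eB.injective (Subtype.ext (mul_left_cancel hij))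

theorem relHamming_comm {ι K : Type*} [Fintype ι] (f g : ι → K) :
    relHamming f g = relHamming g f := by
  simp [relHamming, hammingDist_comm]

theorem relHamming_nonneg {ι K : Type*} [Fintype ι] (f g : ι → K) : 0 ≤ relHamming f g := by
  unfold relHamming
  positivity

theorem relHamming_le_one {ι K : Type*} [Fintype ι] (f g : ι → K) : relHamming f g ≤ 1 := by
  classical
  unfold relHamming
  refine div_le_one_of_le₀ ?_ (Nat.cast_nonneg _)
  exact_mod_cast hammingDist_le_card_fintype

theorem distToCode_le {ι K : Type*} [Fintype ι] {C : Set (ι → K)} (f : ι → K) {g : ι → K}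
    (hg : g ∈ C) : distToCode f C ≤ relHamming f g :=
  ciInf_le ⟨0, by rintro _ ⟨g, rfl⟩; exact relHamming_nonneg _ _⟩ (⟨g, hg⟩ : C)

theorem zero_mem_codeCAGB : (0 : Squares A B → F) ∈ codeCAGB A B CA CB :=
  fun _ => ⟨fun _ => CB.zero_mem, fun _ => CA.zero_mem⟩

theorem codeCAGB_separated (h : IsDoubleCayley A B) [Nonempty A] [Nonempty B] {ε : ℝ} (hε : 0 < ε)
    (hε1 : ε ≤ 1) (hA : SeparatedBy (CA : Set (A → F)) ε) (hB : SeparatedBy (CB : Set (B → F)) ε)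
    (hx : IsExpander (leftCayley (A : Set G)) (ε ^ 2 / 2500)) :
    SeparatedBy (codeCAGB A B CA CB) (0.9996 * ε ^ 3) := by
  have := SquareComplex.code_separated hε hε1 (hA.relabel (Equiv.refl _) (Equiv.refl _))
    (hB.relabel (Equiv.refl _) (Equiv.refl _))
    (expanderForm_left h (Equiv.refl _) (Equiv.refl _) (by positivity) hx)
  intro f hf g hg
  exact this f ((mem_codeCAGB_iff h _ _ (Equiv.refl _) f).2 hf) g
    ((mem_codeCAGB_iff h _ _ (Equiv.refl _) g).2 hg)

/-- If few views are rejected, correction yields a codeword at distance at most `(1 + 4 * D) * bad /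
|G|`. Otherwise the trivial bound `dist ≤ 1` suffices, as `bad` is at least `ε |G| / (36 * D)`. -/
theorem natural_tester_soundness (h : IsDoubleCayley A B) [Nonempty A] [Nonempty B] {ε : ℝ}
    (hε : 0 < ε) (hε1 : ε ≤ 1) (hagr : AgreementTestable CA CB ε)
    (hxA : IsExpander (leftCayley (A : Set G)) (ε ^ 2 / 2500))
    (hxB : IsExpander (SimpleGraph.mulCayley (B : Set G)) (ε ^ 2 / 2500)) :
    (smallCodes A B CA CB).TesterHasSoundness
      (1 / (2 * max ((A.card : ℝ) / B.card) ((B.card : ℝ) / A.card)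
        * (250000 * (ε ^ 3)⁻¹ + 4800 * max (A.card : ℝ) B.card * ε⁻¹) + 1)) := by
  classical
  intro f
  have hn : (0 : ℝ) < Fintype.card G := by exact_mod_cast Fintype.card_pos
  have ha1 : (1 : ℝ) ≤ A.card := by
    rw [← Fintype.card_coe]; exact_mod_cast Fintype.card_pos
  have hb1 : (1 : ℝ) ≤ B.card := by
    rw [← Fintype.card_coe]; exact_mod_cast Fintype.card_pos
  set D := max (A.card : ℝ) B.card with hD
  have hD1 : 1 ≤ D := ha1.trans (le_max_left _ _)
  set r := max ((A.card : ℝ) / B.card) ((B.card : ℝ) / A.card) with hr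
  have hr1 : 1 ≤ r := by
    rcases le_total (A.card : ℝ) B.card with hab | hab
    · exact le_max_of_le_right ((one_le_div (by linarith)).2 hab)
    · exact le_max_of_le_left ((one_le_div (by linarith)).2 hab)
  set Q := 2 * r * (250000 * (ε ^ 3)⁻¹ + 4800 * D * ε⁻¹) + 1 with hQ
  -- This part of the denominator covers both `1 + 4 * D` and `36 * D * ε⁻¹`.
  have hQ1 : 9600 * D * ε⁻¹ + 1 ≤ Q := by
    have h1 : 0 ≤ 250000 * (ε ^ 3)⁻¹ := by positivity
    have h2 : 0 ≤ 4800 * D * ε⁻¹ := by positivity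
    have h3 : 1 * (250000 * (ε ^ 3)⁻¹ + 4800 * D * ε⁻¹) ≤
        r * (250000 * (ε ^ 3)⁻¹ + 4800 * D * ε⁻¹) :=
      mul_le_mul_of_nonneg_right hr1 (add_nonneg h1 h2)
    linarith
  have hQ0 : 0 < Q := lt_of_lt_of_le (by positivity) hQ1
  set S := cayleyComplex h (Equiv.refl A) (Equiv.refl B) with hS
  set bad : ℝ := ((Finset.univ.filter fun v => S.viewAt f v ∉
    productCode (relabel (Equiv.refl A) (Equiv.refl F) (CA : Set (A → F)))
      (relabel (Equiv.refl B) (Equiv.refl F) (CB : Set (B → F)))).card : ℝ) with hbad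
  have hrej : (smallCodes A B CA CB).rejectProb f = bad / Fintype.card G := by
    rw [SmallCodes.rejectProb, hbad]
    congr 3
  have hbad0 : 0 ≤ bad := Nat.cast_nonneg _
  rw [hrej, one_div, ← div_eq_inv_mul, div_le_div_iff₀ hQ0 hn]
  change distToCode f (codeCAGB A B CA CB) * _ ≤ _
  by_cases hsmall : 36 * D * bad < ε * Fintype.card G
  · obtain ⟨g, hg, hd⟩ := SquareComplex.exists_codeword_near (S := S) hε hε1
      (hagr.costTestable (Equiv.refl _) (Equiv.refl _) (Equiv.refl F))
      (expanderForm_left h (Equiv.refl _) (Equiv.refl _) (by positivity) hxA)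
      (expanderForm_right h (Equiv.refl _) (Equiv.refl _) (by positivity) hxB)
      ⟨0, fun _ => CB.zero_mem, fun _ => CA.zero_mem⟩ f (by simpa [Fintype.card_coe] using hsmall)
    rw [← hbad, Fintype.card_coe, Fintype.card_coe, ← hD] at hd
    have h1 := (distToCode_le f ((mem_codeCAGB_iff h _ _ (Equiv.refl _) g).1 hg)).trans_eq
      (relHamming_comm _ _)
    have h2 := h1.trans hd
    rw [← mul_div_assoc, le_div_iff₀ hn] at h2
    have h3 : 1 ≤ ε⁻¹ := (one_le_inv₀ hε).2 hε1
    have h4 : D * 1 ≤ D * ε⁻¹ := mul_le_mul_of_nonneg_left h3 (by linarith)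
    have h5 : (1 + 4 * D) * bad ≤ Q * bad := mul_le_mul_of_nonneg_right (by linarith) hbad0
    linarith
  · push Not at hsmall
    have h1 := (distToCode_le f (zero_mem_codeCAGB (CA := CA) (CB := CB))).trans
      (relHamming_le_one _ _)
    have h2 : (Fintype.card G : ℝ) ≤ 36 * D * ε⁻¹ * bad := by
      have := mul_le_mul_of_nonneg_left hsmall (inv_pos.2 hε).le
      rw [inv_mul_cancel_left₀ hε.ne'] at this
      linarith
    have h3 : 0 ≤ D * ε⁻¹ := by positivity
    have h4 : 36 * D * ε⁻¹ * bad ≤ Q * bad := mul_le_mul_of_nonneg_right (by linarith) hbad0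
    have h5 := mul_le_mul_of_nonneg_right h1 hn.le
    linarith

end DoubleCayley

/-! ### The rate -/

/-- The tensor code as a subspace of the matrices. -/
def tensorSubmodule {R S F : Type*} [Field F] (C₁ : Submodule F (R → F))
    (C₂ : Submodule F (S → F)) : Submodule F (R → S → F) where
  carrier := tensorCode C₁ C₂
  add_mem' h h' := ⟨fun i => C₂.add_mem (h.1 i) (h'.1 i), fun j => C₁.add_mem (h.2 j) (h'.2 j)⟩
  zero_mem' := ⟨fun _ => C₂.zero_mem, fun _ => C₁.zero_mem⟩
  smul_mem' c _ h := ⟨fun i => C₂.smul_mem c (h.1 i), fun j => C₁.smul_mem c (h.2 j)⟩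

/-- The outer products of the basis vectors of the two codes lie in the tensor code and are linearly
independent. -/
theorem finrank_tensorSubmodule_le {R S F : Type*} [Field F] [Fintype R] [Fintype S]
    (C₁ : Submodule F (R → F)) (C₂ : Submodule F (S → F)) :
    Module.finrank F C₁ * Module.finrank F C₂ ≤ Module.finrank F (tensorSubmodule C₁ C₂) := by
  set b₁ := Module.finBasis F C₁
  set b₂ := Module.finBasis F C₂
  set k := Module.finrank F C₁
  set l := Module.finrank F C₂
  have hmem : ∀ c : Fin k → Fin l → F,
      (fun i j => ∑ x, ∑ y, c x y * ((b₁ x : R → F) i * (b₂ y : S → F) j)) ∈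
        tensorSubmodule C₁ C₂ := by
    intro c
    refine ⟨fun i => ?_, fun j => ?_⟩
    · have : (fun j => ∑ x, ∑ y, c x y * ((b₁ x : R → F) i * (b₂ y : S → F) j)) =
          ∑ x, ∑ y, (c x y * (b₁ x : R → F) i) • (b₂ y : S → F) := by
        funext j
        simp [Finset.sum_apply, mul_assoc]
      beta_reduce
      rw [this]
      exact C₂.sum_mem fun x _ => C₂.sum_mem fun y _ => C₂.smul_mem _ (b₂ y).2
    · have : (fun i => ∑ x, ∑ y, c x y * ((b₁ x : R → F) i * (b₂ y : S → F) j)) =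
          ∑ x, ∑ y, (c x y * (b₂ y : S → F) j) • (b₁ x : R → F) := by
        funext i
        simp only [Finset.sum_apply, Pi.smul_apply, smul_eq_mul]
        exact Finset.sum_congr rfl fun x _ => Finset.sum_congr rfl fun y _ => by ring
      beta_reduce
      rw [this]
      exact C₁.sum_mem fun x _ => C₁.sum_mem fun y _ => C₁.smul_mem _ (b₁ x).2
  let T : (Fin k → Fin l → F) →ₗ[F] tensorSubmodule C₁ C₂ :=
    { toFun := fun c => ⟨_, hmem c⟩
      map_add' := fun c d => by
        ext i j
        simp [add_mul, Finset.sum_add_distrib]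
      map_smul' := fun c d => by
        ext i j
        simp [Finset.mul_sum, mul_assoc] }
  have hT : Function.Injective T := by
    rw [← LinearMap.ker_eq_bot, LinearMap.ker_eq_bot']
    intro c hc
    have h0 : ∀ i j, ∑ x, ∑ y, c x y * ((b₁ x : R → F) i * (b₂ y : S → F) j) = 0 := fun i j =>
      congrFun (congrFun (congrArg Subtype.val hc) i) j
    -- For a fixed row, independence of the basis of `C₂` applies; the basis of `C₁` is removed
    -- afterwards.
    have h1 : ∀ i, ∀ y, ∑ x, c x y * (b₁ x : R → F) i = 0 := by
      intro i
      refine Fintype.linearIndependent_iff.1 b₂.linearIndependent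
        (fun y => ∑ x, c x y * (b₁ x : R → F) i) (Subtype.ext (funext fun j => ?_))
      have := h0 i j
      rw [Finset.sum_comm] at this
      simp only [Submodule.coe_sum, Submodule.coe_smul, Finset.sum_apply, Pi.smul_apply,
        smul_eq_mul, Submodule.coe_zero, Pi.zero_apply]
      rw [← this]
      refine Finset.sum_congr rfl fun y _ => ?_
      rw [Finset.sum_mul]
      exact Finset.sum_congr rfl fun x _ => by ring
    funext x y
    refine Fintype.linearIndependent_iff.1 b₁.linearIndependent (fun x => c x y)
      (Subtype.ext (funext fun i => ?_)) x
    simpa [Submodule.coe_sum, Finset.sum_apply] using h1 i y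
  have := LinearMap.finrank_le_finrank_of_injective hT
  simpa [Module.finrank_pi_fintype] using this

/-- A family of linear constraints lowers the dimension at most by the sum of the codimensions. -/
theorem finrank_le_of_constraints {ι F E W : Type*} [Field F] [Fintype ι] [AddCommGroup E]
    [Module F E] [FiniteDimensional F E] [AddCommGroup W] [Module F W] [FiniteDimensional F W]
    (P : ι → E →ₗ[F] W) (T : Submodule F W) (C : Submodule F E)
    (hC : ∀ x, (∀ i, P i x ∈ T) → x ∈ C) :
    Module.finrank F E + Fintype.card ι * Module.finrank F T ≤
      Module.finrank F C + Fintype.card ι * Module.finrank F W := by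
  -- The kernel consists of the solutions of all constraints, and the target has the sum of the
  -- codimensions as its dimension.
  set L : E →ₗ[F] (ι → W ⧸ T) := LinearMap.pi fun i => T.mkQ ∘ₗ P i with hL
  have hker : LinearMap.ker L ≤ C := by
    intro x hx
    refine hC x fun i => ?_
    have := congrFun (LinearMap.mem_ker.1 hx) i
    simpa [hL] using this
  have h1 := L.finrank_range_add_finrank_ker
  have h2 := Submodule.finrank_mono hker
  have h3 := Submodule.finrank_le (LinearMap.range L)
  rw [Module.finrank_pi_fintype, Finset.sum_const, Finset.card_univ, smul_eq_mul] at h3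
  have h4 := T.finrank_quotient_add_finrank
  rw [← h4, mul_add]
  omega

theorem rate_eq {ι F : Type*} [Fintype ι] [Field F] [Fintype F]
    (C : Submodule F (ι → F)) : rate (C : Set (ι → F)) = Module.finrank F C / Fintype.card ι := by
  classical
  have hq : (1 : ℝ) < Fintype.card F := by exact_mod_cast Fintype.one_lt_card
  have h1 : (Nat.card (ι → F) : ℝ) = (Fintype.card F : ℝ) ^ Fintype.card ι := by
    rw [Nat.card_eq_fintype_card, Fintype.card_fun]
    push_cast
    rfl
  have h2 : (Nat.card (C : Set (ι → F)) : ℝ) = (Fintype.card F : ℝ) ^ Module.finrank F C := by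
    have := Module.natCard_eq_pow_finrank (K := F) (V := C)
    rw [Nat.card_eq_fintype_card (α := F)] at this
    exact_mod_cast this
  rw [rate, h1, h2, Real.logb, Real.log_pow, Real.log_pow,
    mul_div_mul_right _ _ (Real.log_pos hq).ne']

variable {G : Type*} [Group G] [Fintype G] {A B : Finset G} {F : Type*} [Field F]

/-- The code `C(A, G, B)` as a subspace. -/
def codeSubmodule (CA : Submodule F (A → F)) (CB : Submodule F (B → F)) :
    Submodule F (Squares A B → F) where
  carrier := codeCAGB A B CA CB
  add_mem' h h' g := (tensorSubmodule CA CB).add_mem (h g) (h' g)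
  zero_mem' := zero_mem_codeCAGB
  smul_mem' c _ h g := (tensorSubmodule CA CB).smul_mem c (h g)

/-- Each `g ∈ G` imposes at most `|A| |B| - dim C_A * dim C_B` constraints, and there are only `|G|
|A| |B| / 4` squares. Division produces the factor 4 and `1 - 4 = -3`. -/
theorem le_rate_codeCAGB [Fintype F] (h : IsDoubleCayley A B) [Nonempty A] [Nonempty B]
    (CA : Submodule F (A → F)) (CB : Submodule F (B → F)) :
    4 * rate (CA : Set (A → F)) * rate (CB : Set (B → F)) - 3 ≤
      rate (codeCAGB A B CA CB) := by
  let P : G → (Squares A B → F) →ₗ[F] (A → B → F) := fun g =>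
    LinearMap.pi fun a => LinearMap.pi fun b => LinearMap.proj (phi A B g a b)
  have h1 := finrank_le_of_constraints P (tensorSubmodule CA CB) (codeSubmodule CA CB)
    (fun x hx g => hx g)
  have h2 := finrank_tensorSubmodule_le CA CB
  have h3 := (cayleyComplex h (Equiv.refl A) (Equiv.refl B)).card_squares
  change _ ≤ rate (codeSubmodule CA CB : Set (Squares A B → F))
  rw [rate_eq, rate_eq, rate_eq]
  simp only [Module.finrank_fintype_fun_eq_card, Module.finrank_pi_fintype, Finset.sum_const,
    Finset.card_univ, smul_eq_mul] at h1
  have h4 := h1.trans' (Nat.add_le_add_left (Nat.mul_le_mul_left (Fintype.card G) h2) _)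
  have hn : (0 : ℝ) < Fintype.card G := by exact_mod_cast Fintype.card_pos
  have ha : (0 : ℝ) < Fintype.card A := by exact_mod_cast Fintype.card_pos
  have hb : (0 : ℝ) < Fintype.card B := by exact_mod_cast Fintype.card_pos
  have h5 : (Fintype.card (Squares A B) : ℝ) =
      Fintype.card G * Fintype.card A * Fintype.card B / 4 := by
    have : (4 * Fintype.card (Squares A B) : ℝ) =
        Fintype.card G * Fintype.card A * Fintype.card B := by
      exact_mod_cast h3
    linarith
  have h6 : (Fintype.card (Squares A B) + Fintype.card G *
      (Module.finrank F CA * Module.finrank F CB) : ℝ) ≤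
      Module.finrank F (codeSubmodule CA CB) +
        Fintype.card G * (Fintype.card A * Fintype.card B) := by
    exact_mod_cast h4
  rw [h5] at h6 ⊢
  rw [le_div_iff₀ (by positivity)]
  field_simp
  linarith

/-! ### Reasoning about programs -/

/-- Started on `σ`, the program `p` halts within `T` steps in a memory that satisfies `Q`. -/
def Exec (W : ℕ) (p : Prog) (σ : Store) (T : ℕ) (Q : Store → Prop) : Prop :=
  ∃ τ t, Runs W p σ τ t ∧ t ≤ T ∧ Q τ

namespace Exec

variable {W : ℕ} {p q : Prog} {σ : Store} {T T' : ℕ} {Q Q' : Store → Prop}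

theorem mono (h : Exec W p σ T Q) (hT : T ≤ T') (hQ : ∀ τ, Q τ → Q' τ) : Exec W p σ T' Q' := by
  obtain ⟨τ, t, hr, ht, hq⟩ := h
  exact ⟨τ, t, hr, ht.trans hT, hQ τ hq⟩

theorem skip (h : Q σ) : Exec W .skip σ 1 Q := ⟨σ, 1, .skip σ, le_rfl, h⟩

theorem write {x : ℕ} {i e : Expr} (hi : i.eval σ ≤ W) (he : e.eval σ ≤ W)
    (h : Q (Function.update σ x (Function.update (σ x) (i.eval σ) (e.eval σ)))) :
    Exec W (.write x i e) σ (i.cost + e.cost + 1) Q :=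
  ⟨_, _, .write σ x i e hi he, le_rfl, h⟩

theorem seq (h : Exec W p σ T fun τ => Exec W q τ T' Q) : Exec W (.seq p q) σ (T + T') Q := by
  obtain ⟨τ, t, hr, ht, τ', t', hr', ht', hq⟩ := h
  exact ⟨τ', t + t', .seq hr hr', Nat.add_le_add ht ht', hq⟩

theorem write_seq {x : ℕ} {i e : Expr} (hi : i.eval σ ≤ W) (he : e.eval σ ≤ W)
    (h : Exec W q (Function.update σ x (Function.update (σ x) (i.eval σ) (e.eval σ))) T Q) :
    Exec W (.seq (.write x i e) q) σ (T + (i.cost + e.cost + 1)) Q :=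
  ((write hi he h).seq).mono (Nat.add_comm _ _).le fun _ => id

theorem ite_true {e : Expr} (he : e.eval σ ≠ 0) (h : Exec W p σ T Q) :
    Exec W (.ite e p q) σ (e.cost + T + 1) Q := by
  obtain ⟨τ, t, hr, ht, hq⟩ := h
  exact ⟨τ, _, .ite_true he hr, by omega, hq⟩

theorem ite_false {e : Expr} (he : e.eval σ = 0) (h : Exec W q σ T Q) :
    Exec W (.ite e p q) σ (e.cost + T + 1) Q := by
  obtain ⟨τ, t, hr, ht, hq⟩ := h
  exact ⟨τ, _, .ite_false he hr, by omega, hq⟩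

/-- A loop whose body decreases the measure `k` of the invariant `I k`. -/
theorem loop {e : Expr} {I : ℕ → Store → Prop}
    (hbody : ∀ k σ, I k σ → e.eval σ ≠ 0 → Exec W p σ T fun τ => ∃ k' < k, I k' τ) {k : ℕ}
    (h : I k σ) :
    Exec W (.loop e p) σ ((e.cost + T + 1) * k + (e.cost + 1))
      fun τ => (∃ k', I k' τ) ∧ e.eval τ = 0 := by
  induction k using Nat.strong_induction_on generalizing σ with
  | _ k ih =>
    by_cases he : e.eval σ = 0
    · exact ⟨σ, e.cost + 1, by constructor; exact he, Nat.le_add_left _ _, ⟨k, h⟩, he⟩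
    · obtain ⟨τ, t, hr, ht, k', hk', hI⟩ := hbody k σ h he
      obtain ⟨τ', t', hr', ht', hq⟩ := ih k' hk' hI
      refine ⟨τ', _, .loop_step he hr hr', ?_, hq⟩
      have : (e.cost + T + 1) * (k' + 1) ≤ (e.cost + T + 1) * k := Nat.mul_le_mul_left _ hk'
      rw [Nat.mul_add, Nat.mul_one] at this
      omega

end Exec

/-- Run `f v` where `v ≤ K` is the value of `e`. -/
def caseOf (e : Expr) (f : ℕ → Prog) : ℕ → Prog
  | 0 => f 0
  -- With truncated subtraction the test is nonzero exactly when `e > K`.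
  | K + 1 => .ite (.sub e (.lit K)) (f (K + 1)) (caseOf e f K)

theorem Exec.caseOf {W : ℕ} {e : Expr} {f : ℕ → Prog} {K : ℕ} {σ : Store} {T : ℕ}
    {Q : Store → Prop} (he : e.eval σ ≤ K) (h : Exec W (f (e.eval σ)) σ T Q) :
    Exec W (caseOf e f K) σ (T + (e.cost + 3) * K) Q := by
  induction K with
  | zero =>
    rw [Nat.le_zero.1 he] at h
    exact h.mono (by omega) fun _ => id
  | succ K ih =>
    rcases Nat.lt_or_ge K (e.eval σ) with hK | hK
    · have : e.eval σ = K + 1 := by omega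
      rw [this] at h
      refine (Exec.ite_true (by simp only [Expr.eval]; omega) h).mono ?_ fun _ => id
      simp only [Expr.cost, Nat.mul_add]
      omega
    · refine (Exec.ite_false (by simp only [Expr.eval]; omega) (ih hK)).mono ?_ fun _ => id
      simp only [Expr.cost, Nat.mul_add]
      omega

section Branch

variable {ι : Type*}

open Classical in
/-- Run `f v` where `v i ≤ K` is the value of `e i` for `i` in the list. -/
def branchList (e : ι → Expr) (K : ℕ) (f : (ι → ℕ) → Prog) : List ι → (ι → ℕ) → Prog
  | [], v => f v
  | i :: l, v => caseOf (e i) (fun a => branchList e K f l (Function.update v i a)) K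

open Classical in
theorem Exec.branchList {W : ℕ} {e : ι → Expr} {K : ℕ} {f : (ι → ℕ) → Prog} {σ : Store} {T : ℕ}
    {Q : Store → Prop} (he : ∀ i, (e i).eval σ ≤ K) (l : List ι) (v : ι → ℕ)
    (h : Exec W (f fun i => if i ∈ l then (e i).eval σ else v i) σ T Q) :
    Exec W (branchList e K f l v) σ (T + (l.map fun i => ((e i).cost + 3) * K).sum) Q := by
  induction l generalizing v with
  | nil => simpa [SquareLTC.branchList] using h
  | cons i l ih =>
    have := ih (Function.update v i ((e i).eval σ)) (by
      convert h using 2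
      funext k
      by_cases hk : k ∈ l
      · simp [hk]
      · by_cases hki : k = i
        · subst hki; simp
        · simp [hk, hki])
    refine (Exec.caseOf (f := fun a => SquareLTC.branchList e K f l (Function.update v i a))
      (he i) this).mono ?_ fun _ => id
    simp only [List.map_cons, List.sum_cons]
    omega

/-- Run `f v` where `v i ≤ K` is the value of `e i`. -/
def branch [Fintype ι] (e : ι → Expr) (K : ℕ) (f : (ι → ℕ) → Prog) : Prog :=
  branchList e K f Finset.univ.toList 0

/-- The time that it takes to branch. -/
def branchCost [Fintype ι] (e : ι → Expr) (K : ℕ) : ℕ := ∑ i, ((e i).cost + 3) * K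

theorem Exec.branch [Fintype ι] {W : ℕ} {e : ι → Expr} {K : ℕ} {f : (ι → ℕ) → Prog} {σ : Store}
    {T : ℕ} {Q : Store → Prop} (he : ∀ i, (e i).eval σ ≤ K)
    (h : Exec W (f fun i => (e i).eval σ) σ T Q) :
    Exec W (branch e K f) σ (T + branchCost e K) Q := by
  have := Exec.branchList he Finset.univ.toList 0 (f := f) (by simpa using h)
  simpa [SquareLTC.branch, branchCost, Finset.sum_map_toList] using this

/-- Run the programs `p i` one after the other. -/
def forList (p : ι → Prog) : List ι → Prog
  | [] => .skip
  | i :: l => .seq (p i) (forList p l)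

theorem Exec.forList {W : ℕ} {p : ι → Prog} {T : ℕ} {I : List ι → Store → Prop}
    (hstep : ∀ i l σ, I (i :: l) σ → Exec W (p i) σ T (I l)) (l : List ι) {σ : Store}
    (h : I l σ) : Exec W (forList p l) σ (T * l.length + 1) (I []) := by
  induction l generalizing σ with
  | nil => exact .skip h
  | cons i l ih =>
    refine (Exec.seq ((hstep i l σ h).mono le_rfl fun τ hτ => ih hτ)).mono ?_ fun _ => id
    simp only [List.length_cons, Nat.mul_add]
    omega

end Branch

/-- The current vertex of a loop. -/
def vertexE : Expr := .read 10 (.lit 1)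

/-- Run `p` for all vertices, in decreasing order. -/
def forVertices (p : Prog) : Prog :=
  .seq (.write 10 (.lit 1) (.read 0 (.lit 0)))
    (.loop vertexE (.seq (.write 10 (.lit 1) (.sub vertexE (.lit 1))) p))

/-- `J k` is the invariant once all vertices with number at least `k` are done. It must ignore array
10, which holds the loop counter. -/
theorem Exec.forVertices {W n T : ℕ} {p : Prog} {J : ℕ → Store → Prop} (h1W : 1 ≤ W) (hW : n ≤ W)
    (hJ : ∀ k σ f, J k σ → J k (Function.update σ 10 f))
    (hbody : ∀ k < n, ∀ σ, J (k + 1) σ → σ 10 1 = k →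
      Exec W p σ T fun τ => J k τ ∧ τ 10 1 = k) {σ : Store} (h : J n σ) (hn : σ 0 0 = n) :
    Exec W (forVertices p) σ ((T + 9) * n + 7) (J 0) := by
  have hloop := Exec.loop (W := W) (e := vertexE)
    (p := .seq (.write 10 (.lit 1) (.sub vertexE (.lit 1))) p) (T := T + 6)
    (I := fun k σ => k ≤ n ∧ J k σ ∧ σ 10 1 = k)
    (fun k σ ⟨hk, hJk, hσ⟩ he => by
      have hk0 : k ≠ 0 := by simpa [vertexE, Expr.eval, hσ] using he
      obtain ⟨k, rfl⟩ := Nat.exists_eq_succ_of_ne_zero hk0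
      refine Exec.mono (Exec.write_seq (T := T) (Q := fun τ => J k τ ∧ τ 10 1 = k)
        (by simpa [Expr.eval]) (by simp [vertexE, Expr.eval, hσ]; omega)
        (hbody k (by omega) _ (hJ _ _ _ hJk) (by simp [vertexE, Expr.eval, hσ])))
        (by simp [vertexE, Expr.cost]) ?_
      rintro τ ⟨h1, h2⟩
      exact ⟨k, by omega, by omega, h1, h2⟩) (σ := Function.update σ 10
        (Function.update (σ 10) ((Expr.lit 1).eval σ) ((Expr.read 0 (.lit 0)).eval σ))) (k := n)
    ⟨le_rfl, hJ _ _ _ h, by simp [Expr.eval, hn]⟩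
  refine Exec.mono (Exec.write_seq (by simpa [Expr.eval]) (by simpa [Expr.eval, hn]) hloop)
    (by simp [vertexE, Expr.cost]; ring_nf; omega) ?_
  rintro τ ⟨⟨k, -, h1, h2⟩, h3⟩
  have : k = 0 := by simpa [vertexE, Expr.eval, h2] using h3
  exact this ▸ h1

/-! ### The decoder -/

section Decoder

variable {α β q : ℕ}

/-- The number of a local view. -/
def viewCode (t : Fin α → Fin β → Fin q) : ℕ := Fintype.equivFin (Fin α → Fin β → Fin q) t

/-- The number of local views. -/
def viewCount (α β q : ℕ) : ℕ := Fintype.card (Fin α → Fin β → Fin q)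

theorem viewCode_le (t : Fin α → Fin β → Fin q) : viewCode t ≤ viewCount α β q :=
  (Fintype.equivFin (Fin α → Fin β → Fin q) t).2.le

theorem viewCode_injective : Function.Injective (viewCode (α := α) (β := β) (q := q)) :=
  Fin.val_injective.comp (Equiv.injective _)

/-- The letter with a given number. -/
def letterOf [Nonempty (Fin q)] : ℕ → Fin q := Function.invFun Fin.val

theorem letterOf_val [Nonempty (Fin q)] (x : Fin q) : letterOf (x : ℕ) = x :=
  Function.leftInverse_invFun Fin.val_injective x

/-- The local view with a given number. -/
def viewOf [Nonempty (Fin q)] : ℕ → Fin α → Fin β → Fin q := Function.invFun viewCode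

theorem viewOf_viewCode [Nonempty (Fin q)] (t : Fin α → Fin β → Fin q) :
    viewOf (viewCode t) = t :=
  Function.leftInverse_invFun viewCode_injective t

/-- The current vertex or one of its neighbours. -/
def neighbourE (α β : ℕ) : Option (Fin α ⊕ Fin β) → Expr
  | none => vertexE
  | some (.inl i) => .read 1 (.add (.mul vertexE (.lit α)) (.lit i))
  | some (.inr j) => .read 2 (.add (.mul vertexE (.lit β)) (.lit j))

/-- A square at the current vertex. -/
def squareE (p : Fin α × Fin β) : Expr :=
  .read 3 (.add (.mul (.add (.mul vertexE (.lit α)) (.lit p.1)) (.lit β)) (.lit p.2))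

theorem cost_squareE (p : Fin α × Fin β) : (squareE p).cost = 11 := rfl

theorem cost_neighbourE_le (x : Option (Fin α ⊕ Fin β)) : (neighbourE α β x).cost ≤ 7 := by
  rcases x with _ | i | j <;> simp [neighbourE, vertexE, Expr.cost]

/-- The number of vertices on the stack of vertices at which correction may be possible. -/
def stackE : Expr := .read 10 (.lit 0)

/-- Choose the initial view at the current vertex and put the vertex on the stack. -/
def initVertex [Nonempty (Fin q)] (init : (Fin α → Fin β → Fin q) → Fin α → Fin β → Fin q) :
    Prog :=
  branch (fun p : Fin α × Fin β => .read 4 (squareE p)) q fun vals =>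
    .seq (.write 8 vertexE (.lit (viewCode (init fun i j => letterOf (vals (i, j))))))
      (.write 9 vertexE vertexE)

/-- Put a neighbour of the current vertex on the stack. -/
def pushNeighbour (α β : ℕ) (x : Fin α ⊕ Fin β) : Prog :=
  .seq (.write 9 stackE (neighbourE α β (some x))) (.write 10 (.lit 0) (.add stackE (.lit 1)))

/-- Correct the view at the vertex on the top of the stack if this is possible. -/
def correctTop [Nonempty (Fin q)]
    (rule : (Option (Fin α ⊕ Fin β) → Fin α → Fin β → Fin q) → Option (Fin α → Fin β → Fin q)) :
    Prog :=
  .seq (.write 10 (.lit 1) (.read 9 (.sub stackE (.lit 1))))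
    (branch (fun x => .read 8 (neighbourE α β x)) (viewCount α β q) fun vals =>
      match rule fun x => viewOf (vals x) with
      -- The vertex is popped only if it cannot be corrected. A corrected vertex stays below its
      -- neighbours on the stack.
      | none => .write 10 (.lit 0) (.sub stackE (.lit 1))
      | some t => .seq (.write 8 vertexE (.lit (viewCode t)))
          (forList (pushNeighbour α β) Finset.univ.toList))

/-- Write the letters of the view at the current vertex to the output. -/
def outputVertex [Nonempty (Fin q)] (α β : ℕ) : Prog :=
  branch (fun _ : Unit => .read 8 vertexE) (viewCount α β q) fun vals =>
    forList (fun p : Fin α × Fin β =>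
      .write 7 (squareE p) (.lit (viewOf (α := α) (β := β) (q := q) (vals ()) p.1 p.2 : Fin q)))
      Finset.univ.toList

/-- The decoder for given rules for the choice of the views. -/
def decoder [Nonempty (Fin q)] (init : (Fin α → Fin β → Fin q) → Fin α → Fin β → Fin q)
    (rule : (Option (Fin α ⊕ Fin β) → Fin α → Fin β → Fin q) → Option (Fin α → Fin β → Fin q)) :
    Prog :=
  -- Array 8 holds the codes of the views and array 9 the stack, whose size is cell 0 of array 10;
  -- cell 1 is the current vertex. Initialization writes `v` to cell `v` of array 9, so setting the
  -- size to `|V|` puts all vertices on the stack.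
  .seq (forVertices (initVertex init)) (.seq (.write 10 (.lit 0) (.read 0 (.lit 0)))
    (.seq (.loop stackE (correctTop rule)) (forVertices (outputVertex (q := q) α β))))

variable {V X : Type*} {n N : ℕ}

/-- The vertex itself or one of its neighbours. -/
def SquareComplex.neighbour (S : SquareComplex V (Fin α) (Fin β) X) :
    Option (Fin α ⊕ Fin β) → V → V
  | none => id
  | some (.inl i) => S.left i
  | some (.inr j) => S.right j

/-- The memory `σ` holds the tables of the square complex `S` and the word `y`. -/
structure HoldsWord (S : SquareComplex V (Fin α) (Fin β) X) (eV : V ≃ Fin n) (eX : X ≃ Fin N)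
    (y : X → Fin q) (σ : Store) : Prop where
  card : σ 0 0 = n
  left : ∀ (v : V) (i : Fin α), σ 1 (eV v * α + i) = eV (S.left i v)
  right : ∀ (v : V) (j : Fin β), σ 2 (eV v * β + j) = eV (S.right j v)
  square : ∀ (v : V) (i : Fin α) (j : Fin β), σ 3 ((eV v * α + i) * β + j) = eX (S.sq v i j)
  word : ∀ s, σ 4 (eX s) = y s

variable {S : SquareComplex V (Fin α) (Fin β) X} {eV : V ≃ Fin n} {eX : X ≃ Fin N}
  {y : X → Fin q} {σ : Store}

theorem HoldsWord.update (h : HoldsWord S eV eX y σ) (x : ℕ) (hx : 5 ≤ x) (f : ℕ → ℕ) :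
    HoldsWord S eV eX y (Function.update σ x f) := by
  have : ∀ k < 5, Function.update σ x f k = σ k := fun k hk =>
    Function.update_of_ne (by omega) _ _
  constructor
  · rw [this 0 (by norm_num)]; exact h.card
  · rw [this 1 (by norm_num)]; exact h.left
  · rw [this 2 (by norm_num)]; exact h.right
  · rw [this 3 (by norm_num)]; exact h.square
  · rw [this 4 (by norm_num)]; exact h.word

theorem HoldsWord.eval_square (h : HoldsWord S eV eX y σ) {v : V} (hv : σ 10 1 = eV v)
    (p : Fin α × Fin β) : (squareE p).eval σ = eX (S.sq v p.1 p.2) := by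
  simp [squareE, vertexE, Expr.eval, hv, h.square]

theorem HoldsWord.eval_neighbour (h : HoldsWord S eV eX y σ) {v : V} (hv : σ 10 1 = eV v)
    (x : Option (Fin α ⊕ Fin β)) : (neighbourE α β x).eval σ = eV (S.neighbour x v) := by
  rcases x with _ | i | j
  · simp [neighbourE, vertexE, Expr.eval, hv, SquareComplex.neighbour]
  · simp [neighbourE, vertexE, Expr.eval, hv, h.left, SquareComplex.neighbour]
  · simp [neighbourE, vertexE, Expr.eval, hv, h.right, SquareComplex.neighbour]

theorem eval_vertexE (σ : Store) : vertexE.eval σ = σ 10 1 := rfl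

theorem eval_stackE (σ : Store) : stackE.eval σ = σ 10 0 := rfl

variable [Nonempty (Fin q)] {W : ℕ}
  {init : (Fin α → Fin β → Fin q) → Fin α → Fin β → Fin q}
  {rule : (Option (Fin α ⊕ Fin β) → Fin α → Fin β → Fin q) → Option (Fin α → Fin β → Fin q)}

theorem exec_init (hW : 1 ≤ W) (hn : n ≤ W) (hK : viewCount α β q ≤ W)
    (h : HoldsWord S eV eX y σ) :
    Exec W (forVertices (initVertex init)) σ
      ((9 + branchCost (fun p : Fin α × Fin β => .read 4 (squareE p)) q + 9) * n + 7)
      fun τ => HoldsWord S eV eX y τ ∧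
        ∀ v, τ 8 (eV v) = viewCode (init (S.viewAt y v)) ∧ τ 9 (eV v) = eV v := by
  refine (Exec.forVertices (J := fun k τ => HoldsWord S eV eX y τ ∧ ∀ v, k ≤ (eV v : ℕ) →
      τ 8 (eV v) = viewCode (init (S.viewAt y v)) ∧ τ 9 (eV v) = eV v) hW hn ?_ ?_
    ⟨h, fun v hv => absurd (eV v).2 (by omega)⟩ h.card).mono le_rfl fun τ hτ =>
      ⟨hτ.1, fun v => hτ.2 v (Nat.zero_le _)⟩
  · rintro k σ f ⟨h1, h2⟩
    exact ⟨h1.update 10 (by norm_num) f, by simpa using h2⟩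
  · rintro k hk σ ⟨h1, h2⟩ hσ
    obtain ⟨v, hv⟩ : ∃ v, (eV v : ℕ) = k := ⟨eV.symm ⟨k, hk⟩, by simp⟩
    rw [← hv] at hσ
    have hval : ∀ p : Fin α × Fin β,
        (Expr.read 4 (squareE p)).eval σ = y (S.sq v p.1 p.2) := fun p => by
      simp only [Expr.eval, h1.eval_square hσ, h1.word]
    refine Exec.branch (T := 9) (fun p => ?_) ?_
    · rw [hval]; exact (y _).2.le
    · simp only [hval, letterOf_val]
      refine Exec.mono (Exec.write_seq (by rw [eval_vertexE, hσ]; exact (eV v).2.le.trans hn)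
        ((viewCode_le _).trans hK) (Exec.write (by
          simp only [eval_vertexE]; simp only [Function.update_apply]; simp [hσ]
          exact (eV v).2.le.trans hn) (by
          simp only [eval_vertexE]; simp only [Function.update_apply]; simp [hσ]
          exact (eV v).2.le.trans hn) ?_)) (by simp [vertexE, Expr.cost]) fun _ => id
      refine ⟨⟨(h1.update 8 (by norm_num) _).update 9 (by norm_num) _, ?_⟩, ?_⟩
      · intro u hu
        rw [← hv] at hu
        by_cases huv : u = v
        · subst huv
          simp [eval_vertexE, hσ, Expr.eval]
          rfl
        · have hne : (eV u : ℕ) ≠ eV v := fun e => huv (eV.injective (Fin.ext e))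
          have := h2 u (by omega)
          simpa [eval_vertexE, Function.update_apply, hσ, hne] using this
      · simp [hσ, hv]

theorem exec_output (hW : 1 ≤ W) (hn : n ≤ W) (hN : N ≤ W) (hq : q ≤ W) {f : X → Fin q}
    (h : HoldsWord S eV eX y σ) (hz : ∀ v, σ 8 (eV v) = viewCode (S.viewAt f v)) :
    Exec W (forVertices (outputVertex (q := q) α β)) σ
      ((13 * (α * β) + 1 + branchCost (fun _ : Unit => .read 8 vertexE) (viewCount α β q) + 9)
        * n + 7)
      fun τ => ∀ s, τ 7 (eX s) = f s := by
  refine (Exec.forVertices (J := fun k τ => HoldsWord S eV eX y τ ∧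
      (∀ v, τ 8 (eV v) = viewCode (S.viewAt f v)) ∧ ∀ v, k ≤ (eV v : ℕ) →
      ∀ i j, τ 7 (eX (S.sq v i j)) = f (S.sq v i j)) hW hn ?_ ?_
    ⟨h, hz, fun v hv => absurd (eV v).2 (by omega)⟩ h.card).mono le_rfl fun τ hτ s => ?_
  · rintro k σ g ⟨h1, h2, h3⟩
    exact ⟨h1.update 10 (by norm_num) g, by simpa using h2, by simpa using h3⟩
  · rintro k hk σ ⟨h1, h2, h3⟩ hσ
    obtain ⟨v, hv⟩ : ∃ v, (eV v : ℕ) = k := ⟨eV.symm ⟨k, hk⟩, by simp⟩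
    rw [← hv] at hσ
    have hval : (Expr.read 8 vertexE).eval σ = viewCode (S.viewAt f v) := by
      simp only [Expr.eval, eval_vertexE, hσ, h2]
    refine Exec.branch (T := 13 * (α * β) + 1) (fun _ => ?_) ?_
    · rw [hval]; exact viewCode_le _
    · simp only [hval, viewOf_viewCode]
      refine (Exec.forList (T := 13) (I := fun l τ => HoldsWord S eV eX y τ ∧ τ 10 1 = eV v ∧
        (∀ v, τ 8 (eV v) = viewCode (S.viewAt f v)) ∧
        (∀ u, k + 1 ≤ (eV u : ℕ) → ∀ i j, τ 7 (eX (S.sq u i j)) = f (S.sq u i j)) ∧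
        ∀ p ∉ l, τ 7 (eX (S.sq v p.1 p.2)) = f (S.sq v p.1 p.2)) ?_ _
        ⟨h1, hσ, h2, h3, fun p hp => absurd (by simp) hp⟩).mono (by simp) ?_
      · rintro p l τ ⟨t1, t2, t3, t4, t5⟩
        refine Exec.mono (Exec.write (by rw [t1.eval_square t2]; exact (eX _).2.le.trans hN)
          ((Fin.is_lt _).le.trans hq) ?_) (by simp [cost_squareE, Expr.cost]) fun _ => id
        have key : ∀ s, τ 7 (eX s) = f s → Function.update (τ 7) ((squareE p).eval τ)
            ((Expr.lit (S.viewAt f v p.1 p.2 : Fin q)).eval τ) (eX s) = f s := by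
          intro s hs
          rw [t1.eval_square t2, Function.update_apply]
          split_ifs with e
          · rw [eX.injective (Fin.ext e)]
            rfl
          · exact hs
        refine ⟨t1.update 7 (by norm_num) _, by simpa using t2, by simpa using t3, ?_, ?_⟩
        · intro u hu i j
          rw [Function.update_self]
          exact key _ (t4 u hu i j)
        · intro p' hp'
          rw [Function.update_self]
          by_cases hpp : p' = p
          · subst hpp
            rw [t1.eval_square t2, Function.update_self]
            rfl
          · exact key _ (t5 p' (by simp [hpp, hp']))
      · rintro τ ⟨t1, t2, t3, t4, t5⟩
        refine ⟨⟨t1, t3, fun u hu i j => ?_⟩, t2.trans hv⟩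
        by_cases huv : u = v
        · subst huv
          exact t5 (i, j) (by simp)
        · have hne : (eV u : ℕ) ≠ eV v := fun e => huv (eV.injective (Fin.ext e))
          exact t4 u (by omega) i j
  · obtain ⟨v, i, j, rfl⟩ := S.exists_sq s
    exact hτ.2.2 v (Nat.zero_le _) i j

/-- What the rule of the decoder has to satisfy. -/
structure IsCorrection (S : SquareComplex V (Fin α) (Fin β) X) (L : Set (Fin α → Fin β → Fin q))
    (rule : (Option (Fin α ⊕ Fin β) → Fin α → Fin β → Fin q) → Option (Fin α → Fin β → Fin q)) :
    Prop where
  none : ∀ (z : V → Fin α → Fin β → Fin q) (v : V),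
    rule (fun x => z (S.neighbour x v)) = none → S.Stable L z v
  some : ∀ (z : V → Fin α → Fin β → Fin q) (v : V) t,
    rule (fun x => z (S.neighbour x v)) = some t →
      t ∈ L ∧ 2 * localCost t (S.rowsAt z v) (S.colsAt z v) < S.costAt z v

/-- Entries are only added above the old top, so the old stack survives. The condition on `x ∉ l` in
the loop records which neighbours have been pushed so far. -/
theorem exec_pushNeighbours {v : V} {z : V → Fin α → Fin β → Fin q} {sp : ℕ} (hn : n ≤ W)
    (hsp : sp + (α + β) ≤ W) (h : HoldsWord S eV eX y σ) (hσ : σ 10 1 = eV v) (hσ0 : σ 10 0 = sp)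
    (h8 : ∀ u, σ 8 (eV u) = viewCode (z u)) (h9 : ∀ k < sp, ∃ u, σ 9 k = eV u) :
    Exec W (forList (pushNeighbour α β) Finset.univ.toList) σ (16 * (α + β) + 1) fun τ =>
      HoldsWord S eV eX y τ ∧ τ 10 0 = sp + (α + β) ∧ (∀ u, τ 8 (eV u) = viewCode (z u)) ∧
      (∀ k < sp, τ 9 k = σ 9 k) ∧ (∀ k < sp + (α + β), ∃ u, τ 9 k = eV u) ∧
      ∀ x, ∃ k < sp + (α + β), τ 9 k = eV (S.neighbour (some x) v) := by
  refine (Exec.forList (T := 16) (I := fun l τ => HoldsWord S eV eX y τ ∧ τ 10 1 = eV v ∧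
    τ 10 0 + l.length = sp + (α + β) ∧ sp ≤ τ 10 0 ∧
    (∀ u, τ 8 (eV u) = viewCode (z u)) ∧
    (∀ k < sp, τ 9 k = σ 9 k) ∧ (∀ k < τ 10 0, ∃ u, τ 9 k = eV u) ∧
    ∀ x ∉ l, ∃ k < τ 10 0, τ 9 k = eV (S.neighbour (some x) v)) ?_ _
    ⟨h, hσ, by simp [hσ0], hσ0.ge, h8, fun _ _ => rfl, by rwa [hσ0],
      fun x hx => absurd (by simp) hx⟩).mono (by simp) ?_
  · rintro x l τ ⟨t1, t2, t3, t4, t5, t6, t7, t8⟩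
    have hlen : τ 10 0 + (l.length + 1) = sp + (α + β) := by simpa using t3
    refine Exec.mono (Exec.write_seq (by rw [eval_stackE]; omega)
      (by rw [t1.eval_neighbour t2]; exact (eV _).2.le.trans hn)
      (Exec.write (by simp [Expr.eval])
        (by simp only [Expr.eval, stackE]; simp; omega) ?_)) (by
          have := cost_neighbourE_le (some x)
          simp only [stackE, Expr.cost]
          omega) fun _ => id
    rw [t1.eval_neighbour t2]
    set τ' := Function.update τ 9 (Function.update (τ 9) (stackE.eval τ)
      (eV (S.neighbour (some x) v))) with hτ'
    set ρ := Function.update τ' 10 (Function.update (τ' 10) ((Expr.lit 0).eval τ')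
      ((stackE.add (.lit 1)).eval τ')) with hρ
    have e0 : ρ 10 0 = τ 10 0 + 1 := by simp [hρ, hτ', Expr.eval, eval_stackE]
    have e1 : ρ 10 1 = τ 10 1 := by simp [hρ, hτ', Expr.eval]
    have e8 : ρ 8 = τ 8 := by simp [hρ, hτ']
    have e9 : ρ 9 = Function.update (τ 9) (τ 10 0) (eV (S.neighbour (some x) v)) := by
      simp [hρ, hτ', eval_stackE]
    refine ⟨(t1.update 9 (by norm_num) _).update 10 (by norm_num) _, e1.trans t2, by omega,
      by omega, by rwa [e8], ?_, ?_, ?_⟩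
    · intro k hk
      rw [e9, Function.update_of_ne (by omega)]
      exact t6 k hk
    · intro k hk
      rw [e9]
      rcases Nat.lt_succ_iff_lt_or_eq.1 (e0 ▸ hk) with hk | hk
      · obtain ⟨u, hu⟩ := t7 k hk
        exact ⟨u, by rw [Function.update_of_ne hk.ne, hu]⟩
      · exact ⟨_, by rw [hk, Function.update_self]⟩
    · intro x' hx'
      rw [e9, e0]
      by_cases hxx : x' = x
      · subst hxx
        exact ⟨τ 10 0, Nat.lt_succ_self _, by rw [Function.update_self]⟩
      · obtain ⟨k, hk, hk'⟩ := t8 x' (by simp [hxx, hx'])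
        exact ⟨k, by omega, by rw [Function.update_of_ne hk.ne, hk']⟩
  · rintro τ ⟨t1, -, t3, -, t5, t6, t7, t8⟩
    simp only [List.length_nil, Nat.add_zero] at t3
    exact ⟨t1, t3, t5, t6, by rwa [← t3], fun x => t3 ▸ t8 x (by simp)⟩

variable [Fintype V]

/-- Stability at `u` depends only on the views at `u` and its neighbours, and adjacency is symmetric
through the inversion of labels. This is why only neighbours of a corrected vertex need to be
pushed. -/
theorem SquareComplex.stable_of_far {S : SquareComplex V (Fin α) (Fin β) X}
    {L : Set (Fin α → Fin β → Fin q)}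
    {z z' : V → Fin α → Fin β → Fin q} {u v : V} (hz : ∀ w ≠ v, z' w = z w) (huv : u ≠ v)
    (hnb : ∀ x, u ≠ S.neighbour (some x) v) (h : S.Stable L z u) : S.Stable L z' u := by
  have h1 : S.rowsAt z' u = S.rowsAt z u := by
    funext i j
    unfold rowsAt
    rw [hz]
    rintro rfl
    exact hnb (.inl (S.invL i)) (S.left_left i u).symm
  have h2 : S.colsAt z' u = S.colsAt z u := by
    funext i j
    unfold colsAt
    rw [hz]
    rintro rfl
    exact hnb (.inr (S.invR i)) (S.right_right i u).symm
  unfold Stable costAt at *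
  rw [h1, h2, hz u huv]
  exact h

/-- The invariant of the correction loop. -/
def LoopInvariant (S : SquareComplex V (Fin α) (Fin β) X) (eV : V ≃ Fin n) (eX : X ≃ Fin N)
    (y : X → Fin q) (L : Set (Fin α → Fin β → Fin q)) (z₀ : V → Fin α → Fin β → Fin q) (M k : ℕ)
    (σ : Store) : Prop :=
  HoldsWord S eV eX y σ ∧ k ≤ M ∧ ∃ z : V → Fin α → Fin β → Fin q,
    -- The weight of the potential exceeds the number of entries that one correction pushes.
    k = (α + β + 1) * S.potential z + σ 10 0 ∧ Relation.ReflTransGen (S.Step L) z₀ z ∧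
    (∀ v, σ 8 (eV v) = viewCode (z v)) ∧ (∀ k < σ 10 0, ∃ v, σ 9 k = eV v) ∧
    ∀ v, ¬ S.Stable L z v → ∃ k < σ 10 0, σ 9 k = eV v

/-- A pop shortens the stack. A correction adds `α + β` entries but lowers the potential by at least
1, which frees `α + β + 1`. The bound `M` keeps the stack size within the word size. -/
theorem exec_correctTop {L : Set (Fin α → Fin β → Fin q)} {z₀ : V → Fin α → Fin β → Fin q}
    {M : ℕ} (hrule : IsCorrection S L rule) (hW : 1 ≤ W) (hn : n ≤ W)
    (hK : viewCount α β q ≤ W) (hM : M + (α + β) ≤ W) (k : ℕ) (σ : Store)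
    (h : LoopInvariant S eV eX y L z₀ M k σ) (he : stackE.eval σ ≠ 0) :
    Exec W (correctTop rule) σ (16 * (α + β) + 20 +
        branchCost (fun x : Option (Fin α ⊕ Fin β) => .read 8 (neighbourE α β x))
          (viewCount α β q))
      fun τ => ∃ k' < k, LoopInvariant S eV eX y L z₀ M k' τ := by
  classical
  obtain ⟨h1, hkM, z, hk, hz, h8, h9, hst⟩ := h
  rw [eval_stackE] at he
  obtain ⟨v, hv⟩ := h9 (σ 10 0 - 1) (by omega)
  have hspW : σ 10 0 + (α + β) ≤ W := by omega
  have hev : (Expr.read 9 (.sub stackE (.lit 1))).eval σ = eV v := by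
    simpa [Expr.eval, stackE] using hv
  refine Exec.mono (T := 16 * (α + β) + 12 + branchCost
      (fun x : Option (Fin α ⊕ Fin β) => .read 8 (neighbourE α β x)) (viewCount α β q) + 7)
    (Exec.write_seq (by simpa [Expr.eval]) (hev ▸ (eV v).2.le.trans hn) ?_) (by omega)
    fun _ => id
  rw [hev]
  set σ' := Function.update σ 10 (Function.update (σ 10) ((Expr.lit 1).eval σ) (eV v)) with hσ'
  have g1 : HoldsWord S eV eX y σ' := h1.update 10 (by norm_num) _
  have g2 : σ' 10 1 = eV v := by simp [hσ', Expr.eval]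
  have g3 : σ' 10 0 = σ 10 0 := by simp [hσ', Expr.eval]
  have g8 : σ' 8 = σ 8 := by simp [hσ']
  have g9 : σ' 9 = σ 9 := by simp [hσ']
  have hval : ∀ x : Option (Fin α ⊕ Fin β),
      (Expr.read 8 (neighbourE α β x)).eval σ' = viewCode (z (S.neighbour x v)) := fun x => by
    simp only [Expr.eval, g1.eval_neighbour g2, g8, h8]
  refine Exec.branch (fun x => by rw [hval]; exact viewCode_le _) ?_
  simp only [hval, viewOf_viewCode]
  split
  · rename_i hr
    refine Exec.mono (Exec.write (by simp [Expr.eval])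
      (by simp only [Expr.eval, eval_stackE, g3]; omega) ?_)
      (by simp [stackE, Expr.cost]) fun _ => id
    set τ := Function.update σ' 10 (Function.update (σ' 10) ((Expr.lit 0).eval σ')
      ((stackE.sub (.lit 1)).eval σ')) with hτ
    have e0 : τ 10 0 = σ 10 0 - 1 := by simp [hτ, Expr.eval, eval_stackE, g3]
    have e8 : τ 8 = σ 8 := by rw [← g8]; simp [hτ]
    have e9 : τ 9 = σ 9 := by rw [← g9]; simp [hτ]
    refine ⟨k - 1, by omega, g1.update 10 (by norm_num) _, by omega, z, by omega, hz, ?_, ?_, ?_⟩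
    · rw [e8]; exact h8
    · rw [e9, e0]
      exact fun k hk => h9 k (by omega)
    · rw [e9, e0]
      intro u hu
      obtain ⟨m, hm, hm'⟩ := hst u hu
      -- The removed entry is the stable vertex `v`, so it is not the one that witnesses an unstable
      -- `u`.
      refine ⟨m, ?_, hm'⟩
      by_contra hcon
      have : m = σ 10 0 - 1 := by omega
      rw [this, hv] at hm'
      exact hu (eV.injective (Fin.ext hm') ▸ hrule.none z v hr)
  · rename_i t hr
    obtain ⟨htL, hlt⟩ := hrule.some z v t hr
    set z' := Function.update z v t with hz'
    have hz'v : ∀ u ≠ v, z' u = z u := fun u hu => Function.update_of_ne hu _ _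
    have hstep : S.Step L z z' := ⟨v, by simpa [hz'], by simpa [hz'], hz'v⟩
    have hpot := (SquareComplex.Step.potential_le S hstep).2
    set τ := Function.update σ' 8 (Function.update (σ' 8) (vertexE.eval σ')
      ((Expr.lit (viewCode t)).eval σ')) with hτ
    have e8 : ∀ u, τ 8 (eV u) = viewCode (z' u) := by
      intro u
      simp only [hτ, Function.update_self, eval_vertexE, g2, Expr.eval]
      by_cases hu : u = v
      · subst hu
        simp [hz']
      · have hne : (eV u : ℕ) ≠ eV v := fun e => hu (eV.injective (Fin.ext e))
        rw [Function.update_of_ne hne, hz'v u hu, g8, h8]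
    have e10 : τ 10 = σ' 10 := by simp [hτ]
    have e9 : τ 9 = σ 9 := by rw [← g9]; simp [hτ]
    have hpush := exec_pushNeighbours (σ := τ) (W := W) (v := v) (z := z') (sp := σ 10 0) hn hspW
      (g1.update 8 (by norm_num) _) (by rw [e10, g2]) (by rw [e10, g3]) e8
      (by rw [e9]; exact h9)
    refine Exec.mono (Exec.write_seq (by rw [eval_vertexE, g2]; exact (eV v).2.le.trans hn)
      ((viewCode_le _).trans hK) hpush) (by simp [vertexE, Expr.cost]) ?_
    rintro ρ ⟨r1, r2, r3, r4, r5, r6⟩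
    have hmul : (α + β + 1) * (S.potential z' + 1) ≤ (α + β + 1) * S.potential z :=
      Nat.mul_le_mul_left _ hpot
    rw [Nat.mul_add, Nat.mul_one] at hmul
    refine ⟨(α + β + 1) * S.potential z' + ρ 10 0, by omega, r1, by omega, z', rfl, hz.tail hstep,
      r3, by rwa [r2], ?_⟩
    -- An unstable vertex is `v` itself, which was not popped, or a neighbour just pushed, or far
    -- from `v` and so unstable before, hence already on the stack.
    intro u hu
    rw [r2]
    by_cases huv : u = v
    · subst huv
      exact ⟨σ 10 0 - 1, by omega, by rw [r4 _ (by omega), e9, hv]⟩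
    · by_cases hnb : ∃ x, u = S.neighbour (some x) v
      · obtain ⟨x, rfl⟩ := hnb
        exact r6 x
      · push Not at hnb
        obtain ⟨m, hm, hm'⟩ := hst u fun hs => hu (S.stable_of_far hz'v huv hnb hs)
        exact ⟨m, by omega, by rw [r4 m hm, e9, hm']⟩

end Decoder

universe u v

/-! ### Running time and correctness of the decoder -/

section Decoder

variable {α β q : ℕ} {V X : Type*} {n N : ℕ} {S : SquareComplex V (Fin α) (Fin β) X}
  {eV : V ≃ Fin n} {eX : X ≃ Fin N} {y : X → Fin q} {σ : Store}

/-- The cost of one correction. -/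
def correctCost (α β q : ℕ) : ℕ := 16 * (α + β) + 20 +
  branchCost (fun x : Option (Fin α ⊕ Fin β) => .read 8 (neighbourE α β x)) (viewCount α β q)

/-- The number of corrections per vertex. -/
def correctCount (α β : ℕ) : ℕ := (α + β + 1) * (2 * (α * β)) + 1

/-- The time per vertex that the decoder takes. -/
def vertexCost (α β q : ℕ) : ℕ :=
  (9 + branchCost (fun p : Fin α × Fin β => .read 4 (squareE p)) q + 9) +
    (correctCost α β q + 3) * correctCount α β +
    (13 * (α * β) + 1 + branchCost (fun _ : Unit => .read 8 vertexE) (viewCount α β q) + 9) + 21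

theorem localCost_le {I J K : Type*} [Fintype I] [Fintype J] (t r : I → J → K) (c : J → I → K) :
    localCost t r c ≤ 2 * (Fintype.card I * Fintype.card J) := by
  classical
  have h1 : (∑ i, if t i = r i then 0 else 1) ≤ Fintype.card I := by
    refine (Finset.sum_le_sum (g := fun _ => 1) fun i _ => by split_ifs <;> omega).trans ?_
    simp
  have h2 : (∑ j, if (fun i => t i j) = c j then 0 else 1) ≤ Fintype.card J := by
    refine (Finset.sum_le_sum (g := fun _ => 1) fun i _ => by split_ifs <;> omega).trans ?_
    simp
  have h3 := Nat.mul_le_mul_left (Fintype.card J) h1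
  have h4 := Nat.mul_le_mul_left (Fintype.card I) h2
  rw [Nat.mul_comm (Fintype.card J) (Fintype.card I)] at h3
  unfold localCost
  omega

theorem SquareComplex.potential_le [Fintype V] (S : SquareComplex V (Fin α) (Fin β) X)
    (z : V → Fin α → Fin β → Fin q) : S.potential z ≤ 2 * (α * β) * Fintype.card V := by
  refine (Finset.sum_le_sum fun v _ => localCost_le _ _ _).trans ?_
  simp [Nat.mul_comm]

/-- When the stack is empty all vertices are stable, and `hf` identifies the views with those of
`f`. The number of rounds is at most the initial measure, and the initial potential is at most `2 *
α * β * n`. -/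
theorem exec_decoder [Nonempty (Fin q)] [Fintype V] {W : ℕ}
    {init : (Fin α → Fin β → Fin q) → Fin α → Fin β → Fin q}
    {rule : (Option (Fin α ⊕ Fin β) → Fin α → Fin β → Fin q) → Option (Fin α → Fin β → Fin q)}
    {L : Set (Fin α → Fin β → Fin q)} {f : X → Fin q}
    (hrule : IsCorrection S L rule) (hn1 : 1 ≤ n) (hn : n ≤ W) (hN : N ≤ W) (hq : q ≤ W)
    (hK : viewCount α β q ≤ W) (hM : correctCount α β * n + (α + β) ≤ W)
    (h : HoldsWord S eV eX y σ)
    (hf : ∀ z, Relation.ReflTransGen (S.Step L) (fun v => init (S.viewAt y v)) z →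
      (∀ v, S.Stable L z v) → ∀ v, z v = S.viewAt f v) :
    Exec W (decoder init rule) σ (vertexCost α β q * n) fun τ => ∀ s, τ 7 (eX s) = f s := by
  have hW : 1 ≤ W := hn1.trans hn
  have hcard : Fintype.card V = n := by simpa using Fintype.card_congr eV
  set z₀ : V → Fin α → Fin β → Fin q := fun v => init (S.viewAt y v) with hz₀
  have hpot := S.potential_le z₀
  rw [hcard] at hpot
  have hM' : (α + β + 1) * S.potential z₀ + n ≤ correctCount α β * n := by
    have e : correctCount α β * n = (α + β + 1) * (2 * (α * β) * n) + n := by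
      rw [correctCount]
      ring
    rw [e]
    exact Nat.add_le_add_right (Nat.mul_le_mul_left _ hpot) _
  refine Exec.mono (Exec.seq (T' := (correctCost α β q + 3) * (correctCount α β * n) + 3 +
    ((13 * (α * β) + 1 + branchCost (fun _ : Unit => .read 8 vertexE) (viewCount α β q) + 9) * n
      + 7) + 4) ((exec_init hW hn hK h).mono le_rfl ?_)) ?_ fun _ => id
  · rintro σ₁ ⟨h1, h8⟩
    have hcd : (Expr.read 0 (.lit 0)).eval σ₁ = n := h1.card
    refine Exec.write_seq (by simp [Expr.eval]) (by rw [hcd]; exact hn) ?_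
    rw [hcd]
    set σ₂ := Function.update σ₁ 10 (Function.update (σ₁ 10) ((Expr.lit 0).eval σ₁) n) with hσ₂
    have g0 : σ₂ 10 0 = n := by simp [hσ₂, Expr.eval]
    have g8 : σ₂ 8 = σ₁ 8 := by simp [hσ₂]
    have g9 : σ₂ 9 = σ₁ 9 := by simp [hσ₂]
    have hI : LoopInvariant S eV eX y L z₀ (correctCount α β * n)
        ((α + β + 1) * S.potential z₀ + σ₂ 10 0) σ₂ := by
      refine ⟨h1.update 10 (by norm_num) _, by rwa [g0], z₀, rfl, .refl, ?_, ?_, ?_⟩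
      · rw [g8]; exact fun v => (h8 v).1
      · rw [g0, g9]
        intro k hk
        refine ⟨eV.symm ⟨k, hk⟩, ?_⟩
        have := (h8 (eV.symm ⟨k, hk⟩)).2
        simpa using this
      · rw [g0, g9]
        exact fun v _ => ⟨eV v, (eV v).2, (h8 v).2⟩
    have hloop := Exec.loop (exec_correctTop hrule hW hn hK hM) hI
    refine Exec.seq (hloop.mono (T' := (correctCost α β q + 3) * (correctCount α β * n) + 3) ?_ ?_)
    · rw [g0]
      have := Nat.mul_le_mul_left (correctCost α β q + 3) hM'
      have e : stackE.cost + (16 * (α + β) + 20 + branchCost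
          (fun x : Option (Fin α ⊕ Fin β) => .read 8 (neighbourE α β x)) (viewCount α β q)) + 1
          = correctCost α β q + 3 := by
        simp only [stackE, Expr.cost, correctCost]
        omega
      rw [e]
      simp only [stackE, Expr.cost]
      omega
    · rintro τ ⟨⟨k, h1, -, z, -, hz, h8, -, hst⟩, h0⟩
      rw [eval_stackE] at h0
      have hstable : ∀ v, S.Stable L z v := by
        intro v
        by_contra hv
        obtain ⟨k, hk, -⟩ := hst v hv
        omega
      have hzf := hf z hz hstable
      exact exec_output hW hn hN hq h1 fun v => by rw [h8, hzf]
  · have e : vertexCost α β q * n =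
        (9 + branchCost (fun p : Fin α × Fin β => .read 4 (squareE p)) q + 9) * n +
        (correctCost α β q + 3) * (correctCount α β * n) +
        (13 * (α * β) + 1 + branchCost (fun _ : Unit => .read 8 vertexE) (viewCount α β q) + 9) * n
        + 21 * n := by
      rw [vertexCost]
      ring
    rw [e]
    omega

open Classical in
/-- Correct the view if this lowers its cost to less than one half. -/
def correctionRule (L : Set (Fin α → Fin β → Fin q)) (iL : Fin α → Fin α) (iR : Fin β → Fin β)
    (w : Option (Fin α ⊕ Fin β) → Fin α → Fin β → Fin q) : Option (Fin α → Fin β → Fin q) :=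
  if h : ∃ t ∈ L, 2 * localCost t (fun i j => w (some (.inl i)) (iL i) j)
      (fun j i => w (some (.inr j)) i (iR j)) <
      localCost (w none) (fun i j => w (some (.inl i)) (iL i) j)
        (fun j i => w (some (.inr j)) i (iR j))
  then some h.choose else none

theorem isCorrection_correctionRule [Fintype V] (S : SquareComplex V (Fin α) (Fin β) X)
    (L : Set (Fin α → Fin β → Fin q)) : IsCorrection S L (correctionRule L S.invL S.invR) where
  none z v h := by
    unfold correctionRule at h
    split_ifs at h with h'
    push Not at h'
    exact h'
  some z v t h := by
    unfold correctionRule at h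
    split_ifs at h with h'
    rw [← Option.some.inj h]
    exact h'.choose_spec

open Classical in
/-- Keep the view if it is in `L`. -/
def initialView (L : Set (Fin α → Fin β → Fin q)) (t : Fin α → Fin β → Fin q) :
    Fin α → Fin β → Fin q :=
  if t ∈ L then t else if h : L.Nonempty then h.some else t

theorem initialView_mem {L : Set (Fin α → Fin β → Fin q)} (hL : L.Nonempty)
    (t : Fin α → Fin β → Fin q) : initialView L t ∈ L := by
  unfold initialView
  split_ifs with h
  · exact h
  · exact hL.some_mem

theorem initialView_of_mem {L : Set (Fin α → Fin β → Fin q)} {t : Fin α → Fin β → Fin q}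
    (h : t ∈ L) : initialView L t = t := if_pos h

end Decoder

/-! ### Problems that are solvable in linear time -/

/-- There is a program that, for all inputs `σ` of size `N` with the property `Pre N σ Q`, produces
an output with the property `Q` in linear time. -/
def LinSolvable (Pre : ℕ → Store → (Store → Prop) → Prop) : Prop :=
  ∃ (P : Prog) (c : ℕ), ∀ N σ Q, Pre N σ Q → ∀ W, c * N ≤ W → Exec W P σ (c * N) Q

theorem LinSolvable.mono {Pre Pre' : ℕ → Store → (Store → Prop) → Prop} (h : LinSolvable Pre)
    (hP : ∀ N σ Q, Pre' N σ Q → Pre N σ Q) : LinSolvable Pre' := by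
  obtain ⟨P, c, h⟩ := h
  exact ⟨P, c, fun N σ Q hQ => h N σ Q (hP N σ Q hQ)⟩

/-- Case distinction according to the values of finitely many bounded expressions. -/
theorem LinSolvable.branch {ι : Type*} [Fintype ι] {e : ι → Expr} {K : ℕ}
    {Pre : ℕ → Store → (Store → Prop) → Prop} (hN : ∀ N σ Q, Pre N σ Q → 1 ≤ N)
    (hK : ∀ N σ Q, Pre N σ Q → ∀ i, (e i).eval σ ≤ K)
    (h : ∀ v : ι → ℕ, LinSolvable fun N σ Q => Pre N σ Q ∧ ∀ i, (e i).eval σ = v i) :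
    LinSolvable Pre := by
  classical
  choose P c hPc using h
  -- Only finitely many value vectors occur, so one constant dominates the constants of all
  -- branches.
  set C : ℕ := ∑ v : ι → Fin (K + 1), c fun i => v i with hC
  refine ⟨SquareLTC.branch e K P, C + branchCost e K, fun N σ Q hQ W hW => ?_⟩
  have hb := hK N σ Q hQ
  have hc : c (fun i => (e i).eval σ) ≤ C :=
    Finset.single_le_sum (f := fun v : ι → Fin (K + 1) => c fun i => (v i : ℕ))
      (fun _ _ => Nat.zero_le _)
      (Finset.mem_univ fun i => (⟨(e i).eval σ, Nat.lt_succ_of_le (hb i)⟩ : Fin (K + 1)))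
  have hcN := Nat.mul_le_mul_right N hc
  rw [Nat.add_mul] at hW ⊢
  have h1 := hPc (fun i => (e i).eval σ) N σ Q ⟨hQ, fun _ => rfl⟩ W (by omega)
  have h2 := Nat.le_mul_of_pos_right (branchCost e K) (hN N σ Q hQ)
  exact (Exec.branch hb h1).mono (by omega) fun _ => id

/-- The task to decode a word on a square complex when the codes `CA`, `CB` and the inversion of
the labels are known. -/
inductive DecodingTask {α β q : ℕ} (CA : Set (Fin α → Fin q)) (CB : Set (Fin β → Fin q))
    (iL : Fin α → Fin α) (iR : Fin β → Fin β) (N : ℕ) (σ : Store) : (Store → Prop) → Prop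
  | intro {V : Type u} {X : Type v} [Fintype V] (S : SquareComplex V (Fin α) (Fin β) X) {n : ℕ}
      (eV : V ≃ Fin n) (eX : X ≃ Fin N) (y f : X → Fin q) (hσ : HoldsWord S eV eX y σ)
      (hL : S.invL = iL) (hR : S.invR = iR) (hn1 : 1 ≤ n) (hn : n ≤ 4 * N)
      (hne : (productCode CA CB).Nonempty)
      (hf : ∀ z₀ z : V → Fin α → Fin β → Fin q, (∀ v, z₀ v ∈ productCode CA CB) →
        (∀ v, S.viewAt y v ∈ productCode CA CB → z₀ v = S.viewAt y v) →
        Relation.ReflTransGen (S.Step (productCode CA CB)) z₀ z →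
        (∀ v, S.Stable (productCode CA CB) z v) → ∀ v, z v = S.viewAt f v) :
      DecodingTask CA CB iL iR N σ fun τ => ∀ s, τ 7 (eX s) = f s

theorem DecodingTask.one_le {α β q : ℕ} {CA : Set (Fin α → Fin q)} {CB : Set (Fin β → Fin q)}
    {iL : Fin α → Fin α} {iR : Fin β → Fin β} {N : ℕ} {σ : Store} {Q : Store → Prop}
    (h : DecodingTask.{u, v} CA CB iL iR N σ Q) : 1 ≤ N := by
  cases h
  omega

/-- For fixed codes and inversions the rules are fixed maps between finite sets. Although they are
obtained by choice, each branch of the program contains their value as a literal. -/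
theorem linSolvable_decodingTask {α β q : ℕ} (CA : Set (Fin α → Fin q))
    (CB : Set (Fin β → Fin q)) (iL : Fin α → Fin α) (iR : Fin β → Fin β) :
    LinSolvable (DecodingTask.{u, v} CA CB iL iR) := by
  rcases isEmpty_or_nonempty (Fin q) with hq | hq
  -- With an empty alphabet there is no received word, since there is at least one square.
  · refine ⟨.skip, 0, fun N σ Q hQ => ?_⟩
    have := hQ.one_le
    obtain @⟨V, X, _, S, n, eV, eX, y, f, -⟩ := hQ
    exact isEmptyElim (y (eX.symm ⟨0, this⟩))
  refine ⟨decoder (initialView (productCode CA CB)) (correctionRule (productCode CA CB) iL iR),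
    -- The constant also has to provide words large enough for view codes, letters, vertex numbers
    -- and the stack size; `n ≤ 4 * N` accounts for the factors 4.
    4 * vertexCost α β q + q + viewCount α β q + 4 * correctCount α β + (α + β) + 5,
    fun N σ Q hQ W hW => ?_⟩
  have hN := hQ.one_le
  obtain @⟨V, X, _, S, n, eV, eX, y, f, hσ, rfl, rfl, hn1, hn, hne, hf⟩ := hQ
  have k1 := Nat.mul_le_mul_left (vertexCost α β q) hn
  have k2 := Nat.mul_le_mul_left (correctCount α β) hn
  have k3 := Nat.le_mul_of_pos_right q hN
  have k4 := Nat.le_mul_of_pos_right (viewCount α β q) hN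
  have k5 := Nat.le_mul_of_pos_right (α + β) hN
  have e : (4 * vertexCost α β q + q + viewCount α β q + 4 * correctCount α β + (α + β) + 5) * N =
      vertexCost α β q * (4 * N) + q * N + viewCount α β q * N + correctCount α β * (4 * N)
        + (α + β) * N + 5 * N := by ring
  rw [e] at hW ⊢
  refine (exec_decoder (isCorrection_correctionRule S _) hn1 (by omega) (by omega) (by omega)
    (by omega) (by omega) hσ fun z hz hs => hf _ z (fun v => initialView_mem hne _)
      (fun v hv => initialView_of_mem hv) hz hs).mono (by omega) fun _ => id

/-- The values that determine the codes and the inversions of the labels. -/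
def tableE (α β q : ℕ) : (Fin α → Fin q) ⊕ (Fin β → Fin q) ⊕ (Fin α × Fin α) ⊕ (Fin β × Fin β) →
    Expr
  | .inl w => .read 5 (.lit (∑ j, (w j : ℕ) * q ^ (j : ℕ)))
  | .inr (.inl w) => .read 6 (.lit (∑ j, (w j : ℕ) * q ^ (j : ℕ)))
  | .inr (.inr (.inl p)) =>
    -- Truncated subtraction turns the test whether two label moves lead from vertex 0 back to it
    -- into a bit, so that the branching is bounded.
    .sub (.lit 1) (.read 1 (.add (.mul (.read 1 (.lit p.1)) (.lit α)) (.lit p.2)))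
  | .inr (.inr (.inr p)) =>
    .sub (.lit 1) (.read 2 (.add (.mul (.read 2 (.lit p.1)) (.lit β)) (.lit p.2)))

/-- The task to decode a word on a square complex when the codes and the inversion of the labels
are given by tables. -/
def TableTask (α β q : ℕ) (N : ℕ) (σ : Store) (Q : Store → Prop) : Prop :=
  ∃ (CA : Set (Fin α → Fin q)) (CB : Set (Fin β → Fin q)) (iL : Fin α → Fin α)
    (iR : Fin β → Fin β), DecodingTask.{u, v} CA CB iL iR N σ Q ∧
    (∀ w ∈ CA, σ 5 (∑ j, (w j : ℕ) * q ^ (j : ℕ)) = 1) ∧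
    (∀ w ∉ CA, σ 5 (∑ j, (w j : ℕ) * q ^ (j : ℕ)) = 0) ∧
    (∀ w ∈ CB, σ 6 (∑ j, (w j : ℕ) * q ^ (j : ℕ)) = 1) ∧
    (∀ w ∉ CB, σ 6 (∑ j, (w j : ℕ) * q ^ (j : ℕ)) = 0) ∧
    (∀ i i' : Fin α, σ 1 (σ 1 i * α + i') = 0 ↔ i' = iL i) ∧
    ∀ j j' : Fin β, σ 2 (σ 2 j * β + j') = 0 ↔ j' = iR j

open Classical in
/-- A function with the given graph. -/
def functionOf {ι : Type*} (r : ι → ι → Prop) (i : ι) : ι := if h : ∃ k, r i k then h.choose else i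

theorem functionOf_eq {ι : Type*} {r : ι → ι → Prop} {f : ι → ι} (h : ∀ i k, r i k ↔ k = f i) :
    functionOf r = f := by
  funext i
  have h' : ∃ k, r i k := ⟨f i, (h i _).2 rfl⟩
  rw [functionOf, dif_pos h']
  exact (h i _).1 h'.choose_spec

/-- Branching on all membership bits and inversion bits reconstructs `CA`, `CB`, `iL`, `iR` from the
memory. -/
theorem linSolvable_tableTask (α β q : ℕ) : LinSolvable (TableTask.{u, v} α β q) := by
  classical
  refine LinSolvable.branch (e := tableE α β q) (K := 1)
    (fun N σ Q ⟨CA, CB, iL, iR, h, _⟩ => h.one_le) ?_ fun val => ?_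
  · rintro N σ Q ⟨CA, CB, iL, iR, h, h1, h2, h3, h4, h5, h6⟩ (w | w | p | p)
    · by_cases hw : w ∈ CA
      · exact (h1 w hw).le
      · exact (h2 w hw).le.trans zero_le_one
    · by_cases hw : w ∈ CB
      · exact (h3 w hw).le
      · exact (h4 w hw).le.trans zero_le_one
    · exact Nat.sub_le _ _
    · exact Nat.sub_le _ _
  · refine (linSolvable_decodingTask.{u, v} {w | val (.inl w) = 1} {w | val (.inr (.inl w)) = 1}
      (functionOf fun i i' => val (.inr (.inr (.inl (i, i')))) = 1)
      (functionOf fun i i' => val (.inr (.inr (.inr (i, i')))) = 1)).mono ?_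
    rintro N σ Q ⟨⟨CA, CB, iL, iR, h, h1, h2, h3, h4, h5, h6⟩, hv⟩
    have e1 : {w | val (.inl w) = 1} = CA := by
      ext w
      rw [Set.mem_ofPred_eq, ← hv (.inl w)]
      refine ⟨fun hw => ?_, h1 w⟩
      by_contra hcon
      exact zero_ne_one ((h2 w hcon).symm.trans hw)
    have e2 : {w | val (.inr (.inl w)) = 1} = CB := by
      ext w
      rw [Set.mem_ofPred_eq, ← hv (.inr (.inl w))]
      refine ⟨fun hw => ?_, h3 w⟩
      by_contra hcon
      exact zero_ne_one ((h4 w hcon).symm.trans hw)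
    have hsub : ∀ a : ℕ, 1 - a = 1 ↔ a = 0 := by omega
    have e3 : (functionOf fun i i' => val (.inr (.inr (.inl (i, i')))) = 1) = iL :=
      functionOf_eq fun i k => by
        rw [← hv, ← h5]
        exact hsub _
    have e4 : (functionOf fun i i' => val (.inr (.inr (.inr (i, i')))) = 1) = iR :=
      functionOf_eq fun i k => by
        rw [← hv, ← h6]
        exact hsub _
    rw [e1, e2, e3, e4]
    exact h

/-- The task to decode a word on a square complex with at most `m` labels and letters. -/
def BoundedTask (m N : ℕ) (σ : Store) (Q : Store → Prop) : Prop :=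
  (∀ k : Fin 3, σ 0 (k + 1) ≤ m) ∧ TableTask.{u, v} (σ 0 1) (σ 0 2) (σ 0 3) N σ Q

/-- The sizes of the tables are themselves read from the memory, so this outer branching on three
numbers at most `m` makes the program depend on `m` only. -/
theorem linSolvable_boundedTask (m : ℕ) : LinSolvable (BoundedTask.{u, v} m) := by
  refine LinSolvable.branch (e := fun k : Fin 3 => .read 0 (.lit (k + 1))) (K := m)
    (fun N σ Q ⟨_, CA, CB, iL, iR, h, _⟩ => h.one_le) (fun N σ Q h => h.1) fun val => ?_
  refine (linSolvable_tableTask.{u, v} (val 0) (val 1) (val 2)).mono ?_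
  rintro N σ Q ⟨⟨-, h⟩, hv⟩
  rw [← hv, ← hv, ← hv]
  exact h

/-! ### The input of the decoder as a bounded decoding task -/

section Cayley

variable {G : Type u} [Group G] [Fintype G] {A B : Finset G} {F : Type*} [Field F] [Fintype F]
  {CA : Submodule F (A → F)} {CB : Submodule F (B → F)}

theorem isInput_boundedTask (h : IsDoubleCayley A B) [Nonempty A] [Nonempty B] {ε : ℝ}
    (hε : 0 < ε) (hε1 : ε ≤ 1) (hA : SeparatedBy (CA : Set (A → F)) ε)
    (hB : SeparatedBy (CB : Set (B → F)) ε) (hagr : AgreementTestable CA CB ε)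
    (hxA : IsExpander (leftCayley (A : Set G)) (ε ^ 2 / 2500))
    (hxB : IsExpander (SimpleGraph.mulCayley (B : Set G)) (ε ^ 2 / 2500))
    {m : ℕ} (hAm : A.card ≤ m) (hBm : B.card ≤ m) (hFm : Fintype.card F ≤ m)
    (num : Numbering F A B) {f f' : Squares A B → F} (hf' : f' ∈ codeCAGB A B CA CB)
    (hd : A.card * B.card * relHamming f f' * (4800 * max (A.card : ℝ) B.card) < ε ^ 3)
    {σ : Store} (hσ : IsInput num CA CB f σ) :
    BoundedTask.{u, u} m (Nat.card (Squares A B)) σ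
      fun τ => ∀ s, τ 7 (num.squares s) = num.field (f' s) := by
  have hα : 0 < A.card := by rw [← Fintype.card_coe]; exact Fintype.card_pos
  have hβ : 0 < B.card := by rw [← Fintype.card_coe]; exact Fintype.card_pos
  have : Nonempty (Fin A.card) := ⟨⟨0, hα⟩⟩
  have : Nonempty (Fin B.card) := ⟨⟨0, hβ⟩⟩
  refine ⟨?_, ?_⟩
  · intro k
    fin_cases k
    · exact hσ.card_left.trans_le hAm
    · exact hσ.card_right.trans_le hBm
    · exact hσ.card_field.trans_le (by rwa [Nat.card_eq_fintype_card])
  rw [hσ.card_left, hσ.card_right, hσ.card_field]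
  set S := cayleyComplex h num.left.symm num.right.symm with hS
  have hHolds : HoldsWord S num.group num.squares (fun s => num.field (f s)) σ := by
    refine ⟨hσ.card_group, fun v i => ?_, fun v j => ?_, fun v i j => ?_, hσ.word⟩
    · simpa [hS, cayleyComplex] using hσ.left_mul v (num.left.symm i)
    · simpa [hS, cayleyComplex] using hσ.right_mul v (num.right.symm j)
    · simpa [hS, cayleyComplex] using hσ.square v (num.left.symm i) (num.right.symm j)
  have hidx : ∀ {ι : Type _} {k : ℕ} (pos : ι ≃ Fin k) (w : Fin k → Fin (Nat.card F)),
      wordIndex pos num.field (fun a => num.field.symm (w (pos a))) =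
        ∑ j, (w j : ℕ) * Nat.card F ^ (j : ℕ) := by
    intro ι k pos w
    simp [wordIndex]
  have hn1 : 1 ≤ Nat.card G := Nat.card_pos
  -- Inversion of labels is detected at the vertex with number 0: two moves return to it iff their
  -- labels are inverse. The group identity may have any number.
  set v₀ : G := num.group.symm ⟨0, hn1⟩ with hv₀
  have hv₀' : (num.group v₀ : ℕ) = 0 := by simp [hv₀]
  have hzero : ∀ v : G, (num.group v : ℕ) = 0 ↔ v = v₀ := fun v =>
    ⟨fun hv => num.group.injective (Fin.ext (hv.trans hv₀'.symm)), fun hv => hv ▸ hv₀'⟩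
  refine ⟨relabel num.left.symm num.field.symm (CA : Set (A → F)),
    relabel num.right.symm num.field.symm (CB : Set (B → F)), S.invL, S.invR, ?_,
    fun w hw => ?_, fun w hw => ?_, fun w hw => ?_, fun w hw => ?_, fun i i' => ?_,
    fun j j' => ?_⟩
  · refine DecodingTask.intro S num.group num.squares (fun s => num.field (f s))
      (fun s => num.field (f' s)) hHolds rfl rfl hn1 ?_
      -- The zero matrix, written with the numbers of the letters.
      ⟨fun _ _ => num.field 0, fun _ => ?_, fun _ => ?_⟩ fun z₀ z hz₀ hzy hz hs => ?_
    · have := S.card_squares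
      rw [Fintype.card_fin, Fintype.card_fin] at this
      rw [Nat.card_eq_fintype_card, Nat.card_eq_fintype_card, this]
      exact (Nat.le_mul_of_pos_right _ hα).trans (Nat.le_mul_of_pos_right _ hβ)
    · simp only [relabel, Set.mem_ofPred_eq, Equiv.symm_apply_apply]
      exact CB.zero_mem
    · simp only [relabel, Set.mem_ofPred_eq, Equiv.symm_apply_apply]
      exact CA.zero_mem
    · refine SquareComplex.eq_view_of_steps hε hε1 (hA.relabel _ _) (hB.relabel _ _)
        (hagr.costTestable _ _ _) (expanderForm_left h _ _ (by positivity) hxA)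
        (expanderForm_right h _ _ (by positivity) hxB) hz₀ hzy hz hs
        ((mem_codeCAGB_iff h _ _ _ _).2 (by simpa using hf')) ?_
      rw [Fintype.card_fin, Fintype.card_fin]
      have : relHamming (fun s => num.field (f s)) (fun s => num.field (f' s)) = relHamming f f' :=
        relHamming_relabel (Equiv.refl _) num.field f f'
      rwa [this]
  · rw [← hidx num.left w]
    exact hσ.mem_left _ hw
  · rw [← hidx num.left w]
    exact hσ.notMem_left _ hw
  · rw [← hidx num.right w]
    exact hσ.mem_right _ hw
  · rw [← hidx num.right w]
    exact hσ.notMem_right _ hw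
  · have e1 := hHolds.left v₀ i
    rw [hv₀', Nat.zero_mul, Nat.zero_add] at e1
    rw [e1, hHolds.left, hzero]
    constructor
    · intro hi
      have : S.left i' (S.left i v₀) = S.left (S.invL i) (S.left i v₀) :=
        hi.trans (S.left_left i v₀).symm
      exact num.left.symm.injective (Subtype.ext (mul_right_cancel this))
    · rintro rfl
      exact S.left_left i v₀
  · have e1 := hHolds.right v₀ j
    rw [hv₀', Nat.zero_mul, Nat.zero_add] at e1
    rw [e1, hHolds.right, hzero]
    constructor
    · intro hj
      have : S.right j' (S.right j v₀) = S.right (S.invR j) (S.right j v₀) :=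
        hj.trans (S.right_right j v₀).symm
      exact num.right.symm.injective (Subtype.ext (mul_left_cancel this))
    · rintro rfl
      exact S.right_right j v₀

end Cayley

end SquareLTC

end

/-- For every bound `m` there are a program `P` and a constant `c`, so that for all
`G, A, B, F, C_A, C_B, ε` as in the hypotheses the code `C(A, G, B)` has the stated relative
distance, rate and soundness of its natural tester and, if moreover `|A|, |B|, |F| ≤ m`, then `P`
decodes `C(A, G, B)` up to the stated radius in at most `c * |X(2)|` steps. -/
theorem mainTheorem11 (m : ℕ) :
    ∃ (P : SquareLTC.Prog) (c : ℕ),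
      ∀ (G : Type*) [Group G] [Fintype G] (A B : Finset G)
        (F : Type*) [Field F] [Fintype F]
        (CA : Submodule F (A → F)) (CB : Submodule F (B → F)) (ε : ℝ),
      A.Nonempty → B.Nonempty →
      (1 : G) ∉ A → (1 : G) ∉ B →
      (∀ a ∈ A, a⁻¹ ∈ A) → (∀ b ∈ B, b⁻¹ ∈ B) →
      Subgroup.closure (A : Set G) = ⊤ → Subgroup.closure (B : Set G) = ⊤ →
      (∀ a ∈ A, ∀ b ∈ B, ∀ g : G, g * a * g⁻¹ ≠ b) →
      ε ∈ Set.Ioc (0 : ℝ) 1 →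
      (ε : EReal) ≤ SquareLTC.relDist (CA : Set (A → F)) →
      (ε : EReal) ≤ SquareLTC.relDist (CB : Set (B → F)) →
      SquareLTC.AgreementTestable CA CB ε →
      SquareLTC.IsExpander (SquareLTC.leftCayley (A : Set G)) (ε ^ 2 / 2500) →
      SquareLTC.IsExpander (SimpleGraph.mulCayley (B : Set G)) (ε ^ 2 / 2500) →
      ((0.9996 * ε ^ 3 : ℝ) : EReal) ≤ SquareLTC.relDist (SquareLTC.codeCAGB A B CA CB) ∧
      4 * SquareLTC.rate (CA : Set (A → F)) * SquareLTC.rate (CB : Set (B → F)) - 3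
        ≤ SquareLTC.rate (SquareLTC.codeCAGB A B CA CB) ∧
      (SquareLTC.smallCodes A B CA CB).TesterHasSoundness
        (1 / (2 * max ((A.card : ℝ) / B.card) ((B.card : ℝ) / A.card)
          * (250000 * (ε ^ 3)⁻¹ + 4800 * max (A.card : ℝ) B.card * ε⁻¹) + 1)) ∧
      (A.card ≤ m → B.card ≤ m → Fintype.card F ≤ m →
        SquareLTC.Decodes P (c * Nat.card (SquareLTC.Squares A B)) A B CA CB
          (1 / ((A.card : ℝ) * B.card)
            * (1 / (250000 * (ε ^ 5)⁻¹ + 4800 * max (A.card : ℝ) B.card * (ε ^ 3)⁻¹)))) := by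
  obtain ⟨P, c, hP⟩ := SquareLTC.linSolvable_boundedTask m
  refine ⟨P, c, ?_⟩
  intro G _ _ A B F _ _ CA CB ε hA0 hB0 hA1 hB1 hAinv hBinv _ _ hconj hε hdA hdB hagr hxA hxB
  have h : SquareLTC.IsDoubleCayley A B := ⟨hA1, hB1, hAinv, hBinv, hconj⟩
  have : Nonempty A := hA0.to_subtype
  have : Nonempty B := hB0.to_subtype
  rw [SquareLTC.le_relDist_iff] at hdA hdB
  refine ⟨(SquareLTC.le_relDist_iff _ _).2
    (SquareLTC.codeCAGB_separated h hε.1 hε.2 hdA hdB hxA),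
    SquareLTC.le_rate_codeCAGB h CA CB,
    SquareLTC.natural_tester_soundness h hε.1 hε.2 hagr hxA hxB, ?_⟩
  intro hAm hBm hFm num f f' hf' hd σ hσ
  refine hP _ σ _ (SquareLTC.isInput_boundedTask h hε.1 hε.2 hdA hdB hagr hxA hxB hAm hBm hFm num
    hf' ?_ hσ) _ le_rfl
  have hε0 := hε.1
  have ha : (0 : ℝ) < A.card := by exact_mod_cast hA0.card_pos
  have hb : (0 : ℝ) < B.card := by exact_mod_cast hB0.card_pos
  have hD : 0 < max (A.card : ℝ) B.card := lt_max_of_lt_left ha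
  -- Discarding the first summand enlarges the radius to `ε ^ 3 / (4800 * |A| * |B| * max)`, which
  -- is what `eq_view_of_steps` tolerates.
  have h1 : 4800 * max (A.card : ℝ) B.card * (ε ^ 3)⁻¹ ≤
      250000 * (ε ^ 5)⁻¹ + 4800 * max (A.card : ℝ) B.card * (ε ^ 3)⁻¹ :=
    le_add_of_nonneg_left (by positivity)
  have h2 := one_div_le_one_div_of_le (by positivity) h1
  have h3 := hd.trans_le (mul_le_mul_of_nonneg_left h2 (by positivity))
  have h4 := mul_lt_mul_of_pos_left h3
    (by positivity : 0 < A.card * B.card * (4800 * max (A.card : ℝ) B.card))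
  refine lt_of_eq_of_lt (by ring) (h4.trans_eq ?_)
  field_simp
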